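/- Identify $\mathbb{R}^4$ with the quaternions $\mathbb{H}$ and $S^3=SU(2)$ with the unit quaternions, and let $M=\mathbb{R}^4\times S^3$. Identify the complement of the zero section $\{0\}\times S^3$ with $(9/4,\infty)\times S^3\times S^3$ by $(r,p,q)\mapsto(\sqrt{r-9/4}\,q,\;pq^{-1})$. Let $\sigma_i,\sigma_i'$ $(i=1,2,3)$ be the left-invariant coframes on the two factors $S^3$ (with coordinates $p$ and $q$), i.e. $p^{-1}dp=\sum\sigma_iT_i$, $q^{-1}dq=\sum\sigma'_iT_i$ with $[T_i,T_j]=2\varepsilon_{ijk}T_k$, and put $\eta_i^{\pm}=\tfrac12(\sigma_i\pm\sigma_i')$. Put $$A_1=\sqrt{\frac{(r-\frac94)(r+\frac94)}{(r-\frac34)(r+\frac34)}},\quad A_2=\sqrt{\tfrac13(r-\tfrac94)(r+\tfrac34)},\quad B_1=\tfrac{2r}{3},\quad B_2=\sqrt{\tfrac13(r+\tfrac94)(r-\tfrac34)},\quad ds=\sqrt{\frac{(r-\frac34)(r+\frac34)}{(r-\frac94)(r+\frac94)}}\,dr,$$ and, with adjacent $1$-forms wedged together ($\eta^{+-}_{jk}=\eta_j^+\wedge\eta_k^-$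 etc.), $$\omega=4A_1B_1\eta^{-+}_{11}+4A_2B_2(\eta^{-+}_{22}+\eta^{-+}_{33}),$$ $$\Omega^+=8B_1B_2^2\eta^{---}_{123}-8A_1A_2B_2(\eta^{++-}_{123}+\eta^{+-+}_{123})-8A_2^2B_1\eta^{-++}_{123},$$ $$\Omega^-=-8A_2^2A_1\eta^{+++}_{123}+8B_1B_2A_2(\eta^{--+}_{123}+\eta^{-+-}_{123})+8A_1B_2^2\eta^{+--}_{123}.$$ **Theorem.** (1) The forms $ds\wedge\omega+\Omega^+$ and $\tfrac12\omega\wedge\omega-ds\wedge\Omega^-$ extend smoothly over the zero section to forms $\varphi$ and $\psi$ on $M$ such that $\varphi$ is a $G_2$-structure, $\psi=*_\varphi\varphi$, and $d\varphi=0=d{*_\varphi\varphi}$ (the torsion-free BGGG $G_2$-structure). (2) For every $c\in(0,\pi/2)$ there is a unique continuous function $f_c:[9/4,\infty)\to\mathbb{R}$ with $f_c(9/4)=0$ such that, for all $r\ge 9/4$, $\cos(f_c(r)/3+c)\neq0$ and $$24\tan\!\big(f_c(r)/3+c\big)\,f_c(r)=16r^2-81 .$$ It is non-negative and $f_c(r)\to\frac{3\pi}{2}-3c$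 as $r\to\infty$. (3) For every $c\in(0,\pi/2)$ the form $A_c=f_c(r)\,\eta_1^+$, extended by $0$ over the zero section, is a smooth $1$-form on $M$, and, regarded as a connection on the trivial $U(1)$-bundle (with $\mathfrak u(1)=\mathbb{R}$), it is a deformed $G_2$-instanton: its curvature $F=dA_c$ satisfies $\frac16F\wedge F\wedge F-F\wedge *_\varphi\varphi=0$ on all of $M$. (4) As $c\to\pi/2$ (from below) the connections $A_c$ converge to the flat connection $0$: $f_c\to0$ uniformly on $[9/4,\infty)$, and $A_c\to0$ with all derivatives, uniformly on compact subsets of $M$. -/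

import Mathlib

open scoped Manifold ContDiff Quaternion

noncomputable section

namespace BGGG

/-! ### Exterior algebra of the dual of a real topological vector space -/

section Exterior

variable {V : Type*} [AddCommGroup V] [Module ℝ V] [TopologicalSpace V]

/-- The (not yet antisymmetrised) product
`(v₁, …, v_{k+l}) ↦ α(v₁, …, v_k) β(v_{k+1}, …, v_{k+l})`. -/
def tensorForm {k l : ℕ} (α : V [⋀^Fin k]→L[ℝ] ℝ) (β : V [⋀^Fin l]→L[ℝ] ℝ) :
    ContinuousMultilinearMap ℝ (fun _ : Fin (k + l) => V) ℝ where
  toMultilinearMap :=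
    ((LinearMap.mul' ℝ ℝ).compMultilinearMap
      (MultilinearMap.domCoprod α.toAlternatingMap.toMultilinearMap
        β.toAlternatingMap.toMultilinearMap)).domDomCongr finSumFinEquiv
  cont := by
    change Continuous fun v : Fin (k + l) → V =>
      α (fun i => v (Fin.castAdd l i)) * β (fun j => v (Fin.natAdd k j))
    exact (α.cont.comp (by fun_prop)).mul (β.cont.comp (by fun_prop))

theorem tensorForm_apply {k l : ℕ} (α : V [⋀^Fin k]→L[ℝ] ℝ) (β : V [⋀^Fin l]→L[ℝ] ℝ)
    (v : Fin (k + l) → V) :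
    tensorForm α β v =
      α (fun i => v (Fin.castAdd l i)) * β (fun j => v (Fin.natAdd k j)) := rfl

/-- The wedge product
`(α ∧ β)(v₁, …, v_{k+l}) = 1/(k! l!) ∑_σ sgn σ α(v_{σ1}, …) β(v_{σ(k+1)}, …)`. -/
def wedge {k l : ℕ} (α : V [⋀^Fin k]→L[ℝ] ℝ) (β : V [⋀^Fin l]→L[ℝ] ℝ) :
    V [⋀^Fin (k + l)]→L[ℝ] ℝ :=
  ((k.factorial : ℝ) * (l.factorial : ℝ))⁻¹ •
    ContinuousMultilinearMap.alternatization (tensorForm α β)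

/-- A covector regarded as an alternating 1-form. -/
def oneForm (a : V →L[ℝ] ℝ) : V [⋀^Fin 1]→L[ℝ] ℝ :=
  ContinuousAlternatingMap.ofSubsingleton ℝ V ℝ (0 : Fin 1) a

/-- `a ∧ b` for covectors. -/
def wedge2 (a b : V →L[ℝ] ℝ) : V [⋀^Fin 2]→L[ℝ] ℝ := wedge (oneForm a) (oneForm b)

/-- `a ∧ b ∧ c` for covectors. -/
def wedge3 (a b c : V →L[ℝ] ℝ) : V [⋀^Fin 3]→L[ℝ] ℝ := wedge (wedge2 a b) (oneForm c)

/-- `a ∧ b ∧ c ∧ d` for covectors. -/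
def wedge4 (a b c d : V →L[ℝ] ℝ) : V [⋀^Fin 4]→L[ℝ] ℝ := wedge (wedge3 a b c) (oneForm d)

/-- The model 3-form `e¹²³ + e¹⁴⁵ + e¹⁶⁷ + e²⁴⁶ - e²⁵⁷ - e³⁴⁷ - e³⁵⁶`
(indices are shifted by one, since `Fin 7` starts at `0`). -/
def modelThreeForm (e : Fin 7 → V →L[ℝ] ℝ) : V [⋀^Fin 3]→L[ℝ] ℝ :=
  wedge3 (e 0) (e 1) (e 2) + wedge3 (e 0) (e 3) (e 4) + wedge3 (e 0) (e 5) (e 6)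
    + wedge3 (e 1) (e 3) (e 5) - wedge3 (e 1) (e 4) (e 6) - wedge3 (e 2) (e 3) (e 6)
    - wedge3 (e 2) (e 4) (e 5)

/-- The Hodge dual of `modelThreeForm e` for the metric and orientation for which `e` is an
oriented orthonormal coframe:
`e⁴⁵⁶⁷ + e²³⁶⁷ + e²³⁴⁵ + e¹³⁵⁷ - e¹³⁴⁶ - e¹²⁵⁶ - e¹²⁴⁷`. -/
def modelFourForm (e : Fin 7 → V →L[ℝ] ℝ) : V [⋀^Fin 4]→L[ℝ] ℝ :=
  wedge4 (e 3) (e 4) (e 5) (e 6) + wedge4 (e 1) (e 2) (e 5) (e 6)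
    + wedge4 (e 1) (e 2) (e 3) (e 4) + wedge4 (e 0) (e 2) (e 4) (e 6)
    - wedge4 (e 0) (e 2) (e 3) (e 5) - wedge4 (e 0) (e 1) (e 4) (e 5)
    - wedge4 (e 0) (e 1) (e 3) (e 6)

end Exterior

/-! ### The manifold `ℝ⁴ × S³` and differential forms on it -/

instance finrankQuaternion : Fact (Module.finrank ℝ ℍ[ℝ] = 3 + 1) :=
  ⟨Quaternion.finrank_eq_four⟩

/-- `S³ = SU(2)`, the unit quaternions. -/
abbrev S3 : Type := Metric.sphere (0 : ℍ[ℝ]) 1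

/-- `ℝ⁴ × S³`, where `ℝ⁴` is the space of quaternions, with its product smooth structure. -/
abbrev M7 : Type := ℍ[ℝ] × S3

/-- The model vector space of `M7`. -/
abbrev E7 : Type := ℍ[ℝ] × EuclideanSpace ℝ (Fin 3)

/-- The model of `M7`. -/
abbrev I7 : ModelWithCorners ℝ E7 (ModelProd ℍ[ℝ] (EuclideanSpace ℝ (Fin 3))) :=
  (𝓘(ℝ, ℍ[ℝ])).prod (𝓡 3)

/-- The differential of a map to a normed space `F` (whose tangent spaces are identified
with `F`). -/
def differential {F : Type*} [NormedAddCommGroup F] [NormedSpace ℝ F] (g : M7 → F) (m : M7) :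
    TangentSpace I7 m →L[ℝ] F :=
  (NormedSpace.fromTangentSpace (𝕜 := ℝ) (g m) : TangentSpace 𝓘(ℝ, F) (g m) →L[ℝ] F).comp
    (mfderiv I7 𝓘(ℝ, F) g m)

/-- (Not necessarily continuous) differential `k`-forms on `ℝ⁴ × S³`. -/
abbrev DForm (k : ℕ) : Type := (m : M7) → TangentSpace I7 m [⋀^Fin k]→L[ℝ] ℝ

/-- The expression of a form in the chart at `m₀`: its pullback by the inverse of the chart. -/
def chartRep {k : ℕ} (α : DForm k) (m₀ : M7) (z : E7) : E7 [⋀^Fin k]→L[ℝ] ℝ :=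
  (α ((extChartAt I7 m₀).symm z)).compContinuousLinearMap
    ((mfderiv 𝓘(ℝ, E7) I7 (extChartAt I7 m₀).symm z).comp
      ((NormedSpace.fromTangentSpace (𝕜 := ℝ) z).symm : E7 →L[ℝ] TangentSpace 𝓘(ℝ, E7) z))

/-- A form is smooth if all its chart expressions are. -/
def SmoothForm {k : ℕ} (α : DForm k) : Prop :=
  ∀ m₀ : M7, ContDiffOn ℝ ∞ (chartRep α m₀) (extChartAt I7 m₀).target

/-- The exterior derivative, computed at `m` in the chart at `m`. -/
def extD {k : ℕ} (α : DForm k) : DForm (k + 1) := fun m =>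
  (extDeriv (chartRep α m) (extChartAt I7 m m)).compContinuousLinearMap
    (differential (extChartAt I7 m) m)

/-- Convergence in `C^∞_loc`: in each chart all derivatives converge uniformly on compact sets. -/
def ConvergesSmoothly {k : ℕ} {ι : Type*} (α : ι → DForm k) (l : Filter ι) (β : DForm k) : Prop :=
  ∀ (m₀ : M7) (K : Set E7), IsCompact K → K ⊆ (extChartAt I7 m₀).target → ∀ n : ℕ,
    TendstoUniformlyOn (fun i => iteratedFDeriv ℝ n (chartRep (α i) m₀))
      (iteratedFDeriv ℝ n (chartRep β m₀)) l K

/-- `φ` is a torsion-free `G₂`-structure on `ℝ⁴ × S³` with `ψ = *_φ φ`: both forms are smooth, at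
each point they are in standard form in a common coframe, and `dφ = 0 = d *_φ φ`. -/
structure IsTorsionFreeG2 (φ : DForm 3) (ψ : DForm 4) : Prop where
  smooth_phi : SmoothForm φ
  smooth_psi : SmoothForm ψ
  adapted : ∀ m : M7, ∃ e : Fin 7 → TangentSpace I7 m →L[ℝ] ℝ,
    LinearIndependent ℝ e ∧ φ m = modelThreeForm e ∧ ψ m = modelFourForm e
  closed : ∀ m : M7, extD φ m = 0
  coclosed : ∀ m : M7, extD ψ m = 0

/-- The connection 1-form `A` on the trivial `U(1)`-bundle (with `𝔲(1) = ℝ`, so that its curvature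
is `F = dA`) is a smooth deformed `G₂`-instanton: `F³ / 6 - F ∧ ψ = 0`, where `ψ = *_φ φ`. -/
def IsDeformedG2Instanton (ψ : DForm 4) (A : DForm 1) : Prop :=
  SmoothForm A ∧ ∀ m : M7,
    (1 / 6 : ℝ) • (wedge (wedge (extD A m) (extD A m)) (extD A m) :
        TangentSpace I7 m [⋀^Fin 6]→L[ℝ] ℝ)
      - (wedge (extD A m) (ψ m) : TangentSpace I7 m [⋀^Fin 6]→L[ℝ] ℝ) = 0

/-! ### Cohomogeneity one coordinates

The complement of the zero section `{0} × S³` is identified with `(9/4, ∞) × S³ × S³` by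
`(r, p, q) ↦ (√(r - 9/4) q, p q⁻¹)`. As `r → 9/4` the orbits of the diagonal `S³`, acting on
`S³ × S³` by right multiplication, collapse. The smooth structure is the one given by the arc
length `s = ∫_{9/4}^r √((x² - 9/16) / (x² - 81/16)) dx` as radius of `ℝ⁴`: with `ρ = √(r - 9/4)`
one has `ds = 2 √((r² - 9/16) / (r + 9/4)) dρ`, so that `s / ρ` is a positive smooth function
of `ρ²`. -/

/-- The coordinate `r`. -/
def radius (m : M7) : ℝ := 9 / 4 + ‖m.1‖ ^ 2

/-- The coordinate `q ∈ S³` (off the zero section). -/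
def coordQ (m : M7) : ℍ[ℝ] := ‖m.1‖⁻¹ • m.1

/-- The coordinate `p ∈ S³` (off the zero section). -/
def coordP (m : M7) : ℍ[ℝ] := (m.2 : ℍ[ℝ]) * coordQ m

theorem bijOn_coordinates :
    Set.BijOn (fun m : M7 => (radius m, coordP m, coordQ m)) {m | m.1 ≠ 0}
      (Set.Ioi (9 / 4 : ℝ) ×ˢ Metric.sphere (0 : ℍ[ℝ]) 1 ×ˢ Metric.sphere (0 : ℍ[ℝ]) 1) := by
  have hQ : ∀ m : M7, m.1 ≠ 0 → ‖coordQ m‖ = 1 := fun m hm => by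
    simp [coordQ, norm_smul, hm]
  refine ⟨fun m hm => ?_, fun m hm m' hm' h => ?_, ?_⟩
  · have h0 : 0 < ‖m.1‖ := norm_pos_iff.2 hm
    have hy : ‖(m.2 : ℍ[ℝ])‖ = 1 := by simp
    refine ⟨?_, ?_, ?_⟩
    · simp only [radius, Set.mem_Ioi]
      nlinarith
    · simp [coordP, hQ m hm]
    · simpa using hQ m hm
  · simp only [Prod.mk.injEq, radius, add_right_inj] at h
    obtain ⟨h1, h2, h3⟩ := h
    have hn : ‖m.1‖ = ‖m'.1‖ := by
      simpa using (sq_eq_sq₀ (norm_nonneg _) (norm_nonneg _)).1 h1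
    have hq0 : coordQ m ≠ 0 := fun h => by simpa [h] using hQ m hm
    have hx : m.1 = m'.1 := by
      have h0 : (‖m'.1‖)⁻¹ ≠ 0 := inv_ne_zero (norm_ne_zero_iff.2 hm')
      rw [coordQ, coordQ, hn] at h3
      exact smul_right_injective _ h0 h3
    have hy : (m.2 : ℍ[ℝ]) = m'.2 := by
      rw [coordP, coordP, ← h3] at h2
      exact mul_right_cancel₀ hq0 h2
    exact Prod.ext hx (Subtype.ext hy)
  · rintro ⟨r, p, q⟩ ⟨hr, hp, hq⟩
    have hr' : 0 < r - 9 / 4 := by simpa using hr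
    have hp' : ‖p‖ = 1 := by simpa using hp
    have hq' : ‖q‖ = 1 := by simpa using hq
    have hq0 : q ≠ 0 := fun h => by simp [h] at hq'
    have hs : 0 < Real.sqrt (r - 9 / 4) := Real.sqrt_pos.2 hr'
    have hnx : ‖Real.sqrt (r - 9 / 4) • q‖ = Real.sqrt (r - 9 / 4) := by
      rw [norm_smul, hq', mul_one, Real.norm_of_nonneg hs.le]
    have hQ' : ‖Real.sqrt (r - 9 / 4) • q‖⁻¹ • Real.sqrt (r - 9 / 4) • q = q := by
      rw [hnx, smul_smul, inv_mul_cancel₀ hs.ne', one_smul]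
    refine ⟨(Real.sqrt (r - 9 / 4) • q, ⟨p * q⁻¹, by simp [hp', hq']⟩), ?_, ?_⟩
    · exact smul_ne_zero hs.ne' hq0
    · have e1 : radius (Real.sqrt (r - 9 / 4) • q, ⟨p * q⁻¹, by simp [hp', hq']⟩) = r := by
        simp only [radius]
        rw [hnx, Real.sq_sqrt hr'.le]
        ring
      have e2 : coordQ (Real.sqrt (r - 9 / 4) • q, ⟨p * q⁻¹, by simp [hp', hq']⟩) = q := hQ'
      have e3 : coordP (Real.sqrt (r - 9 / 4) • q, ⟨p * q⁻¹, by simp [hp', hq']⟩) = p := by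
        simp only [coordP, e2]
        rw [mul_assoc, inv_mul_cancel₀ hq0, mul_one]
      simp only [e1, e2, e3]

/-- The basis `T₁, T₂, T₃` of `𝔰𝔲(2) = Im ℍ`, with `[T_i, T_j] = 2 ε_{ijk} T_k`. -/
def T : Fin 3 → ℍ[ℝ] := ![⟨0, 1, 0, 0⟩, ⟨0, 0, 1, 0⟩, ⟨0, 0, 0, 1⟩]

/-- The `i`-th component of the pullback `g⁻¹ dg` of the left-invariant Maurer-Cartan form by a
map `g` to the unit quaternions, i.e. the pullback by `g` of the dual coframe `σ_i` of the
left-invariant frame `T_i`. -/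
def maurerCartan (g : M7 → ℍ[ℝ]) (i : Fin 3) (m : M7) : TangentSpace I7 m →L[ℝ] ℝ :=
  (innerSL ℝ (T i)).comp ((ContinuousLinearMap.mul ℝ ℍ[ℝ] (g m)⁻¹).comp (differential g m))

/-- `η_i⁺`: the 1-forms `η_i^±` are dual to `T_i^± = (T_i, ± T_i)` on `S³ × S³`. -/
def etaP (i : Fin 3) (m : M7) : TangentSpace I7 m →L[ℝ] ℝ :=
  (1 / 2 : ℝ) • (maurerCartan coordP i m + maurerCartan coordQ i m)

/-- `η_i⁻`. -/
def etaM (i : Fin 3) (m : M7) : TangentSpace I7 m →L[ℝ] ℝ :=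
  (1 / 2 : ℝ) • (maurerCartan coordP i m - maurerCartan coordQ i m)

/-! ### The BGGG `G₂`-structure off the zero section -/

/-- The coefficient `A₁`. -/
def A1 (r : ℝ) : ℝ := √((r - 9 / 4) * (r + 9 / 4)) / √((r - 3 / 4) * (r + 3 / 4))

/-- The coefficient `A₂`. -/
def A2 (r : ℝ) : ℝ := √((r - 9 / 4) * (r + 3 / 4) / 3)

/-- The coefficient `B₁`. -/
def B1 (r : ℝ) : ℝ := 2 * r / 3

/-- The coefficient `B₂`. -/
def B2 (r : ℝ) : ℝ := √((r + 9 / 4) * (r - 3 / 4) / 3)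

/-- The differential of the arc length
`s = ∫_{9/4}^r √((x - 3/4)(x + 3/4)) / √((x - 9/4)(x + 9/4)) dx`. -/
def ds (m : M7) : TangentSpace I7 m →L[ℝ] ℝ :=
  (√((radius m - 3 / 4) * (radius m + 3 / 4)) / √((radius m - 9 / 4) * (radius m + 9 / 4))) •
    differential radius m

/-- `ω = 4 A₁ B₁ η₁⁻ ∧ η₁⁺ + 4 A₂ B₂ (η₂⁻ ∧ η₂⁺ + η₃⁻ ∧ η₃⁺)`. -/
def omega : DForm 2 := fun m =>
  (4 * A1 (radius m) * B1 (radius m)) • wedge2 (etaM 0 m) (etaP 0 m)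
    + (4 * A2 (radius m) * B2 (radius m)) •
      (wedge2 (etaM 1 m) (etaP 1 m) + wedge2 (etaM 2 m) (etaP 2 m))

/-- `Ω⁺`. -/
def OmegaRe : DForm 3 := fun m =>
  (8 * B1 (radius m) * B2 (radius m) ^ 2) • wedge3 (etaM 0 m) (etaM 1 m) (etaM 2 m)
    - (8 * A1 (radius m) * A2 (radius m) * B2 (radius m)) •
      (wedge3 (etaP 0 m) (etaP 1 m) (etaM 2 m) + wedge3 (etaP 0 m) (etaM 1 m) (etaP 2 m))
    - (8 * A2 (radius m) ^ 2 * B1 (radius m)) • wedge3 (etaM 0 m) (etaP 1 m) (etaP 2 m)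

/-- `Ω⁻`. -/
def OmegaIm : DForm 3 := fun m =>
  (-(8 * A2 (radius m) ^ 2 * A1 (radius m))) • wedge3 (etaP 0 m) (etaP 1 m) (etaP 2 m)
    + (8 * B1 (radius m) * B2 (radius m) * A2 (radius m)) •
      (wedge3 (etaM 0 m) (etaM 1 m) (etaP 2 m) + wedge3 (etaM 0 m) (etaP 1 m) (etaM 2 m))
    + (8 * A1 (radius m) * B2 (radius m) ^ 2) • wedge3 (etaP 0 m) (etaM 1 m) (etaM 2 m)

/-- The BGGG 3-form `ds ∧ ω + Ω⁺` (meaningful off the zero section). -/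
def phi : DForm 3 := fun m =>
  (wedge (oneForm (ds m)) (omega m) : TangentSpace I7 m [⋀^Fin 3]→L[ℝ] ℝ) + OmegaRe m

/-- The 4-form `½ ω ∧ ω - ds ∧ Ω⁻` (meaningful off the zero section). -/
def psi : DForm 4 := fun m =>
  (1 / 2 : ℝ) • (wedge (omega m) (omega m) : TangentSpace I7 m [⋀^Fin 4]→L[ℝ] ℝ)
    - (wedge (oneForm (ds m)) (OmegaIm m) : TangentSpace I7 m [⋀^Fin 4]→L[ℝ] ℝ)

/-- The 1-form `f(r) η₁⁺`. On the zero section, where `η₁⁺` is not defined as a form on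
`ℝ⁴ × S³`, its value is `0` by the convention `0⁻¹ = 0` (see the next fact). -/
def connectionForm (f : ℝ → ℝ) : DForm 1 := fun m => oneForm (f (radius m) • etaP 0 m)

theorem connectionForm_zeroSection (f : ℝ → ℝ) (m : M7) (hm : m.1 = 0) :
    connectionForm f m = 0 := by
  have hq : coordQ m = 0 := by simp [coordQ, hm]
  have hp : coordP m = 0 := by simp [coordP, hq]
  have h0 : ∀ g : M7 → ℍ[ℝ], g m = 0 → maurerCartan g 0 m = 0 := fun g hg => by
    rw [maurerCartan, hg, inv_zero, map_zero, ContinuousLinearMap.zero_comp,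
      ContinuousLinearMap.comp_zero]
  have h : etaP 0 m = 0 := by
    rw [etaP, h0 _ hp, h0 _ hq, add_zero, smul_zero]
  ext v
  simp [connectionForm, oneForm, h]

/-- `f` is the continuous branch on `[9/4, ∞)`, vanishing at `9/4`, of the implicit relation
`24 tan(f/3 + c) f = 16 r² - 81`. -/
structure IsBranch (c : ℝ) (f : ℝ → ℝ) : Prop where
  continuousOn : ContinuousOn f (Set.Ici (9 / 4))
  vanish : f (9 / 4) = 0
  relation : ∀ r : ℝ, 9 / 4 ≤ r →
    Real.cos (f r / 3 + c) ≠ 0 ∧ 24 * Real.tan (f r / 3 + c) * f r = 16 * r ^ 2 - 81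

end BGGG

end

/-! Everything is transported to the open set `y ≠ 0` of `ℍ × ℍ ∋ (x, y)`, into which `ℝ⁴ × S³`
embeds. There `q = x/|x|` and `p = yq`; since real rescaling does not change the imaginary part of
`g⁻¹dg`, the forms `η_i^±` are pulled back from the forms `eP`, `eM` built from `yx` and `x`. Write
`s = |x|² = r - 9/4`. With `ν = y⁻¹dy` one has `η⁻ = ½ x⁻¹νx` and `η⁺ = x⁻¹dx + η⁻`, so `sη⁻` and
`sη⁺` (`nE`, `pE`) are smooth across `x = 0`.

Part (1). The square roots cancel in the coefficients of `φ` and `ψ` with respect to `dr, η^±`,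
which become polynomials in `r`. The structure equations `dη⁺ = -2(η⁺η⁺ + η⁻η⁻)`, `dη⁻ = -2(η⁺η⁻ +
η⁻η⁺)` then give `φ = (27/8) ν₁ν₂ν₃ + dβ` and `ψ = dγ` for explicit invariant `β`, `γ` with
polynomial coefficients (`phiA_eq`, `psiA_eq`). Closedness is `d² = 0` together with `dν₁ν₂ν₃ = 0`,
and smoothness reduces to that of `β` and `γ`. Their terms of high order in `s` are visibly smooth
in `pE`, `nE`, `ν`. The terms of lowest order have equal coefficients in the directions 1, 2, 3, so
they are invariant under the rotation `v ↦ xvx⁻¹` and can be rewritten through `ν` and the smooth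
components of `dx x̄` (`betaA_eq`, `gammaA_eq`). Off the zero section the adapted coframe consists
of multiples of `ds, η^±`; on it, of multiples of `ν` and `dx`, after evaluating `φ` and `ψ` there
(`phiA_zeroSection`, `psiA_zeroSection`).

Parts (2) and (3). Put `u = 16r² - 81`, `ε = π/2 - c` and `t = cot(f/3 + c)`. The implicit relation
becomes `f = ut/24` with `arctan t + ut/72 = ε`, whose left side is strictly increasing in `t` for
`u ≥ 0`. Hence `t` is unique, and by the inverse function theorem it is smooth in `(ε, u)` up to `u
= 0`. Since `u` is divisible by `s`, `fη₁⁺` is a smooth function times `pE`. The deformed instanton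
equation reduces to `f'(f² + u²/576 + u/8) = 4rf`, which follows by differentiating the relation
(`branch_ode`). On the zero section the curvature is anti-self-dual along `ℝ⁴`, and both terms of
the equation vanish.

Part (4). `0 ≤ f ≤ 3ε` gives uniform convergence. The connection depends smoothly on `(ε, point)`
also at `ε = 0`, where it vanishes; this gives convergence of all derivatives on compact sets. -/

open scoped Manifold ContDiff Quaternion

noncomputable section

namespace BGGG

/-! ### Wedge products of covectors -/

section Algebra

variable {V : Type*} [AddCommGroup V] [Module ℝ V] [TopologicalSpace V]

/-- The wedge product `a₁ ∧ ⋯ ∧ a_k` of covectors. -/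
def covectorWedge {k : ℕ} (a : Fin k → V →L[ℝ] ℝ) : V [⋀^Fin k]→L[ℝ] ℝ :=
  ContinuousMultilinearMap.alternatization
    ((ContinuousMultilinearMap.mkPiAlgebra ℝ (Fin k) ℝ).compContinuousLinearMap a)

theorem covectorWedge_apply {k : ℕ} (a : Fin k → V →L[ℝ] ℝ) (v : Fin k → V) :
    covectorWedge a v = ∑ σ : Equiv.Perm (Fin k), (Equiv.Perm.sign σ : ℝ) * ∏ i, a i (v (σ i)) := by
  simp [covectorWedge, ContinuousMultilinearMap.alternatization_apply_apply, Units.smul_def]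

theorem covectorWedge_eq_det {k : ℕ} (a : Fin k → V →L[ℝ] ℝ) (v : Fin k → V) :
    covectorWedge a v = (Matrix.of fun i j => a j (v i)).det := by
  simp [covectorWedge_apply, Matrix.det_apply']

theorem wedge_apply {k l : ℕ} (α : V [⋀^Fin k]→L[ℝ] ℝ) (β : V [⋀^Fin l]→L[ℝ] ℝ)
    (v : Fin (k + l) → V) :
    wedge α β v = ((k.factorial : ℝ) * (l.factorial : ℝ))⁻¹ *
      ∑ σ : Equiv.Perm (Fin (k + l)), (Equiv.Perm.sign σ : ℝ) *
        (α (fun i => v (σ (Fin.castAdd l i))) * β (fun j => v (σ (Fin.natAdd k j)))) := by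
  simp [wedge, ContinuousMultilinearMap.alternatization_apply_apply, tensorForm_apply,
    Units.smul_def]

/-- Expanding both factors gives a sum over `τ`, `τ'` and `σ`. For fixed `τ`, `τ'` the substitution
`σ ↦ σ(τ ⊕ τ')` turns the inner sum into the full antisymmetrisation, and the resulting `k! l!`
equal copies cancel the normalising factor. -/
theorem covectorWedge_wedge {k l : ℕ} (a : Fin k → V →L[ℝ] ℝ) (b : Fin l → V →L[ℝ] ℝ) :
    wedge (covectorWedge a) (covectorWedge b) = covectorWedge (Fin.append a b) := by
  ext v
  rw [wedge_apply, covectorWedge_apply]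
  simp_rw [covectorWedge_apply, Finset.sum_mul_sum, Finset.mul_sum]
  rw [Finset.sum_comm]
  simp_rw [Finset.sum_comm (s := (Finset.univ : Finset (Equiv.Perm (Fin (k + l)))))]
  have key : ∀ (τ : Equiv.Perm (Fin k)) (τ' : Equiv.Perm (Fin l)),
      ∑ σ : Equiv.Perm (Fin (k + l)), ((k.factorial : ℝ) * (l.factorial : ℝ))⁻¹ *
        ((Equiv.Perm.sign σ : ℝ) *
        (((Equiv.Perm.sign τ : ℝ) * ∏ i, a i (v (σ (Fin.castAdd l (τ i))))) *
          ((Equiv.Perm.sign τ' : ℝ) * ∏ i, b i (v (σ (Fin.natAdd k (τ' i))))))) =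
      ((k.factorial : ℝ) * (l.factorial : ℝ))⁻¹ *
      ∑ σ : Equiv.Perm (Fin (k + l)), (Equiv.Perm.sign σ : ℝ) *
        ∏ i, Fin.append a b i (v (σ i)) := by
    intro τ τ'
    set π : Equiv.Perm (Fin (k + l)) := (finSumFinEquiv.permCongr (Equiv.sumCongr τ τ')) with hπ
    have hs : Equiv.Perm.sign π = Equiv.Perm.sign τ * Equiv.Perm.sign τ' := by
      rw [hπ, Equiv.Perm.sign_permCongr]
      exact Equiv.Perm.sign_sumCongr τ τ'
    rw [Finset.mul_sum]
    conv_rhs => rw [← Equiv.sum_comp (Equiv.mulRight π)]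
    refine Finset.sum_congr rfl fun σ _ => ?_
    rw [Fin.prod_univ_add]
    have h1 : ∀ i, π (Fin.castAdd l i) = Fin.castAdd l (τ i) := fun i => by
      simp [hπ, Equiv.permCongr_apply]
    have h2 : ∀ i, π (Fin.natAdd k i) = Fin.natAdd k (τ' i) := fun i => by
      simp [hπ, Equiv.permCongr_apply]
    simp only [Equiv.coe_mulRight, Equiv.Perm.coe_mul, Function.comp, h1, h2, Fin.append_left,
      Fin.append_right, Equiv.Perm.sign_mul, hs]
    push_cast
    ring
  simp_rw [fun τ τ' => key τ' τ]
  simp [Fintype.card_perm]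
  field_simp

theorem wedge_add_left {k l : ℕ} (α α' : V [⋀^Fin k]→L[ℝ] ℝ) (β : V [⋀^Fin l]→L[ℝ] ℝ) :
    wedge (α + α') β = wedge α β + wedge α' β := by
  ext v; simp only [wedge_apply, ContinuousAlternatingMap.add_apply, add_mul, mul_add,
    Finset.sum_add_distrib]

theorem wedge_add_right {k l : ℕ} (α : V [⋀^Fin k]→L[ℝ] ℝ) (β β' : V [⋀^Fin l]→L[ℝ] ℝ) :
    wedge α (β + β') = wedge α β + wedge α β' := by
  ext v; simp only [wedge_apply, ContinuousAlternatingMap.add_apply, mul_add,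
    Finset.sum_add_distrib]

theorem wedge_smul_left {k l : ℕ} (c : ℝ) (α : V [⋀^Fin k]→L[ℝ] ℝ) (β : V [⋀^Fin l]→L[ℝ] ℝ) :
    wedge (c • α) β = c • wedge α β := by
  ext v
  simp only [wedge_apply, ContinuousAlternatingMap.smul_apply, smul_eq_mul, Finset.mul_sum]
  exact Finset.sum_congr rfl fun _ _ => by ring

theorem wedge_smul_right {k l : ℕ} (c : ℝ) (α : V [⋀^Fin k]→L[ℝ] ℝ) (β : V [⋀^Fin l]→L[ℝ] ℝ) :
    wedge α (c • β) = c • wedge α β := by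
  ext v
  simp only [wedge_apply, ContinuousAlternatingMap.smul_apply, smul_eq_mul, Finset.mul_sum]
  exact Finset.sum_congr rfl fun _ _ => by ring

theorem wedge_comp {W : Type*} [AddCommGroup W] [Module ℝ W] [TopologicalSpace W] {k l : ℕ}
    (α : V [⋀^Fin k]→L[ℝ] ℝ) (β : V [⋀^Fin l]→L[ℝ] ℝ) (L : W →L[ℝ] V) :
    (wedge α β).compContinuousLinearMap L =
      wedge (α.compContinuousLinearMap L) (β.compContinuousLinearMap L) := by
  ext v
  simp [wedge_apply, ContinuousAlternatingMap.compContinuousLinearMap_apply, Function.comp_def]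

theorem oneForm_eq (a : V →L[ℝ] ℝ) : oneForm a = covectorWedge ![a] := by
  ext v
  simp [covectorWedge_eq_det, oneForm]

theorem oneForm_apply (a : V →L[ℝ] ℝ) (v : Fin 1 → V) : oneForm a v = a (v 0) := rfl

theorem wedge2_eq (a b : V →L[ℝ] ℝ) : wedge2 a b = covectorWedge ![a, b] := by
  rw [wedge2, oneForm_eq, oneForm_eq, covectorWedge_wedge]
  congr 1; ext i : 1; fin_cases i <;> rfl

theorem wedge3_eq (a b c : V →L[ℝ] ℝ) : wedge3 a b c = covectorWedge ![a, b, c] := by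
  rw [wedge3, wedge2_eq, oneForm_eq, covectorWedge_wedge]
  congr 1; ext i : 1; fin_cases i <;> rfl

theorem wedge4_eq (a b c d : V →L[ℝ] ℝ) : wedge4 a b c d = covectorWedge ![a, b, c, d] := by
  rw [wedge4, wedge3_eq, oneForm_eq, covectorWedge_wedge]
  congr 1; ext i : 1; fin_cases i <;> rfl

theorem oneForm_wedge2 (a b c : V →L[ℝ] ℝ) :
    (wedge (oneForm a) (wedge2 b c) : V [⋀^Fin 3]→L[ℝ] ℝ) = wedge3 a b c := by
  rw [wedge3_eq, wedge2_eq, oneForm_eq, covectorWedge_wedge]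
  congr 1; ext i : 1; fin_cases i <;> rfl

theorem oneForm_wedge3 (a b c d : V →L[ℝ] ℝ) :
    (wedge (oneForm a) (wedge3 b c d) : V [⋀^Fin 4]→L[ℝ] ℝ) = wedge4 a b c d := by
  rw [wedge3_eq, wedge4_eq, oneForm_eq, covectorWedge_wedge]
  congr 1; ext i : 1; fin_cases i <;> rfl

theorem wedge2_wedge2 (a b c d : V →L[ℝ] ℝ) :
    (wedge (wedge2 a b) (wedge2 c d) : V [⋀^Fin 4]→L[ℝ] ℝ) = wedge4 a b c d := by
  rw [wedge4_eq, wedge2_eq, wedge2_eq, covectorWedge_wedge]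
  congr 1; ext i : 1; fin_cases i <;> rfl

theorem wedge2_wedge4 (a b c d e f : V →L[ℝ] ℝ) :
    (wedge (wedge2 a b) (wedge4 c d e f) : V [⋀^Fin 6]→L[ℝ] ℝ) =
      covectorWedge ![a, b, c, d, e, f] := by
  rw [wedge4_eq, wedge2_eq, covectorWedge_wedge]
  congr 1; ext i : 1; fin_cases i <;> rfl

theorem wedge4_wedge2 (a b c d e f : V →L[ℝ] ℝ) :
    (wedge (wedge4 a b c d) (wedge2 e f) : V [⋀^Fin 6]→L[ℝ] ℝ) =
      covectorWedge ![a, b, c, d, e, f] := by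
  rw [wedge4_eq, wedge2_eq, covectorWedge_wedge]
  congr 1; ext i : 1; fin_cases i <;> rfl

theorem oneForm_add (a b : V →L[ℝ] ℝ) : oneForm (a + b) = oneForm a + oneForm b := by
  ext v; simp [oneForm]

theorem oneForm_smul (c : ℝ) (a : V →L[ℝ] ℝ) : oneForm (c • a) = c • oneForm a := by
  ext v; simp [oneForm]

theorem oneForm_comp {W : Type*} [AddCommGroup W] [Module ℝ W] [TopologicalSpace W]
    (a : V →L[ℝ] ℝ) (L : W →L[ℝ] V) :
    (oneForm a).compContinuousLinearMap L = oneForm (a.comp L) := by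
  ext v; simp [oneForm]

theorem wedge2_comp {W : Type*} [AddCommGroup W] [Module ℝ W] [TopologicalSpace W]
    (a b : V →L[ℝ] ℝ) (L : W →L[ℝ] V) :
    (wedge2 a b).compContinuousLinearMap L = wedge2 (a.comp L) (b.comp L) := by
  rw [wedge2, wedge_comp, oneForm_comp, oneForm_comp]; rfl

theorem wedge3_comp {W : Type*} [AddCommGroup W] [Module ℝ W] [TopologicalSpace W]
    (a b c : V →L[ℝ] ℝ) (L : W →L[ℝ] V) :
    (wedge3 a b c).compContinuousLinearMap L = wedge3 (a.comp L) (b.comp L) (c.comp L) := by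
  rw [wedge3, wedge_comp, wedge2_comp, oneForm_comp]; rfl

theorem wedge4_comp {W : Type*} [AddCommGroup W] [Module ℝ W] [TopologicalSpace W]
    (a b c d : V →L[ℝ] ℝ) (L : W →L[ℝ] V) :
    (wedge4 a b c d).compContinuousLinearMap L =
      wedge4 (a.comp L) (b.comp L) (c.comp L) (d.comp L) := by
  rw [wedge4, wedge_comp, wedge3_comp, oneForm_comp]; rfl

theorem wedge2_apply (a b : V →L[ℝ] ℝ) (v : Fin 2 → V) :
    wedge2 a b v = a (v 0) * b (v 1) - b (v 0) * a (v 1) := by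
  rw [wedge2_eq, covectorWedge_eq_det, Matrix.det_fin_two]; simp

theorem wedge3_apply (a b c : V →L[ℝ] ℝ) (v : Fin 3 → V) :
    wedge3 a b c v = a (v 0) * (b (v 1) * c (v 2) - c (v 1) * b (v 2))
      - b (v 0) * (a (v 1) * c (v 2) - c (v 1) * a (v 2))
      + c (v 0) * (a (v 1) * b (v 2) - b (v 1) * a (v 2)) := by
  rw [wedge3_eq, covectorWedge_eq_det, Matrix.det_fin_three]; simp; ring

theorem wedge4_apply (a b c d : V →L[ℝ] ℝ) (v : Fin 4 → V) :
    wedge4 a b c d v =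
      (a (v 0) * b (v 1) - b (v 0) * a (v 1)) * (c (v 2) * d (v 3) - d (v 2) * c (v 3))
      - (a (v 0) * c (v 1) - c (v 0) * a (v 1)) * (b (v 2) * d (v 3) - d (v 2) * b (v 3))
      + (a (v 0) * d (v 1) - d (v 0) * a (v 1)) * (b (v 2) * c (v 3) - c (v 2) * b (v 3))
      + (b (v 0) * c (v 1) - c (v 0) * b (v 1)) * (a (v 2) * d (v 3) - d (v 2) * a (v 3))
      - (b (v 0) * d (v 1) - d (v 0) * b (v 1)) * (a (v 2) * c (v 3) - c (v 2) * a (v 3))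
      + (c (v 0) * d (v 1) - d (v 0) * c (v 1)) * (a (v 2) * b (v 3) - b (v 2) * a (v 3)) := by
  rw [wedge4_eq, covectorWedge_eq_det, Matrix.det_succ_row_zero]
  simp [Fin.sum_univ_four, Matrix.det_fin_three, Fin.succAbove]
  ring

theorem covectorWedge_eq_zero {k : ℕ} {a : Fin k → V →L[ℝ] ℝ} (i j : Fin k) (hij : i ≠ j)
    (h : a i = a j) : covectorWedge a = 0 := by
  ext v
  rw [covectorWedge_eq_det]
  exact Matrix.det_zero_of_column_eq hij fun l => by simp [h]

theorem covectorWedge_perm {k : ℕ} (a : Fin k → V →L[ℝ] ℝ) (σ : Equiv.Perm (Fin k)) :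
    covectorWedge (a ∘ σ) = (Equiv.Perm.sign σ : ℝ) • covectorWedge a := by
  ext v
  rw [ContinuousAlternatingMap.smul_apply, covectorWedge_eq_det, covectorWedge_eq_det, smul_eq_mul,
    ← Matrix.det_permute']
  rfl

end Algebra

/-! ### Smooth families of forms and exterior derivatives on a normed space -/

section Calculus

variable {E : Type*} [NormedAddCommGroup E] [NormedSpace ℝ E]
  {F : Type*} [NormedAddCommGroup F] [NormedSpace ℝ F]
  {G : Type*} [NormedAddCommGroup G] [NormedSpace ℝ G]

/-- Antisymmetrisation as a continuous linear map. -/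
def alternatizationL (E : Type*) [NormedAddCommGroup E] [NormedSpace ℝ E] (k : ℕ) :
    ContinuousMultilinearMap ℝ (fun _ : Fin k => E) ℝ →L[ℝ] E [⋀^Fin k]→L[ℝ] ℝ :=
  LinearMap.mkContinuous
    { toFun := fun f => ContinuousMultilinearMap.alternatization f
      map_add' := fun f g => map_add _ f g
      map_smul' := fun c f => by
        ext v
        simp [ContinuousMultilinearMap.alternatization_apply_apply, Finset.mul_sum,
          Units.smul_def, mul_left_comm] }
    (k.factorial : ℝ) fun f => by
      refine ContinuousAlternatingMap.opNorm_le_bound _ (by positivity) fun v => ?_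
      simp only [LinearMap.coe_mk, AddHom.coe_mk,
        ContinuousMultilinearMap.alternatization_apply_apply]
      refine (norm_sum_le _ _).trans ?_
      have h : ∀ σ ∈ (Finset.univ : Finset (Equiv.Perm (Fin k))),
          ‖(Equiv.Perm.sign σ) • f (v ∘ σ)‖ ≤ ‖f‖ * ∏ i, ‖v i‖ := fun σ _ => by
        have h1 : ‖(Equiv.Perm.sign σ) • f (v ∘ σ)‖ = ‖f (v ∘ σ)‖ := by
          rcases Int.units_eq_one_or (Equiv.Perm.sign σ) with h | h <;> simp [h]
        rw [h1, ← Equiv.prod_comp σ]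
        exact f.le_opNorm _
      refine (Finset.sum_le_card_nsmul _ _ _ h).trans ?_
      simp [Fintype.card_perm, mul_assoc]

theorem alternatizationL_apply {k : ℕ} (f : ContinuousMultilinearMap ℝ (fun _ : Fin k => E) ℝ) :
    alternatizationL E k f = ContinuousMultilinearMap.alternatization f := rfl

/-- Antisymmetrisation multiplies an alternating map by `k!`. This continuous linear left inverse of
the inclusion into multilinear maps allows smoothness of forms to be tested on the underlying
multilinear maps. -/
theorem alternatizationL_coe {k : ℕ} (f : E [⋀^Fin k]→L[ℝ] ℝ) :
    (k.factorial : ℝ)⁻¹ • alternatizationL E k f.toContinuousMultilinearMap = f := by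
  ext v
  simp only [alternatizationL_apply, ContinuousAlternatingMap.smul_apply,
    ContinuousMultilinearMap.alternatization_apply_apply]
  have : ∀ σ : Equiv.Perm (Fin k), Equiv.Perm.sign σ • f.toContinuousMultilinearMap (v ∘ σ) = f v :=
    fun σ => by
      have := f.toAlternatingMap.map_perm v σ
      simp only [ContinuousAlternatingMap.coe_toAlternatingMap] at this
      simp only [ContinuousAlternatingMap.coe_toContinuousMultilinearMap, this, smul_smul]
      simp
  simp_rw [this]
  simp [Fintype.card_perm]
  field_simp

theorem contDiffAt_alternating {k : ℕ} {n : WithTop ℕ∞} {α : F → E [⋀^Fin k]→L[ℝ] ℝ} {z : F}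
    (h : ContDiffAt ℝ n (fun z => (α z).toContinuousMultilinearMap) z) : ContDiffAt ℝ n α z := by
  have := ((alternatizationL E k).contDiff.contDiffAt.comp z h).const_smul (k.factorial : ℝ)⁻¹
  simpa [Function.comp_def, alternatizationL_coe] using this

/-- As a multilinear map, the pullback is linear in `α` and multilinear in the `k` copies of `L`,
hence smooth in both. -/
theorem contDiffAt_compContinuousAlternating {k : ℕ} {n : WithTop ℕ∞}
    {α : F → E [⋀^Fin k]→L[ℝ] ℝ} {L : F → G →L[ℝ] E} {z : F}
    (hα : ContDiffAt ℝ n α z) (hL : ContDiffAt ℝ n L z) :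
    ContDiffAt ℝ n (fun z => (α z).compContinuousLinearMap (L z)) z := by
  apply contDiffAt_alternating
  have h1 : ContDiffAt ℝ n (fun z => (α z).toContinuousMultilinearMap) z :=
    (ContinuousAlternatingMap.toContinuousMultilinearMapCLM (𝕜 := ℝ) (E := E) (F := ℝ) (ι := Fin k)
      ℝ).contDiff.contDiffAt.comp z hα
  have h2 : ContDiffAt ℝ n (fun z =>
      ContinuousMultilinearMap.compContinuousLinearMapContinuousMultilinear ℝ
        (fun _ : Fin k => G) (fun _ => E) ℝ (fun _ => L z)) z :=
    (ContinuousMultilinearMap.contDiff _).contDiffAt.comp z (contDiffAt_pi.2 fun _ => hL)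
  exact h2.clm_apply h1

theorem contDiffAt_covectorWedge {k : ℕ} {n : WithTop ℕ∞} {a : Fin k → F → E →L[ℝ] ℝ} {z : F}
    (ha : ∀ i, ContDiffAt ℝ n (a i) z) :
    ContDiffAt ℝ n (fun z => covectorWedge fun i => a i z) z := by
  have h2 : ContDiffAt ℝ n (fun z =>
      ContinuousMultilinearMap.compContinuousLinearMapContinuousMultilinear ℝ
        (fun _ : Fin k => E) (fun _ => ℝ) ℝ (fun i => a i z)) z :=
    (ContinuousMultilinearMap.contDiff _).contDiffAt.comp z (contDiffAt_pi.2 ha)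
  exact (alternatizationL E k).contDiff.contDiffAt.comp z
    (h2.clm_apply (contDiffAt_const (c := ContinuousMultilinearMap.mkPiAlgebra ℝ (Fin k) ℝ)))

variable {n : WithTop ℕ∞} {z : F}

theorem contDiffAt_smul_covector {f : F → ℝ} {a : F → E →L[ℝ] ℝ} (hf : ContDiffAt ℝ n f z)
    (ha : ContDiffAt ℝ n a z) : ContDiffAt ℝ n (fun z => f z • a z) z := hf.smul ha

theorem contDiffAt_smul_form {k : ℕ} {f : F → ℝ} {α : F → E [⋀^Fin k]→L[ℝ] ℝ}
    (hf : ContDiffAt ℝ n f z) (hα : ContDiffAt ℝ n α z) :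
    ContDiffAt ℝ n (fun z => f z • α z) z := hf.smul hα

theorem contDiffAt_oneForm {a : F → E →L[ℝ] ℝ} (ha : ContDiffAt ℝ n a z) :
    ContDiffAt ℝ n (fun z => oneForm (a z)) z :=
  (ContinuousAlternatingMap.ofSubsingletonLIE (𝕜 := ℝ) (E := E) (F := ℝ)
    (0 : Fin 1)).contDiff.contDiffAt.comp z ha

theorem contDiffAt_wedge2 {a b : F → E →L[ℝ] ℝ} (ha : ContDiffAt ℝ n a z)
    (hb : ContDiffAt ℝ n b z) : ContDiffAt ℝ n (fun z => wedge2 (a z) (b z)) z := by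
  have := contDiffAt_covectorWedge (a := ![a, b]) (n := n) (z := z)
    (by simp [Fin.forall_fin_succ, *])
  convert this using 2 with w
  rw [wedge2_eq]; congr 1; ext i : 1; fin_cases i <;> rfl

theorem contDiffAt_wedge3 {a b c : F → E →L[ℝ] ℝ} (ha : ContDiffAt ℝ n a z)
    (hb : ContDiffAt ℝ n b z) (hc : ContDiffAt ℝ n c z) :
    ContDiffAt ℝ n (fun z => wedge3 (a z) (b z) (c z)) z := by
  have := contDiffAt_covectorWedge (a := ![a, b, c]) (n := n) (z := z)
    (by simp [Fin.forall_fin_succ, *])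
  convert this using 2 with w
  rw [wedge3_eq]; congr 1; ext i : 1; fin_cases i <;> rfl

theorem extDeriv_oneForm_apply {a : E → E →L[ℝ] ℝ} {z : E} (ha : DifferentiableAt ℝ a z)
    (v : Fin 2 → E) :
    extDeriv (fun z => oneForm (a z)) z v =
      fderiv ℝ a z (v 0) (v 1) - fderiv ℝ a z (v 1) (v 0) := by
  have hd : DifferentiableAt ℝ (fun z => oneForm (a z)) z :=
    (ContinuousAlternatingMap.ofSubsingletonLIE (𝕜 := ℝ) (E := E) (F := ℝ)
      (0 : Fin 1)).differentiableAt.comp z ha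
  have h : ∀ u w : E, fderiv ℝ (fun z => a z u) z w = fderiv ℝ a z w u := fun u w => by
    rw [(ha.hasFDerivAt.clm_apply (hasFDerivAt_const u z)).fderiv]; simp
  rw [extDeriv_apply hd]
  simp [oneForm_apply, Fin.sum_univ_two, h, Fin.removeNth, Fin.succAbove]
  ring

theorem extDeriv_oneForm_smul_apply {f : E → ℝ} {a : E → E →L[ℝ] ℝ} {f' : E →L[ℝ] ℝ} {z : E}
    (hf : HasFDerivAt f f' z) (ha : DifferentiableAt ℝ a z) :
    extDeriv (fun z => oneForm (f z • a z)) z = wedge2 f' (a z) +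
      f z • extDeriv (fun z => oneForm (a z)) z := by
  ext v
  rw [extDeriv_oneForm_apply (hf.differentiableAt.fun_smul ha), ContinuousAlternatingMap.add_apply,
    ContinuousAlternatingMap.smul_apply, extDeriv_oneForm_apply ha, wedge2_apply,
    (hf.fun_smul ha.hasFDerivAt).fderiv]
  simp
  ring

theorem extDeriv_smul_apply {k : ℕ} {f : E → ℝ} {f' : E →L[ℝ] ℝ} {α : E → E [⋀^Fin k]→L[ℝ] ℝ}
    {z : E} (hf : HasFDerivAt f f' z) (hα : DifferentiableAt ℝ α z) (v : Fin (k + 1) → E) :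
    extDeriv (fun z => f z • α z) z v =
      ∑ i, (-1) ^ i.val * (f' (v i) * α z (i.removeNth v)) + f z * extDeriv α z v := by
  rw [extDeriv_apply (hf.differentiableAt.fun_smul hα), extDeriv_apply hα, Finset.mul_sum,
    ← Finset.sum_add_distrib]
  refine Finset.sum_congr rfl fun i _ => ?_
  have h := hα.hasFDerivAt.continuousAlternatingMap_apply_const (i.removeNth v)
  have h2 := (hf.mul h).fderiv
  simp only [ContinuousAlternatingMap.smul_apply, smul_eq_mul]
  rw [show (fun z => f z * α z (i.removeNth v)) = f * fun z => α z (i.removeNth v) from rfl, h2,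
    h.fderiv]
  simp
  ring

variable {a b c : E → E →L[ℝ] ℝ} {z : E}

theorem differentiableAt_covectorWedge {k : ℕ} {a : Fin k → E → E →L[ℝ] ℝ}
    (ha : ∀ i, DifferentiableAt ℝ (a i) z) :
    DifferentiableAt ℝ (fun z => covectorWedge fun i => a i z) z := by
  have h := contDiffAt_covectorWedge (n := 1) (z := fun i => a i z)
    (a := fun i (b : Fin k → E →L[ℝ] ℝ) => b i) fun i => contDiffAt_apply ℝ (E →L[ℝ] ℝ) i _
  exact DifferentiableAt.comp (g := fun b : Fin k → E →L[ℝ] ℝ => covectorWedge b)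
    (f := fun z i => a i z) z (h.differentiableAt one_ne_zero) (differentiableAt_pi.2 ha)

theorem differentiableAt_oneForm (ha : DifferentiableAt ℝ a z) :
    DifferentiableAt ℝ (fun z => oneForm (a z)) z :=
  (ContinuousAlternatingMap.ofSubsingletonLIE (𝕜 := ℝ) (E := E) (F := ℝ)
    (0 : Fin 1)).differentiableAt.comp z ha

theorem differentiableAt_wedge2 (ha : DifferentiableAt ℝ a z) (hb : DifferentiableAt ℝ b z) :
    DifferentiableAt ℝ (fun z => wedge2 (a z) (b z)) z := by
  have := differentiableAt_covectorWedge (a := ![a, b]) (z := z) (by simp [Fin.forall_fin_succ, *])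
  convert this using 2 with w
  rw [wedge2_eq]; congr 1; ext i : 1; fin_cases i <;> rfl

theorem differentiableAt_wedge3 (ha : DifferentiableAt ℝ a z) (hb : DifferentiableAt ℝ b z)
    (hc : DifferentiableAt ℝ c z) :
    DifferentiableAt ℝ (fun z => wedge3 (a z) (b z) (c z)) z := by
  have := differentiableAt_covectorWedge (a := ![a, b, c]) (z := z)
    (by simp [Fin.forall_fin_succ, *])
  convert this using 2 with w
  rw [wedge3_eq]; congr 1; ext i : 1; fin_cases i <;> rfl

/-- Leibniz rule evaluated on vectors. The derivatives of the factors enter as parameters `da`,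
`db`, so that structure equations can be substituted directly. -/
theorem extDeriv_wedge2_apply (ha : DifferentiableAt ℝ a z) (hb : DifferentiableAt ℝ b z)
    (v : Fin 3 → E) {da db : E [⋀^Fin 2]→L[ℝ] ℝ} (hda : extDeriv (fun z => oneForm (a z)) z = da)
    (hdb : extDeriv (fun z => oneForm (b z)) z = db) :
    extDeriv (fun z => wedge2 (a z) (b z)) z v =
      da ![v 0, v 1] * b z (v 2) - da ![v 0, v 2] * b z (v 1) + da ![v 1, v 2] * b z (v 0)
      - (a z (v 0) * db ![v 1, v 2] - a z (v 1) * db ![v 0, v 2] + a z (v 2) * db ![v 0, v 1]) := by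
  subst hda hdb
  have hA : ∀ u, HasFDerivAt (fun z => a z u) ((fderiv ℝ a z).flip u) z := fun u =>
    (ha.hasFDerivAt.clm_apply (hasFDerivAt_const u z)).congr_fderiv (by ext; simp)
  have hB : ∀ u, HasFDerivAt (fun z => b z u) ((fderiv ℝ b z).flip u) z := fun u =>
    (hb.hasFDerivAt.clm_apply (hasFDerivAt_const u z)).congr_fderiv (by ext; simp)
  have key : ∀ (w : Fin 2 → E), fderiv ℝ (fun z => wedge2 (a z) (b z) w) z = _ := fun w => by
    simp only [wedge2_apply]
    exact (((hA _).fun_mul (hB _)).fun_sub ((hB _).fun_mul (hA _))).fderiv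
  simp only [extDeriv_oneForm_apply ha, extDeriv_oneForm_apply hb]
  rw [extDeriv_apply (differentiableAt_wedge2 ha hb)]
  simp [key, Fin.sum_univ_three, Fin.removeNth, Fin.succAbove]
  ring

theorem extDeriv_wedge3_apply (ha : DifferentiableAt ℝ a z) (hb : DifferentiableAt ℝ b z)
    (hc : DifferentiableAt ℝ c z)
    (v : Fin 4 → E) {da db dc : E [⋀^Fin 2]→L[ℝ] ℝ} (hda : extDeriv (fun z => oneForm (a z)) z = da)
    (hdb : extDeriv (fun z => oneForm (b z)) z = db)
    (hdc : extDeriv (fun z => oneForm (c z)) z = dc) :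
    extDeriv (fun z => wedge3 (a z) (b z) (c z)) z v =
      da ![v 0, v 1] * wedge2 (b z) (c z) ![v 2, v 3]
      - da ![v 0, v 2] * wedge2 (b z) (c z) ![v 1, v 3]
      + da ![v 0, v 3] * wedge2 (b z) (c z) ![v 1, v 2]
      + da ![v 1, v 2] * wedge2 (b z) (c z) ![v 0, v 3]
      - da ![v 1, v 3] * wedge2 (b z) (c z) ![v 0, v 2]
      + da ![v 2, v 3] * wedge2 (b z) (c z) ![v 0, v 1]
      - (db ![v 0, v 1] * wedge2 (a z) (c z) ![v 2, v 3]
      - db ![v 0, v 2] * wedge2 (a z) (c z) ![v 1, v 3]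
      + db ![v 0, v 3] * wedge2 (a z) (c z) ![v 1, v 2]
      + db ![v 1, v 2] * wedge2 (a z) (c z) ![v 0, v 3]
      - db ![v 1, v 3] * wedge2 (a z) (c z) ![v 0, v 2]
      + db ![v 2, v 3] * wedge2 (a z) (c z) ![v 0, v 1])
      + (dc ![v 0, v 1] * wedge2 (a z) (b z) ![v 2, v 3]
      - dc ![v 0, v 2] * wedge2 (a z) (b z) ![v 1, v 3]
      + dc ![v 0, v 3] * wedge2 (a z) (b z) ![v 1, v 2]
      + dc ![v 1, v 2] * wedge2 (a z) (b z) ![v 0, v 3]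
      - dc ![v 1, v 3] * wedge2 (a z) (b z) ![v 0, v 2]
      + dc ![v 2, v 3] * wedge2 (a z) (b z) ![v 0, v 1]) := by
  subst hda hdb hdc
  have hA : ∀ u, HasFDerivAt (fun z => a z u) ((fderiv ℝ a z).flip u) z := fun u =>
    (ha.hasFDerivAt.clm_apply (hasFDerivAt_const u z)).congr_fderiv (by ext; simp)
  have hB : ∀ u, HasFDerivAt (fun z => b z u) ((fderiv ℝ b z).flip u) z := fun u =>
    (hb.hasFDerivAt.clm_apply (hasFDerivAt_const u z)).congr_fderiv (by ext; simp)
  have hC : ∀ u, HasFDerivAt (fun z => c z u) ((fderiv ℝ c z).flip u) z := fun u =>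
    (hc.hasFDerivAt.clm_apply (hasFDerivAt_const u z)).congr_fderiv (by ext; simp)
  have key : ∀ (w : Fin 3 → E), fderiv ℝ (fun z => wedge3 (a z) (b z) (c z) w) z = _ := fun w => by
    simp only [wedge3_apply]
    exact ((((hA _).fun_mul (((hB _).fun_mul (hC _)).fun_sub ((hC _).fun_mul (hB _)))).fun_sub
      ((hB _).fun_mul (((hA _).fun_mul (hC _)).fun_sub ((hC _).fun_mul (hA _))))).fun_add
      ((hC _).fun_mul (((hA _).fun_mul (hB _)).fun_sub ((hB _).fun_mul (hA _))))).fderiv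
  simp only [extDeriv_oneForm_apply ha, extDeriv_oneForm_apply hb, extDeriv_oneForm_apply hc]
  rw [extDeriv_apply (differentiableAt_wedge3 ha hb hc)]
  simp [key, Fin.sum_univ_four, Fin.removeNth, Fin.succAbove, wedge2_apply]
  ring

end Calculus

/-! ### Forms on `ℝ⁴ × S³` pulled back from `ℍ × ℍ` -/

/-- The ambient vector space of `M7`. -/
abbrev N8 : Type := ℍ[ℝ] × ℍ[ℝ]

/-- The inclusion of `ℝ⁴ × S³` into `ℍ × ℍ`. -/
def incl (m : M7) : N8 := (m.1, (m.2 : ℍ[ℝ]))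

/-- The pullback to `ℝ⁴ × S³` of a form on `ℍ × ℍ`. -/
def pull {k : ℕ} (α : N8 → N8 [⋀^Fin k]→L[ℝ] ℝ) : DForm k := fun m =>
  (α (incl m)).compContinuousLinearMap (differential incl m)

theorem contMDiff_incl : ContMDiff I7 𝓘(ℝ, N8) ∞ incl :=
  contMDiff_fst.prodMk_space ((contMDiff_coe_sphere (n := 3)).comp contMDiff_snd)

theorem mdifferentiableAt_incl (m : M7) : MDifferentiableAt I7 𝓘(ℝ, N8) incl m :=
  (contMDiff_incl m).mdifferentiableAt (by simp)

theorem differential_comp {F G : Type*} [NormedAddCommGroup F] [NormedSpace ℝ F]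
    [NormedAddCommGroup G] [NormedSpace ℝ G] {g : F → G} {h : M7 → F} {m : M7}
    (hg : DifferentiableAt ℝ g (h m)) (hh : MDifferentiableAt I7 𝓘(ℝ, F) h m) :
    differential (fun m => g (h m)) m = (fderiv ℝ g (h m)).comp (differential h m) := by
  have := mfderiv_comp m hg.mdifferentiableAt hh
  rw [mfderiv_eq_fderiv] at this
  unfold differential
  ext v
  exact congrArg (fun L => L v) this

/-- The inclusion in the chart at `m₀`. -/
def inclRep (m₀ : M7) (z : E7) : N8 := incl ((extChartAt I7 m₀).symm z)

theorem contDiffAt_inclRep {m₀ : M7} {z : E7} (hz : z ∈ (extChartAt I7 m₀).target) :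
    ContDiffAt ℝ ∞ (inclRep m₀) z := by
  have h := contMDiff_incl.comp_contMDiffOn (contMDiffOn_extChartAt_symm (I := I7) (n := ∞) m₀)
  exact (contMDiffOn_iff_contDiffOn.1 h).contDiffAt ((isOpen_extChartAt_target m₀).mem_nhds hz)

/-- By the chain rule a chart expression of a pulled-back form is an ordinary pullback between
normed spaces, along the inclusion read in the chart. -/
theorem chartRep_pull {k : ℕ} (α : N8 → N8 [⋀^Fin k]→L[ℝ] ℝ) {m₀ : M7} {z : E7}
    (hz : z ∈ (extChartAt I7 m₀).target) :
    chartRep (pull α) m₀ z =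
      (α (inclRep m₀ z)).compContinuousLinearMap (fderiv ℝ (inclRep m₀) z) := by
  have h1 : MDifferentiableAt 𝓘(ℝ, E7) I7 (extChartAt I7 m₀).symm z :=
    ((contMDiffOn_extChartAt_symm (I := I7) (n := ∞) m₀).contMDiffAt
      ((isOpen_extChartAt_target m₀).mem_nhds hz)).mdifferentiableAt (by simp)
  have h := mfderiv_comp z (mdifferentiableAt_incl _) h1
  have h2 : mfderiv 𝓘(ℝ, E7) 𝓘(ℝ, N8) (incl ∘ (extChartAt I7 m₀).symm) z =
    fderiv ℝ (inclRep m₀) z := mfderiv_eq_fderiv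
  rw [h2] at h
  rw [h]
  rfl

theorem smoothForm_pull {k : ℕ} {α : N8 → N8 [⋀^Fin k]→L[ℝ] ℝ}
    (hα : ∀ m : M7, ContDiffAt ℝ ∞ α (incl m)) : SmoothForm (pull α) := by
  intro m₀ z hz
  have h := contDiffAt_inclRep hz
  have h2 : ContDiffAt ℝ ∞ (fun z => (α (inclRep m₀ z)).compContinuousLinearMap
      (fderiv ℝ (inclRep m₀) z)) z :=
    contDiffAt_compContinuousAlternating ((hα _).comp z h) (h.fderiv_right (by simp))
  refine (h2.contDiffWithinAt).congr (fun w hw => chartRep_pull α hw) (chartRep_pull α hz)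

/-- Exterior differentiation commutes with pullback by the inclusion read in the chart. Composing
with the differential of the chart then recovers the differential of the inclusion itself. -/
theorem extD_pull {k : ℕ} {α : N8 → N8 [⋀^Fin k]→L[ℝ] ℝ} {m : M7}
    (hα : DifferentiableAt ℝ α (incl m)) : extD (pull α) m = pull (extDeriv α) m := by
  have hz : extChartAt I7 m m ∈ (extChartAt I7 m).target := mem_extChartAt_target m
  have hm : inclRep m (extChartAt I7 m m) = incl m := by simp only [inclRep, extChartAt_to_inv]
  have he : chartRep (pull α) m =ᶠ[nhds (extChartAt I7 m m)] fun z =>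
      (α (inclRep m z)).compContinuousLinearMap (fderiv ℝ (inclRep m) z) := by
    filter_upwards [(isOpen_extChartAt_target m).mem_nhds hz] with z hz using chartRep_pull α hz
  have hF := contDiffAt_inclRep hz
  have hc : MDifferentiableAt I7 𝓘(ℝ, E7) (extChartAt I7 m) m :=
    (contMDiffAt_extChartAt (I := I7) (n := ∞)).mdifferentiableAt (by simp)
  have hd : differential incl m = (fderiv ℝ (inclRep m) (extChartAt I7 m m)).comp
      (differential (extChartAt I7 m) m) := by
    rw [← differential_comp (hF.differentiableAt (by simp)) hc]
    have : incl =ᶠ[nhds m] fun m' => inclRep m (extChartAt I7 m m') := by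
      filter_upwards [extChartAt_source_mem_nhds (I := I7) m] with m' hm'
      simp only [inclRep, (extChartAt I7 m).left_inv hm']
    unfold differential
    rw [this.mfderiv_eq]
    rfl
  rw [extD, he.extDeriv_eq, extDeriv_pullback (by rwa [hm]) hF
    (by
      rw [minSmoothness_of_isRCLikeNormedField]
      exact show ((2 : ℕ∞) : ℕ∞ω) ≤ _ from WithTop.coe_le_coe.2 le_top), pull, hd, hm]
  rfl

theorem differential_fst (m : M7) (v : TangentSpace I7 m) :
    (differential incl m v).1 = (v : E7).1 := by
  have h : differential (fun m => (incl m).1) m = _ :=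
    differential_comp differentiableAt_fst (mdifferentiableAt_incl m)
  have h1 := congrArg (fun L => L v) h
  rw [fderiv_fst] at h1
  refine Eq.trans h1.symm ?_
  have : mfderiv I7 𝓘(ℝ, ℍ[ℝ]) (fun m : M7 => (incl m).1) m =
    ContinuousLinearMap.fst ℝ ℍ[ℝ] (EuclideanSpace ℝ (Fin 3)) := mfderiv_fst
  exact congrArg (fun L : E7 →L[ℝ] ℍ[ℝ] => L v) this

theorem differential_snd (m : M7) (v : TangentSpace I7 m) :
    (differential incl m v).2 =
      (mfderiv (𝓡 3) 𝓘(ℝ, ℍ[ℝ]) ((↑) : S3 → ℍ[ℝ]) m.2 : EuclideanSpace ℝ (Fin 3) →L[ℝ] ℍ[ℝ])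
        (v : E7).2 := by
  have h : differential (fun m => (incl m).2) m = _ :=
    differential_comp differentiableAt_snd (mdifferentiableAt_incl m)
  have h1 := congrArg (fun L => L v) h
  rw [fderiv_snd] at h1
  refine Eq.trans h1.symm ?_
  have h2 := mfderiv_comp (I := I7) (I' := 𝓡 3) (I'' := 𝓘(ℝ, ℍ[ℝ])) (f := fun m : M7 => m.2)
    (g := ((↑) : S3 → ℍ[ℝ])) m
    (((contMDiff_coe_sphere (n := 3)) m.2).mdifferentiableAt (n := ∞) (by simp))
    mdifferentiableAt_snd
  have h3 : mfderiv I7 (𝓡 3) (fun m : M7 => m.2) m =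
    ContinuousLinearMap.snd ℝ ℍ[ℝ] (EuclideanSpace ℝ (Fin 3)) := mfderiv_snd
  rw [h3] at h2
  exact congrArg (fun L : E7 →L[ℝ] ℍ[ℝ] => L v) h2

theorem eq_zero_of_differential_incl {m : M7} {v : TangentSpace I7 m}
    (h : differential incl m v = 0) : v = 0 := by
  have h1 := differential_fst m v
  have h2 := differential_snd m v
  rw [h] at h1 h2
  have h3 : (v : E7).2 = 0 :=
    injective_mvfderiv_subtypeVal_sphere (n := 3) m.2 (h2.symm.trans (map_zero _).symm)
  exact Prod.ext h1.symm h3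

theorem inner_differential_snd (m : M7) (v : TangentSpace I7 m) :
    inner ℝ (m.2 : ℍ[ℝ]) (differential incl m v).2 = 0 := by
  rw [differential_snd]
  have h := range_mvfderiv_subtypeVal (n := 3) m.2
  have h2 : (mfderiv (𝓡 3) 𝓘(ℝ, ℍ[ℝ]) ((↑) : S3 → ℍ[ℝ]) m.2 :
      EuclideanSpace ℝ (Fin 3) →L[ℝ] ℍ[ℝ]) (v : E7).2 ∈ (Submodule.span ℝ {(m.2 : ℍ[ℝ])})ᗮ := by
    rw [← h]
    exact ⟨(v : E7).2, rfl⟩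
  exact Submodule.mem_orthogonal_singleton_iff_inner_right.1 h2

/-! ### Maurer–Cartan forms on the quaternions -/

section MaurerCartan

theorem inner_T_zero (q : ℍ[ℝ]) : inner ℝ (T 0) q = q.imI := by
  rw [Quaternion.inner_def, Quaternion.re_mul]
  simp [T]

theorem inner_T_one (q : ℍ[ℝ]) : inner ℝ (T 1) q = q.imJ := by
  rw [Quaternion.inner_def, Quaternion.re_mul]
  simp [T]

theorem inner_T_two (q : ℍ[ℝ]) : inner ℝ (T 2) q = q.imK := by
  rw [Quaternion.inner_def, Quaternion.re_mul]
  simp [T]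

/-- The Maurer-Cartan forms on the nonzero quaternions. -/
def theta (i : Fin 3) (h : ℍ[ℝ]) : ℍ[ℝ] →L[ℝ] ℝ :=
  (innerSL ℝ (T i)).comp (ContinuousLinearMap.mul ℝ ℍ[ℝ] h⁻¹)

theorem theta_apply (i : Fin 3) (h u : ℍ[ℝ]) : theta i h u = inner ℝ (T i) (h⁻¹ * u) := rfl

theorem contDiffAt_theta {n : ℕ∞ω} (i : Fin 3) {h : ℍ[ℝ]} (hh : h ≠ 0) :
    ContDiffAt ℝ n (theta i) h := by
  have h1 : ContDiffAt ℝ n (fun h : ℍ[ℝ] => h⁻¹) h := by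
    have := contDiffAt_ringInverse (n := n) ℝ (Units.mk0 h hh)
    simpa [Ring.inverse_eq_inv'] using this
  have h2 : ContDiffAt ℝ n (fun h : ℍ[ℝ] => ContinuousLinearMap.mul ℝ ℍ[ℝ] h⁻¹) h :=
    (ContinuousLinearMap.mul ℝ ℍ[ℝ]).contDiff.contDiffAt.comp h h1
  exact contDiffAt_const.clm_comp h2

/-- From `d(h⁻¹) = -h⁻¹ dh h⁻¹` one gets `dθ = -θ ∧ θ`; the relations `[T_i, T_j] = 2ε_{ijk}T_k`
give the factor 2. Indices in `Fin 3` are cyclic. -/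
theorem extDeriv_theta (i : Fin 3) {h : ℍ[ℝ]} (hh : h ≠ 0) :
    extDeriv (fun h => oneForm (theta i h)) h =
      (-2 : ℝ) • wedge2 (theta (i + 1) h) (theta (i + 2) h) := by
  ext v
  have hd : DifferentiableAt ℝ (theta i) h :=
    (contDiffAt_theta (n := 1) i hh).differentiableAt one_ne_zero
  have key : ∀ u w : ℍ[ℝ], fderiv ℝ (theta i) h u w = - inner ℝ (T i) (h⁻¹ * u * h⁻¹ * w) := by
    intro u w
    have h1 : fderiv ℝ (theta i) h u w = fderiv ℝ (fun h => theta i h w) h u := by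
      rw [(hd.hasFDerivAt.clm_apply (hasFDerivAt_const w h)).fderiv]; simp
    rw [h1]
    have h2 := (hasFDerivAt_inv' (𝕜 := ℝ) hh).mul_const' w
    have h3 := ((innerSL ℝ (T i)).hasFDerivAt (x := h⁻¹ * w)).comp h h2
    have h4 : fderiv ℝ (fun h => theta i h w) h = _ := h3.fderiv
    rw [h4]
    simp
  rw [extDeriv_oneForm_apply hd, key, key, ContinuousAlternatingMap.smul_apply, wedge2_apply]
  simp only [theta_apply, mul_assoc (h⁻¹ * _)]
  generalize h⁻¹ * v 0 = a
  generalize h⁻¹ * v 1 = b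
  fin_cases i <;> simp [inner_T_zero, inner_T_one, inner_T_two] <;> ring

variable {E : Type*} [NormedAddCommGroup E] [NormedSpace ℝ E]

/-- The components of `g⁻¹ dg`. -/
def mc (g : E → ℍ[ℝ]) (i : Fin 3) (z : E) : E →L[ℝ] ℝ := (theta i (g z)).comp (fderiv ℝ g z)

theorem contDiffAt_mc {g : E → ℍ[ℝ]} {z : E} (i : Fin 3) (hg : ContDiffAt ℝ ∞ g z)
    (h0 : g z ≠ 0) : ContDiffAt ℝ ∞ (mc g i) z :=
  ((contDiffAt_theta i h0).comp z hg).clm_comp (hg.fderiv_right (by simp))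

theorem extDeriv_mc {g : E → ℍ[ℝ]} {z : E} (i : Fin 3) (hg : ContDiffAt ℝ ∞ g z)
    (h0 : g z ≠ 0) :
    extDeriv (fun z => oneForm (mc g i z)) z =
      (-2 : ℝ) • wedge2 (mc g (i + 1) z) (mc g (i + 2) z) := by
  have h := extDeriv_pullback (differentiableAt_oneForm
    ((contDiffAt_theta (n := 1) i h0).differentiableAt one_ne_zero)) hg
    (by
      rw [minSmoothness_of_isRCLikeNormedField]
      exact show ((2 : ℕ∞) : ℕ∞ω) ≤ _ from WithTop.coe_le_coe.2 le_top)
  simp only [oneForm_comp] at h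
  refine Eq.trans h ?_
  rw [extDeriv_theta i h0]
  change (-2 : ℝ) • (wedge2 _ _).compContinuousLinearMap _ = _
  rw [wedge2_comp]
  rfl

end MaurerCartan

/-! ### The invariant coframe in ambient coordinates -/

/-- The squared distance to the zero section. -/
def sqn (z : N8) : ℝ := ‖z.1‖ ^ 2

theorem sqn_eq (z : N8) : sqn z = z.1.re ^ 2 + z.1.imI ^ 2 + z.1.imJ ^ 2 + z.1.imK ^ 2 := by
  rw [sqn, sq, ← Quaternion.normSq_eq_norm_mul_self, Quaternion.normSq_def']

theorem sqn_pos {z : N8} (hx : z.1 ≠ 0) : 0 < sqn z := by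
  have := norm_pos_iff.2 hx
  unfold sqn; positivity

/-- The real coordinates of the factor `ℝ⁴`. -/
def cx (j : Fin 4) : N8 →L[ℝ] ℝ :=
  (innerSL ℝ ((![1, T 0, T 1, T 2] : Fin 4 → ℍ[ℝ]) j)).comp (ContinuousLinearMap.fst ℝ _ _)

/-- The components of `y⁻¹ dy`. -/
def nu (a : Fin 3) (z : N8) : N8 →L[ℝ] ℝ := mc (fun z : N8 => z.2) a z

/-- The components of `x̄ dx`. -/
def lf (i : Fin 3) (z : N8) : N8 →L[ℝ] ℝ :=
  (innerSL ℝ (T i)).comp ((ContinuousLinearMap.mul ℝ ℍ[ℝ] (star z.1)).comp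
    (ContinuousLinearMap.fst ℝ _ _))

/-- The components of `dx x̄`. -/
def rt (a : Fin 3) (z : N8) : N8 →L[ℝ] ℝ :=
  (innerSL ℝ (T a)).comp (((ContinuousLinearMap.mul ℝ ℍ[ℝ]).flip (star z.1)).comp
    (ContinuousLinearMap.fst ℝ _ _))

/-- The matrix of `v ↦ x v x̄` on the imaginary quaternions. -/
def adm (a i : Fin 3) (x : ℍ[ℝ]) : ℝ := inner ℝ (T a) (x * T i * star x)

/-- The smooth covector `‖x‖² η_i⁻`. -/
def nE (i : Fin 3) (z : N8) : N8 →L[ℝ] ℝ :=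
  (1 / 2 : ℝ) • (adm 0 i z.1 • nu 0 z + adm 1 i z.1 • nu 1 z + adm 2 i z.1 • nu 2 z)

/-- The smooth covector `‖x‖² η_i⁺`. -/
def pE (i : Fin 3) (z : N8) : N8 →L[ℝ] ℝ := lf i z + nE i z

/-- The ambient covector `η_i⁺`. -/
def eP (i : Fin 3) (z : N8) : N8 →L[ℝ] ℝ :=
  (1 / 2 : ℝ) • (mc (fun z : N8 => z.2 * z.1) i z + mc (fun z : N8 => z.1) i z)

/-- The ambient covector `η_i⁻`. -/
def eM (i : Fin 3) (z : N8) : N8 →L[ℝ] ℝ :=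
  (1 / 2 : ℝ) • (mc (fun z : N8 => z.2 * z.1) i z - mc (fun z : N8 => z.1) i z)

/-- The covectors `x η⁺ x⁻¹`. -/
def kap (a : Fin 3) (z : N8) : N8 →L[ℝ] ℝ := (sqn z)⁻¹ • rt a z + (1 / 2 : ℝ) • nu a z

/-- The rotation `v ↦ x v x⁻¹`. -/
def rot (a i : Fin 3) (z : N8) : ℝ := (sqn z)⁻¹ * adm a i z.1

theorem inner_T_apply (q : ℍ[ℝ]) (i : Fin 3) :
    inner ℝ (T i) q = (![q.imI, q.imJ, q.imK] : Fin 3 → ℝ) i := by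
  fin_cases i
  exacts [inner_T_zero q, inner_T_one q, inner_T_two q]

theorem T_re (i : Fin 3) : (T i).re = 0 := by fin_cases i <;> rfl

theorem T_imI (i : Fin 3) : (T i).imI = (![1, 0, 0] : Fin 3 → ℝ) i := by fin_cases i <;> rfl

theorem T_imJ (i : Fin 3) : (T i).imJ = (![0, 1, 0] : Fin 3 → ℝ) i := by fin_cases i <;> rfl

theorem T_imK (i : Fin 3) : (T i).imK = (![0, 0, 1] : Fin 3 → ℝ) i := by fin_cases i <;> rfl

theorem nu_apply (a : Fin 3) (z v : N8) : nu a z v = inner ℝ (T a) (z.2⁻¹ * v.2) := by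
  have : fderiv ℝ (fun z : N8 => z.2) z = _ := fderiv_snd
  simp [nu, mc, this, theta_apply]

theorem lf_apply (i : Fin 3) (z v : N8) : lf i z v = inner ℝ (T i) (star z.1 * v.1) := rfl

theorem rt_apply (i : Fin 3) (z v : N8) : rt i z v = inner ℝ (T i) (v.1 * star z.1) := rfl

theorem mc_fst_apply (i : Fin 3) (z v : N8) :
    mc (fun z : N8 => z.1) i z v = inner ℝ (T i) (z.1⁻¹ * v.1) := by
  have : fderiv ℝ (fun z : N8 => z.1) z = _ := fderiv_fst
  simp [mc, this, theta_apply]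

/-- The product rule `(yx)⁻¹d(yx) = x⁻¹dx + x⁻¹(y⁻¹dy)x`. -/
theorem mc_mul_apply (i : Fin 3) {z : N8} (hy : z.2 ≠ 0) (v : N8) :
    mc (fun z : N8 => z.2 * z.1) i z v =
      inner ℝ (T i) (z.1⁻¹ * v.1 + z.1⁻¹ * (z.2⁻¹ * v.2) * z.1) := by
  have : fderiv ℝ (fun z : N8 => z.2 * z.1) z = _ :=
    ((hasFDerivAt_snd (𝕜 := ℝ) (p := z)).mul' hasFDerivAt_fst).fderiv
  have h2 : (z.2 * z.1)⁻¹ * (z.2 * v.1 + v.2 * z.1) =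
      z.1⁻¹ * v.1 + z.1⁻¹ * (z.2⁻¹ * v.2) * z.1 := by
    rw [mul_inv_rev, mul_add, mul_assoc z.1⁻¹, inv_mul_cancel_left₀ hy]
    simp only [mul_assoc]
  rw [← h2]
  simp [mc, this, theta_apply, mul_add, inner_add_right]

theorem inv_fst (z : N8) : z.1⁻¹ = (sqn z)⁻¹ • star z.1 := by
  rw [sqn, sq, ← Quaternion.normSq_eq_norm_mul_self]; rfl

/-- The term `x⁻¹dx` cancels in the difference, leaving `η⁻ = ½ x⁻¹(y⁻¹dy)x`. With `x⁻¹ = x̄/|x|²`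
its components are those of `y⁻¹dy` paired with `xT_i x̄`. At `x = 0` both sides vanish because `0⁻¹
= 0`. -/
theorem eM_eq (i : Fin 3) {z : N8} (hy : z.2 ≠ 0) : eM i z = (sqn z)⁻¹ • nE i z := by
  refine ContinuousLinearMap.ext fun v => ?_
  simp only [eM, nE, smul_apply, sub_apply,
    add_apply, mc_mul_apply i hy, mc_fst_apply, nu_apply, inv_fst z]
  generalize z.2⁻¹ * v.2 = w
  generalize (sqn z)⁻¹ = c
  simp only [inner_T_apply, adm]
  simp only [Quaternion.imI_mul, Quaternion.imJ_mul, Quaternion.imK_mul, Quaternion.re_mul, T_re,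
    T_imI, T_imJ, T_imK]
  fin_cases i <;> simp <;> ring

theorem eP_eq (i : Fin 3) {z : N8} (hy : z.2 ≠ 0) : eP i z = (sqn z)⁻¹ • pE i z := by
  refine ContinuousLinearMap.ext fun v => ?_
  have h := congrArg (fun L => L v) (eM_eq i hy)
  simp only [eM, smul_apply, sub_apply, smul_eq_mul] at h
  have h2 : mc (fun z : N8 => z.1) i z v = (sqn z)⁻¹ * lf i z v := by
    rw [mc_fst_apply, lf_apply, inv_fst, smul_mul_assoc, inner_smul_right]
  simp only [eP, pE, smul_apply, add_apply, smul_eq_mul]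
  linear_combination h + h2

theorem pE_eq (i : Fin 3) {z : N8} (hx : z.1 ≠ 0) (hy : z.2 ≠ 0) : pE i z = sqn z • eP i z := by
  rw [eP_eq i hy, smul_smul, mul_inv_cancel₀ (sqn_pos hx).ne', one_smul]

theorem nE_eq (i : Fin 3) {z : N8} (hx : z.1 ≠ 0) (hy : z.2 ≠ 0) : nE i z = sqn z • eM i z := by
  rw [eM_eq i hy, smul_smul, mul_inv_cancel₀ (sqn_pos hx).ne', one_smul]

theorem adm_orthogonal (a b : Fin 3) (z : N8) :
    adm a 0 z.1 * adm b 0 z.1 + adm a 1 z.1 * adm b 1 z.1 + adm a 2 z.1 * adm b 2 z.1 =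
      if a = b then sqn z ^ 2 else 0 := by
  rw [sqn_eq]
  simp only [inner_T_apply, adm]
  simp only [Quaternion.imI_mul, Quaternion.imJ_mul, Quaternion.imK_mul, Quaternion.re_mul, T_re,
    T_imI, T_imJ, T_imK]
  fin_cases a <;> fin_cases b <;> simp <;> ring

theorem adm_orthogonal' (a b : Fin 3) (z : N8) :
    adm 0 a z.1 * adm 0 b z.1 + adm 1 a z.1 * adm 1 b z.1 + adm 2 a z.1 * adm 2 b z.1 =
      if a = b then sqn z ^ 2 else 0 := by
  rw [sqn_eq]
  simp only [inner_T_apply, adm]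
  simp only [Quaternion.imI_mul, Quaternion.imJ_mul, Quaternion.imK_mul, Quaternion.re_mul, T_re,
    T_imI, T_imJ, T_imK]
  fin_cases a <;> fin_cases b <;> simp <;> ring

/-- The matrix `adm` is `|x|²` times a rotation, and a rotation equals its own cofactor matrix. -/
theorem adm_cofactor (a i : Fin 3) (z : N8) :
    adm (a + 1) (i + 1) z.1 * adm (a + 2) (i + 2) z.1
      - adm (a + 2) (i + 1) z.1 * adm (a + 1) (i + 2) z.1 = sqn z * adm a i z.1 := by
  rw [sqn_eq]
  simp only [inner_T_apply, adm]
  simp only [Quaternion.imI_mul, Quaternion.imJ_mul, Quaternion.imK_mul, Quaternion.re_mul, T_re,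
    T_imI, T_imJ, T_imK]
  fin_cases a <;> fin_cases i <;> simp <;> ring

theorem eM_rot (i : Fin 3) {z : N8} (hy : z.2 ≠ 0) :
    eM i z = (1 / 2 : ℝ) • (rot 0 i z • nu 0 z + rot 1 i z • nu 1 z + rot 2 i z • nu 2 z) := by
  rw [eM_eq i hy, nE]; simp only [rot]; module

/-- Conjugation by `x` carries `x̄ dx` to `dx x̄` up to the factor `|x|²`. -/
theorem lf_eq (i : Fin 3) (z : N8) : sqn z • lf i z =
    adm 0 i z.1 • rt 0 z + adm 1 i z.1 • rt 1 z + adm 2 i z.1 • rt 2 z := by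
  refine ContinuousLinearMap.ext fun v => ?_
  simp only [smul_apply, add_apply, lf_apply, rt_apply,
    sqn_eq]
  simp only [inner_T_apply, adm]
  simp only [Quaternion.imI_mul, Quaternion.imJ_mul, Quaternion.imK_mul, Quaternion.re_mul, T_re,
    T_imI, T_imJ, T_imK]
  fin_cases i <;> simp <;> ring

theorem eP_rot (i : Fin 3) {z : N8} (hx : z.1 ≠ 0) (hy : z.2 ≠ 0) :
    eP i z = rot 0 i z • kap 0 z + rot 1 i z • kap 1 z + rot 2 i z • kap 2 z := by
  have h0 := (sqn_pos hx).ne'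
  have h : lf i z = (sqn z)⁻¹ • (sqn z • lf i z) := by
    rw [smul_smul, inv_mul_cancel₀ h0, one_smul]
  rw [eP_eq i hy, pE, h, lf_eq, nE]; simp only [rot, kap]; module

theorem rot_orthogonal {z : N8} (hx : z.1 ≠ 0) (a b : Fin 3) :
    rot a 0 z * rot b 0 z + rot a 1 z * rot b 1 z + rot a 2 z * rot b 2 z =
      if a = b then 1 else 0 := by
  have h0 := (sqn_pos hx).ne'
  have := adm_orthogonal a b z
  simp only [rot]
  split_ifs at this ⊢ <;> field_simp <;> linarith

theorem rot_orthogonal' {z : N8} (hx : z.1 ≠ 0) (a b : Fin 3) :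
    rot 0 a z * rot 0 b z + rot 1 a z * rot 1 b z + rot 2 a z * rot 2 b z =
      if a = b then 1 else 0 := by
  have h0 := (sqn_pos hx).ne'
  have := adm_orthogonal' a b z
  simp only [rot]
  split_ifs at this ⊢ <;> field_simp <;> linarith

theorem rot_cofactor {z : N8} (hx : z.1 ≠ 0) (a i : Fin 3) :
    rot (a + 1) (i + 1) z * rot (a + 2) (i + 2) z - rot (a + 2) (i + 1) z * rot (a + 1) (i + 2) z
      = rot a i z := by
  have h0 := (sqn_pos hx).ne'
  have := adm_cofactor a i z
  simp only [rot]
  field_simp; linarith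

section Smoothness

theorem contDiff_sqn : ContDiff ℝ ∞ sqn := contDiff_fst.norm_sq ℝ

theorem contDiff_star_fst : ContDiff ℝ ∞ fun z : N8 => star z.1 := by
  have h : ContDiff ℝ ∞ fun q : ℍ[ℝ] => star q :=
    (LinearMap.toContinuousLinearMap
      (⟨⟨star, star_add⟩, fun c q => Quaternion.star_smul c q⟩ : ℍ[ℝ] →ₗ[ℝ] ℍ[ℝ])).contDiff
  exact h.comp contDiff_fst

theorem contDiff_lf (i : Fin 3) : ContDiff ℝ ∞ (lf i) :=
  contDiff_const.clm_comp (((ContinuousLinearMap.mul ℝ ℍ[ℝ]).contDiff.comp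
    contDiff_star_fst).clm_comp contDiff_const)

theorem contDiff_rt (i : Fin 3) : ContDiff ℝ ∞ (rt i) :=
  contDiff_const.clm_comp (((ContinuousLinearMap.mul ℝ ℍ[ℝ]).flip.contDiff.comp
    contDiff_star_fst).clm_comp contDiff_const)

theorem contDiff_adm (a i : Fin 3) : ContDiff ℝ ∞ fun z : N8 => adm a i z.1 :=
  contDiff_const.inner ℝ ((contDiff_fst.mul contDiff_const).mul contDiff_star_fst)

variable {z : N8}

theorem contDiffAt_nu (i : Fin 3) (hy : z.2 ≠ 0) : ContDiffAt ℝ ∞ (nu i) z :=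
  contDiffAt_mc i contDiffAt_snd hy

theorem contDiffAt_nE (i : Fin 3) (hy : z.2 ≠ 0) : ContDiffAt ℝ ∞ (nE i) z :=
  (((contDiffAt_smul_covector (contDiff_adm 0 i).contDiffAt (contDiffAt_nu 0 hy)).add
    (contDiffAt_smul_covector (contDiff_adm 1 i).contDiffAt (contDiffAt_nu 1 hy))).add
    (contDiffAt_smul_covector (contDiff_adm 2 i).contDiffAt (contDiffAt_nu 2 hy))).const_smul
    (1 / 2 : ℝ)

theorem contDiffAt_pE (i : Fin 3) (hy : z.2 ≠ 0) : ContDiffAt ℝ ∞ (pE i) z :=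
  (contDiff_lf i).contDiffAt.add (contDiffAt_nE i hy)

theorem contDiffAt_mc_mul (i : Fin 3) (hx : z.1 ≠ 0) (hy : z.2 ≠ 0) :
    ContDiffAt ℝ ∞ (mc (fun z : N8 => z.2 * z.1) i) z :=
  contDiffAt_mc i (contDiffAt_snd.mul contDiffAt_fst) (mul_ne_zero hy hx)

theorem contDiffAt_eP (i : Fin 3) (hx : z.1 ≠ 0) (hy : z.2 ≠ 0) : ContDiffAt ℝ ∞ (eP i) z :=
  ((contDiffAt_mc_mul i hx hy).add (contDiffAt_mc i contDiffAt_fst hx)).const_smul (1 / 2 : ℝ)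

theorem contDiffAt_eM (i : Fin 3) (hx : z.1 ≠ 0) (hy : z.2 ≠ 0) : ContDiffAt ℝ ∞ (eM i) z :=
  ((contDiffAt_mc_mul i hx hy).sub (contDiffAt_mc i contDiffAt_fst hx)).const_smul (1 / 2 : ℝ)

end Smoothness

section Algebra

variable {V : Type*} [AddCommGroup V] [Module ℝ V] [TopologicalSpace V]

theorem wedge2_smul_smul (c d : ℝ) (a b : V →L[ℝ] ℝ) :
    wedge2 (c • a) (d • b) = (c * d) • wedge2 a b := by
  ext v
  simp only [wedge2_apply, smul_apply, ContinuousAlternatingMap.smul_apply, smul_eq_mul]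
  ring

theorem wedge3_smul_smul (c d e : ℝ) (a b f : V →L[ℝ] ℝ) :
    wedge3 (c • a) (d • b) (e • f) = (c * d * e) • wedge3 a b f := by
  ext v
  simp only [wedge3_apply, smul_apply, ContinuousAlternatingMap.smul_apply, smul_eq_mul]
  ring

theorem wedge2_comb (m n : Fin 3 → ℝ) (q : Fin 3 → V →L[ℝ] ℝ) :
    wedge2 (m 0 • q 0 + m 1 • q 1 + m 2 • q 2) (n 0 • q 0 + n 1 • q 1 + n 2 • q 2) =
      (m 1 * n 2 - m 2 * n 1) • wedge2 (q 1) (q 2) + (m 2 * n 0 - m 0 * n 2) • wedge2 (q 2) (q 0)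
      + (m 0 * n 1 - m 1 * n 0) • wedge2 (q 0) (q 1) := by
  ext v
  simp only [wedge2_apply, smul_apply, add_apply, ContinuousAlternatingMap.add_apply,
    ContinuousAlternatingMap.smul_apply, smul_eq_mul]
  ring

end Algebra

variable {z : N8}

/-- The action of a rotation on 2-vectors of a three-dimensional space is, under the cyclic
identification, the rotation itself; this is the cofactor identity. -/
theorem wedge2_rot (hx : z.1 ≠ 0) (i : Fin 3) (q : Fin 3 → N8 →L[ℝ] ℝ) :
    wedge2 (rot 0 (i + 1) z • q 0 + rot 1 (i + 1) z • q 1 + rot 2 (i + 1) z • q 2)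
      (rot 0 (i + 2) z • q 0 + rot 1 (i + 2) z • q 1 + rot 2 (i + 2) z • q 2) =
      rot 0 i z • wedge2 (q 1) (q 2) + rot 1 i z • wedge2 (q 2) (q 0)
        + rot 2 i z • wedge2 (q 0) (q 1) := by
  have h := wedge2_comb (fun a => rot a (i + 1) z) (fun a => rot a (i + 2) z) q
  have c0 : rot 1 (i + 1) z * rot 2 (i + 2) z - rot 2 (i + 1) z * rot 1 (i + 2) z = rot 0 i z :=
    rot_cofactor hx 0 i
  have c1 : rot 2 (i + 1) z * rot 0 (i + 2) z - rot 0 (i + 1) z * rot 2 (i + 2) z = rot 1 i z :=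
    rot_cofactor hx 1 i
  have c2 : rot 0 (i + 1) z * rot 1 (i + 2) z - rot 1 (i + 1) z * rot 0 (i + 2) z = rot 2 i z :=
    rot_cofactor hx 2 i
  rw [h, c0, c1, c2]

theorem wedge2_eM (hx : z.1 ≠ 0) (hy : z.2 ≠ 0) (i : Fin 3) :
    wedge2 (eM (i + 1) z) (eM (i + 2) z) = (1 / 4 : ℝ) •
      (rot 0 i z • wedge2 (nu 1 z) (nu 2 z) + rot 1 i z • wedge2 (nu 2 z) (nu 0 z)
        + rot 2 i z • wedge2 (nu 0 z) (nu 1 z)) := by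
  rw [eM_rot _ hy, eM_rot _ hy, wedge2_smul_smul, wedge2_rot hx i fun a => nu a z]
  norm_num

theorem wedge3_eP_eM (hx : z.1 ≠ 0) (hy : z.2 ≠ 0) (i : Fin 3) (a : N8 →L[ℝ] ℝ) :
    wedge3 a (eM (i + 1) z) (eM (i + 2) z) = (1 / 4 : ℝ) •
      (rot 0 i z • wedge3 a (nu 1 z) (nu 2 z) + rot 1 i z • wedge3 a (nu 2 z) (nu 0 z)
        + rot 2 i z • wedge3 a (nu 0 z) (nu 1 z)) := by
  simp only [← oneForm_wedge2, wedge2_eM hx hy i, wedge_smul_right, wedge_add_right]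

theorem kap_eq (hx : z.1 ≠ 0) (hy : z.2 ≠ 0) (a : Fin 3) :
    kap a z = rot a 0 z • eP 0 z + rot a 1 z • eP 1 z + rot a 2 z • eP 2 z := by
  have h0 := rot_orthogonal hx a 0
  have h1 := rot_orthogonal hx a 1
  have h2 := rot_orthogonal hx a 2
  rw [eP_rot 0 hx hy, eP_rot 1 hx hy, eP_rot 2 hx hy]
  trans (rot a 0 z * rot 0 0 z + rot a 1 z * rot 0 1 z + rot a 2 z * rot 0 2 z) • kap 0 z
    + (rot a 0 z * rot 1 0 z + rot a 1 z * rot 1 1 z + rot a 2 z * rot 1 2 z) • kap 1 z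
    + (rot a 0 z * rot 2 0 z + rot a 1 z * rot 2 1 z + rot a 2 z * rot 2 2 z) • kap 2 z
  · rw [h0, h1, h2]
    fin_cases a <;> simp
  · module

/-- The sum is invariant under simultaneous rotation of both triples, so `η⁻` and `η⁺` may be
replaced by `xη⁻x⁻¹ = ½ν` and `xη⁺x⁻¹ = κ`. The singular rotation disappears. -/
theorem sum_wedge2_eM_eP (hx : z.1 ≠ 0) (hy : z.2 ≠ 0) :
    wedge2 (eM 0 z) (eP 0 z) + wedge2 (eM 1 z) (eP 1 z) + wedge2 (eM 2 z) (eP 2 z) =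
      (1 / 2 : ℝ) • (wedge2 (nu 0 z) (kap 0 z) + wedge2 (nu 1 z) (kap 1 z)
        + wedge2 (nu 2 z) (kap 2 z)) := by
  rw [kap_eq hx hy, kap_eq hx hy, kap_eq hx hy, eM_rot _ hy, eM_rot _ hy, eM_rot _ hy]
  ext v
  simp only [wedge2_apply, smul_apply, add_apply, ContinuousAlternatingMap.add_apply,
    ContinuousAlternatingMap.smul_apply, smul_eq_mul]
  ring

/-- The same rotation invariance, using that the vector with components `η_j⁻ ∧ η_k⁻` rotates like
`η⁻`. -/
theorem sum_wedge3_eP_eM_eM (hx : z.1 ≠ 0) (hy : z.2 ≠ 0) :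
    wedge3 (eP 0 z) (eM 1 z) (eM 2 z) + wedge3 (eP 1 z) (eM 2 z) (eM 0 z)
      + wedge3 (eP 2 z) (eM 0 z) (eM 1 z) =
      (1 / 4 : ℝ) • (wedge3 (kap 0 z) (nu 1 z) (nu 2 z) + wedge3 (kap 1 z) (nu 2 z) (nu 0 z)
        + wedge3 (kap 2 z) (nu 0 z) (nu 1 z)) := by
  have h0 := wedge3_eP_eM hx hy 0 (eP 0 z)
  have h1 := wedge3_eP_eM hx hy 1 (eP 1 z)
  have h2 := wedge3_eP_eM hx hy 2 (eP 2 z)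
  simp only [Fin.isValue, zero_add, show (1 + 1 : Fin 3) = 2 from rfl,
    show (1 + 2 : Fin 3) = 0 from rfl, show (2 + 1 : Fin 3) = 0 from rfl,
    show (2 + 2 : Fin 3) = 1 from rfl] at h0 h1 h2
  rw [h0, h1, h2, kap_eq hx hy, kap_eq hx hy, kap_eq hx hy]
  ext v
  simp only [wedge3_apply, smul_apply, add_apply, ContinuousAlternatingMap.add_apply,
    ContinuousAlternatingMap.smul_apply, smul_eq_mul]
  ring

theorem wedge3_rot (hx : z.1 ≠ 0) (q : Fin 3 → N8 →L[ℝ] ℝ) :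
    wedge3 (rot 0 0 z • q 0 + rot 1 0 z • q 1 + rot 2 0 z • q 2)
      (rot 0 1 z • q 0 + rot 1 1 z • q 1 + rot 2 1 z • q 2)
      (rot 0 2 z • q 0 + rot 1 2 z • q 1 + rot 2 2 z • q 2) = wedge3 (q 0) (q 1) (q 2) := by
  have h := wedge2_rot hx 0 q
  simp only [Fin.isValue, zero_add] at h
  rw [← oneForm_wedge2, h]
  simp only [wedge_smul_right, wedge_add_right, oneForm_wedge2]
  have h1 : wedge3 (q 0) (q 1) (q 2) = (rot 0 0 z * rot 0 0 z + rot 1 0 z * rot 1 0 z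
      + rot 2 0 z * rot 2 0 z) • wedge3 (q 0) (q 1) (q 2) := by
    rw [rot_orthogonal' hx 0 0]; simp
  rw [h1]
  ext v
  simp only [wedge3_apply, smul_apply, add_apply, ContinuousAlternatingMap.add_apply,
    ContinuousAlternatingMap.smul_apply, smul_eq_mul]
  ring

theorem wedge3_eP (hx : z.1 ≠ 0) (hy : z.2 ≠ 0) :
    wedge3 (eP 0 z) (eP 1 z) (eP 2 z) = wedge3 (kap 0 z) (kap 1 z) (kap 2 z) := by
  rw [eP_rot _ hx hy, eP_rot _ hx hy, eP_rot _ hx hy, wedge3_rot hx fun a => kap a z]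

theorem wedge3_eM (hx : z.1 ≠ 0) (hy : z.2 ≠ 0) :
    wedge3 (eM 0 z) (eM 1 z) (eM 2 z) = (1 / 8 : ℝ) • wedge3 (nu 0 z) (nu 1 z) (nu 2 z) := by
  rw [eM_rot _ hy, eM_rot _ hy, eM_rot _ hy, wedge3_smul_smul, wedge3_rot hx fun a => nu a z]
  norm_num

/-! ### Primitives of `φ` and `ψ` that are regular at the zero section -/

/-- The contraction of the radial vector field with the volume form of `ℝ⁴`. -/
def radialVol (z : N8) : N8 [⋀^Fin 3]→L[ℝ] ℝ :=
  z.1.re • wedge3 (cx 1) (cx 2) (cx 3) - z.1.imI • wedge3 (cx 0) (cx 2) (cx 3)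
    + z.1.imJ • wedge3 (cx 0) (cx 1) (cx 3) - z.1.imK • wedge3 (cx 0) (cx 1) (cx 2)

/-- The triple product of the components of `dx x̄` is divisible by `|x|²`. The quotient is what
makes the term `4|x|⁴ η⁺₁₂₃` of the primitive of `ψ` smooth. -/
theorem wedge3_rt (z : N8) :
    wedge3 (rt 0 z) (rt 1 z) (rt 2 z) = sqn z • radialVol z := by
  have e0 : ∀ v : N8, cx 0 v = v.1.re := fun v => by
    change inner ℝ (1 : ℍ[ℝ]) v.1 = _
    rw [Quaternion.inner_def]; simp
  have e1 : ∀ v : N8, cx 1 v = v.1.imI := fun v => inner_T_zero v.1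
  have e2 : ∀ v : N8, cx 2 v = v.1.imJ := fun v => inner_T_one v.1
  have e3 : ∀ v : N8, cx 3 v = v.1.imK := fun v => inner_T_two v.1
  ext v
  simp only [radialVol, wedge3_apply, ContinuousAlternatingMap.add_apply,
    ContinuousAlternatingMap.sub_apply, ContinuousAlternatingMap.smul_apply, smul_eq_mul, rt_apply,
    inner_T_zero, inner_T_one, inner_T_two, e0, e1, e2, e3, sqn_eq, Quaternion.imI_mul,
    Quaternion.imJ_mul, Quaternion.imK_mul, Quaternion.re_star, Quaternion.imI_star,
    Quaternion.imJ_star, Quaternion.imK_star]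
  ring

/-- The primitive of `φ - (27/8) ν₁ ∧ ν₂ ∧ ν₃`. -/
def betaA (z : N8) : N8 [⋀^Fin 2]→L[ℝ] ℝ :=
  (3 : ℝ) • (wedge2 (nu 0 z) (rt 0 z) + wedge2 (nu 1 z) (rt 1 z) + wedge2 (nu 2 z) (rt 2 z))
    + (4 / 3 : ℝ) • wedge2 (nE 0 z) (pE 0 z)
    + (3 + 4 / 9 * sqn z) • (wedge2 (nE 1 z) (pE 1 z) + wedge2 (nE 2 z) (pE 2 z))

/-- The form `‖x‖⁴ η_i⁺ ∧ η_j⁻ ∧ η_k⁻` for a cyclic permutation `(i, j, k)`,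
up to the factor `4`. -/
def mixedForm (i : Fin 3) (z : N8) : N8 [⋀^Fin 3]→L[ℝ] ℝ :=
  adm 0 i z.1 • wedge3 (pE i z) (nu 1 z) (nu 2 z) + adm 1 i z.1 • wedge3 (pE i z) (nu 2 z) (nu 0 z)
    + adm 2 i z.1 • wedge3 (pE i z) (nu 0 z) (nu 1 z)

/-- The primitive of `ψ`. -/
def gammaA (z : N8) : N8 [⋀^Fin 3]→L[ℝ] ℝ :=
  (4 : ℝ) • radialVol z
    + (2 : ℝ) • (wedge3 (rt 0 z) (rt 1 z) (nu 2 z) + wedge3 (rt 1 z) (rt 2 z) (nu 0 z)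
      + wedge3 (rt 2 z) (rt 0 z) (nu 1 z))
    + (sqn z - 9 / 2) • (wedge3 (rt 0 z) (nu 1 z) (nu 2 z) + wedge3 (rt 1 z) (nu 2 z) (nu 0 z)
      + wedge3 (rt 2 z) (nu 0 z) (nu 1 z))
    + (sqn z * (sqn z / 2 - 27 / 4)) • wedge3 (nu 0 z) (nu 1 z) (nu 2 z)
    + (8 / 9 : ℝ) • wedge3 (pE 0 z) (pE 1 z) (pE 2 z)
    + (-2 - 2 / 9 * sqn z) • mixedForm 0 z
    + (-13 / 4 - sqn z - sqn z ^ 2 / 9) • (mixedForm 1 z + mixedForm 2 z)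

variable {z : N8}

theorem contDiffAt_betaA (hy : z.2 ≠ 0) : ContDiffAt ℝ ∞ betaA z := by
  have hs : ContDiffAt ℝ ∞ sqn z := contDiff_sqn.contDiffAt
  have hr : ∀ i, ContDiffAt ℝ ∞ (rt i) z := fun i => (contDiff_rt i).contDiffAt
  have hn := fun i => contDiffAt_nu i hy
  have hN := fun i => contDiffAt_nE i hy
  have hP := fun i => contDiffAt_pE i hy
  refine (((((contDiffAt_wedge2 (hn 0) (hr 0)).add (contDiffAt_wedge2 (hn 1) (hr 1))).add
    (contDiffAt_wedge2 (hn 2) (hr 2))).const_smul (3 : ℝ)).add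
    ((contDiffAt_wedge2 (hN 0) (hP 0)).const_smul (4 / 3 : ℝ))).add
    (contDiffAt_smul_form (contDiffAt_const.add (contDiffAt_const.mul hs))
      ((contDiffAt_wedge2 (hN 1) (hP 1)).add (contDiffAt_wedge2 (hN 2) (hP 2))))

theorem contDiff_radialVol : ContDiff ℝ ∞ radialVol := by
  have h : ∀ q : ℍ[ℝ], ContDiff ℝ ∞ fun z : N8 => inner ℝ q z.1 := fun q =>
    contDiff_const.inner ℝ contDiff_fst
  have h0 : ContDiff ℝ ∞ fun z : N8 => z.1.re := by
    convert h 1 using 2 with z; rw [Quaternion.inner_def]; simp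
  have h1 : ContDiff ℝ ∞ fun z : N8 => z.1.imI := by
    convert h (T 0) using 2 with z; rw [inner_T_zero]
  have h2 : ContDiff ℝ ∞ fun z : N8 => z.1.imJ := by
    convert h (T 1) using 2 with z; rw [inner_T_one]
  have h3 : ContDiff ℝ ∞ fun z : N8 => z.1.imK := by
    convert h (T 2) using 2 with z; rw [inner_T_two]
  refine contDiff_iff_contDiffAt.2 fun z => ?_
  exact (((contDiffAt_smul_form h0.contDiffAt contDiffAt_const).sub
    (contDiffAt_smul_form h1.contDiffAt contDiffAt_const)).add
    (contDiffAt_smul_form h2.contDiffAt contDiffAt_const)).sub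
    (contDiffAt_smul_form h3.contDiffAt contDiffAt_const)

theorem contDiffAt_mixedForm (hy : z.2 ≠ 0) (i : Fin 3) : ContDiffAt ℝ ∞ (mixedForm i) z := by
  have hn := fun i => contDiffAt_nu i hy
  have hP := fun i => contDiffAt_pE i hy
  have ha := fun a => (contDiff_adm a i).contDiffAt (x := z)
  exact ((contDiffAt_smul_form (ha 0) (contDiffAt_wedge3 (hP i) (hn 1) (hn 2))).add
    (contDiffAt_smul_form (ha 1) (contDiffAt_wedge3 (hP i) (hn 2) (hn 0)))).add
    (contDiffAt_smul_form (ha 2) (contDiffAt_wedge3 (hP i) (hn 0) (hn 1)))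

theorem contDiffAt_gammaA (hy : z.2 ≠ 0) : ContDiffAt ℝ ∞ gammaA z := by
  have hs : ContDiffAt ℝ ∞ sqn z := contDiff_sqn.contDiffAt
  have hr : ∀ i, ContDiffAt ℝ ∞ (rt i) z := fun i => (contDiff_rt i).contDiffAt
  have hn := fun i => contDiffAt_nu i hy
  have hP := fun i => contDiffAt_pE i hy
  have hM := contDiffAt_mixedForm hy
  have c1 : ContDiffAt ℝ ∞ (fun z => sqn z - 9 / 2) z := hs.sub contDiffAt_const
  have c2 : ContDiffAt ℝ ∞ (fun z => sqn z * (sqn z / 2 - 27 / 4)) z :=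
    hs.mul ((hs.div_const _).sub contDiffAt_const)
  have c3 : ContDiffAt ℝ ∞ (fun z => -2 - 2 / 9 * sqn z) z :=
    contDiffAt_const.sub (contDiffAt_const.mul hs)
  have c4 : ContDiffAt ℝ ∞ (fun z => -13 / 4 - sqn z - sqn z ^ 2 / 9) z :=
    (contDiffAt_const.sub hs).sub ((hs.pow 2).div_const _)
  exact ((((((contDiff_radialVol.contDiffAt.const_smul (4 : ℝ)).add
    ((((contDiffAt_wedge3 (hr 0) (hr 1) (hn 2)).add (contDiffAt_wedge3 (hr 1) (hr 2) (hn 0))).add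
      (contDiffAt_wedge3 (hr 2) (hr 0) (hn 1))).const_smul (2 : ℝ))).add
    (contDiffAt_smul_form c1
      (((contDiffAt_wedge3 (hr 0) (hn 1) (hn 2)).add (contDiffAt_wedge3 (hr 1) (hn 2) (hn 0))).add
      (contDiffAt_wedge3 (hr 2) (hn 0) (hn 1))))).add
    (contDiffAt_smul_form c2 (contDiffAt_wedge3 (hn 0) (hn 1) (hn 2)))).add
    ((contDiffAt_wedge3 (hP 0) (hP 1) (hP 2)).const_smul (8 / 9 : ℝ))).add
    (contDiffAt_smul_form c3 (hM 0))).add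
    (contDiffAt_smul_form c4 ((hM 1).add (hM 2)))

theorem sqn_smul_kap (hx : z.1 ≠ 0) (a : Fin 3) :
    rt a z = sqn z • kap a z + (-(sqn z / 2)) • nu a z := by
  have h0 := (sqn_pos hx).ne'
  rw [kap, smul_add, smul_smul, mul_inv_cancel₀ h0]
  module

/-- The coefficients are the primitives in `r`, vanishing at `9/4`, of the coefficients `8r/3` and
`(4/3)(r² - 9/16)` of `dr ∧ η_i⁻ ∧ η_i⁺` in `φ`. Their common linear part `6|x|²` is not divisible
by `|x|⁴`, so it is carried by the rotation-invariant sum `Σ ν_a ∧ rt_a`; the rest is absorbed by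
`nE ∧ pE`. -/
theorem betaA_eq (hx : z.1 ≠ 0) (hy : z.2 ≠ 0) :
    betaA z = (6 * sqn z + 4 / 3 * sqn z ^ 2) • wedge2 (eM 0 z) (eP 0 z)
      + (6 * sqn z + 3 * sqn z ^ 2 + 4 / 9 * sqn z ^ 3) •
        (wedge2 (eM 1 z) (eP 1 z) + wedge2 (eM 2 z) (eP 2 z)) := by
  have h1 : wedge2 (nu 0 z) (rt 0 z) + wedge2 (nu 1 z) (rt 1 z) + wedge2 (nu 2 z) (rt 2 z)
      = (2 * sqn z) • (wedge2 (eM 0 z) (eP 0 z) + wedge2 (eM 1 z) (eP 1 z)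
        + wedge2 (eM 2 z) (eP 2 z)) := by
    rw [sum_wedge2_eM_eP hx hy, sqn_smul_kap hx, sqn_smul_kap hx, sqn_smul_kap hx]
    ext v
    simp only [wedge2_apply, smul_apply, add_apply, ContinuousAlternatingMap.add_apply,
      ContinuousAlternatingMap.smul_apply, smul_eq_mul]
    ring
  rw [betaA, h1]
  simp only [pE_eq _ hx hy, nE_eq _ hx hy, wedge2_smul_smul]
  module

/-- Since `η_j⁻ ∧ η_k⁻` involves the rotation matrix only linearly, the factor `|x|⁴` suffices for
smoothness, where `pE ∧ nE ∧ nE` would cost `|x|⁶`. -/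
theorem mixedForm_eq (hx : z.1 ≠ 0) (hy : z.2 ≠ 0) (i : Fin 3) :
    mixedForm i z = (4 * sqn z ^ 2) • wedge3 (eP i z) (eM (i + 1) z) (eM (i + 2) z) := by
  have h0 := (sqn_pos hx).ne'
  rw [wedge3_eP_eM hx hy, mixedForm, pE_eq _ hx hy]
  have ha : ∀ a, adm a i z.1 = sqn z * rot a i z := fun a => by simp only [rot]; field_simp
  simp only [ha]
  have hs : ∀ b c : N8 →L[ℝ] ℝ, wedge3 (sqn z • eP i z) b c = sqn z • wedge3 (eP i z) b c :=
    fun b c => by simpa using wedge3_smul_smul (sqn z) 1 1 (eP i z) b c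
  simp only [hs]
  module

theorem radialVol_eq (hx : z.1 ≠ 0) :
    radialVol z = (sqn z)⁻¹ • wedge3 (rt 0 z) (rt 1 z) (rt 2 z) := by
  rw [wedge3_rt, smul_smul, inv_mul_cancel₀ (sqn_pos hx).ne', one_smul]

/-- The coefficients are again primitives in `r`, vanishing at `9/4`, of those of the terms of `ψ`
containing `dr`. The lowest-order part, `4|x|⁴ η⁺₁₂₃` and `-18|x|²` times the cyclic sum of
`η⁺η⁻η⁻`, is rotation invariant. The remainder has enough powers of `|x|²` for `pE` and `mixedForm`.
-/
theorem gammaA_eq (hx : z.1 ≠ 0) (hy : z.2 ≠ 0) :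
    gammaA z = (4 * sqn z ^ 2 + 8 / 9 * sqn z ^ 3) • wedge3 (eP 0 z) (eP 1 z) (eP 2 z)
      + (-18 * sqn z - 8 * sqn z ^ 2 - 8 / 9 * sqn z ^ 3) • wedge3 (eP 0 z) (eM 1 z) (eM 2 z)
      + (-18 * sqn z - 13 * sqn z ^ 2 - 4 * sqn z ^ 3 - 4 / 9 * sqn z ^ 4) •
        (wedge3 (eP 1 z) (eM 2 z) (eM 0 z) + wedge3 (eP 2 z) (eM 0 z) (eM 1 z)) := by
  have h0 := (sqn_pos hx).ne'
  have m0 : mixedForm 0 z = (4 * sqn z ^ 2) • wedge3 (eP 0 z) (eM 1 z) (eM 2 z) :=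
    mixedForm_eq hx hy 0
  have m1 : mixedForm 1 z = (4 * sqn z ^ 2) • wedge3 (eP 1 z) (eM 2 z) (eM 0 z) :=
    mixedForm_eq hx hy 1
  have m2 : mixedForm 2 z = (4 * sqn z ^ 2) • wedge3 (eP 2 z) (eM 0 z) (eM 1 z) :=
    mixedForm_eq hx hy 2
  -- Rotation-invariant part: substitute `κ = |x|⁻² rt + ½ν` and expand.
  have key : (4 : ℝ) • radialVol z
    + (2 : ℝ) • (wedge3 (rt 0 z) (rt 1 z) (nu 2 z) + wedge3 (rt 1 z) (rt 2 z) (nu 0 z)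
      + wedge3 (rt 2 z) (rt 0 z) (nu 1 z))
    + (sqn z - 9 / 2) • (wedge3 (rt 0 z) (nu 1 z) (nu 2 z) + wedge3 (rt 1 z) (nu 2 z) (nu 0 z)
      + wedge3 (rt 2 z) (nu 0 z) (nu 1 z))
    + (sqn z * (sqn z / 2 - 27 / 4)) • wedge3 (nu 0 z) (nu 1 z) (nu 2 z) =
    (4 * sqn z ^ 2) • wedge3 (eP 0 z) (eP 1 z) (eP 2 z) + (-18 * sqn z) •
      (wedge3 (eP 0 z) (eM 1 z) (eM 2 z) + wedge3 (eP 1 z) (eM 2 z) (eM 0 z)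
      + wedge3 (eP 2 z) (eM 0 z) (eM 1 z)) := by
    rw [sum_wedge3_eP_eM_eM hx hy, wedge3_eP hx hy, radialVol_eq hx, sqn_smul_kap hx,
      sqn_smul_kap hx, sqn_smul_kap hx]
    ext v
    simp only [wedge3_apply, smul_apply, add_apply, ContinuousAlternatingMap.add_apply,
      ContinuousAlternatingMap.smul_apply, smul_eq_mul]
    field_simp
    ring
  rw [gammaA, key, m0, m1, m2, pE_eq _ hx hy, pE_eq _ hx hy, pE_eq _ hx hy, wedge3_smul_smul]
  module

/-! ### Exterior derivatives of the primitives off the zero section -/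

/-- The differential of `‖x‖²`. -/
def dsq (z : N8) : N8 →L[ℝ] ℝ :=
  ((2 : ℝ) • innerSL ℝ z.1).comp (ContinuousLinearMap.fst ℝ ℍ[ℝ] ℍ[ℝ])

theorem hasFDerivAt_sqn (z : N8) : HasFDerivAt sqn (dsq z) z := by
  have h := (hasStrictFDerivAt_norm_sq z.1).hasFDerivAt.comp z (hasFDerivAt_fst (𝕜 := ℝ) (p := z))
  refine h.congr_fderiv ?_
  refine ContinuousLinearMap.ext fun v => ?_
  simp [dsq]

variable {z : N8}

theorem extDeriv_oneForm_comb {a b : N8 → N8 →L[ℝ] ℝ} {da db : N8 [⋀^Fin 2]→L[ℝ] ℝ}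
    (c d : ℝ) (ha : DifferentiableAt ℝ a z) (hb : DifferentiableAt ℝ b z)
    (hda : extDeriv (fun z => oneForm (a z)) z = da)
    (hdb : extDeriv (fun z => oneForm (b z)) z = db) :
    extDeriv (fun z => oneForm (c • a z + d • b z)) z = c • da + d • db := by
  subst hda hdb
  simp only [oneForm_add, oneForm_smul]
  rw [extDeriv_fun_add ((differentiableAt_oneForm ha).fun_const_smul c)
    ((differentiableAt_oneForm hb).fun_const_smul d)]
  exact congrArg₂ (· + ·) (extDeriv_smul c _) (extDeriv_smul d _)

/-- Half the sum of the two Maurer–Cartan equations: with `σ = η⁺ + η⁻` and `σ' = η⁺ - η⁻`, the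
mixed products cancel. -/
theorem extDeriv_eP (hx : z.1 ≠ 0) (hy : z.2 ≠ 0) (i : Fin 3) :
    extDeriv (fun z => oneForm (eP i z)) z =
      (-2 : ℝ) • (wedge2 (eP (i + 1) z) (eP (i + 2) z) + wedge2 (eM (i + 1) z) (eM (i + 2) z)) := by
  have h1 := (contDiffAt_mc_mul i hx hy).differentiableAt (by simp)
  have h2 := (contDiffAt_mc (z := z) i contDiffAt_fst hx).differentiableAt (by simp)
  have h := extDeriv_oneForm_comb (1 / 2) (1 / 2) h1 h2
    (extDeriv_mc i (contDiffAt_snd.mul contDiffAt_fst) (mul_ne_zero hy hx))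
    (extDeriv_mc i contDiffAt_fst hx)
  simp only [← smul_add] at h
  refine Eq.trans h ?_
  ext v
  simp only [eP, eM, wedge2_apply, smul_apply, add_apply, sub_apply,
    ContinuousAlternatingMap.add_apply, ContinuousAlternatingMap.smul_apply, smul_eq_mul]
  ring

theorem extDeriv_eM (hx : z.1 ≠ 0) (hy : z.2 ≠ 0) (i : Fin 3) :
    extDeriv (fun z => oneForm (eM i z)) z =
      (-2 : ℝ) • (wedge2 (eP (i + 1) z) (eM (i + 2) z) + wedge2 (eM (i + 1) z) (eP (i + 2) z)) := by
  have h1 := (contDiffAt_mc_mul i hx hy).differentiableAt (by simp)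
  have h2 := (contDiffAt_mc (z := z) i contDiffAt_fst hx).differentiableAt (by simp)
  have h := extDeriv_oneForm_comb (1 / 2) (-(1 / 2)) h1 h2
    (extDeriv_mc i (contDiffAt_snd.mul contDiffAt_fst) (mul_ne_zero hy hx))
    (extDeriv_mc i contDiffAt_fst hx)
  have e : (fun z => oneForm (eM i z)) = fun z => oneForm ((1 / 2 : ℝ) •
      mc (fun z : N8 => z.2 * z.1) i z + (-(1 / 2) : ℝ) • mc (fun z : N8 => z.1) i z) := by
    funext z; congr 1; rw [eM]; module
  rw [e, h]
  ext v
  simp only [eP, eM, wedge2_apply, smul_apply, add_apply, sub_apply,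
    ContinuousAlternatingMap.add_apply, ContinuousAlternatingMap.smul_apply, smul_eq_mul]
  ring

theorem extDeriv_smul_wedge2_apply {f : N8 → ℝ} {f' : N8 →L[ℝ] ℝ} {a b : N8 → N8 →L[ℝ] ℝ}
    {da db : N8 [⋀^Fin 2]→L[ℝ] ℝ} (hf : HasFDerivAt f f' z) (ha : DifferentiableAt ℝ a z)
    (hb : DifferentiableAt ℝ b z) (hda : extDeriv (fun z => oneForm (a z)) z = da)
    (hdb : extDeriv (fun z => oneForm (b z)) z = db) (v : Fin 3 → N8) :
    extDeriv (fun z => f z • wedge2 (a z) (b z)) z v = wedge3 f' (a z) (b z) v + f z *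
      (da ![v 0, v 1] * b z (v 2) - da ![v 0, v 2] * b z (v 1) + da ![v 1, v 2] * b z (v 0)
      - (a z (v 0) * db ![v 1, v 2] - a z (v 1) * db ![v 0, v 2]
        + a z (v 2) * db ![v 0, v 1])) := by
  rw [extDeriv_smul_apply hf (differentiableAt_wedge2 ha hb),
    extDeriv_wedge2_apply ha hb v hda hdb]
  congr 1
  simp [Fin.sum_univ_three, wedge2_apply, wedge3_apply, Fin.removeNth, Fin.succAbove]
  ring

theorem extDeriv_smul_wedge3_apply {f : N8 → ℝ} {f' : N8 →L[ℝ] ℝ} {a b c : N8 → N8 →L[ℝ] ℝ}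
    (hf : HasFDerivAt f f' z) (ha : DifferentiableAt ℝ a z)
    (hb : DifferentiableAt ℝ b z) (hc : DifferentiableAt ℝ c z) (v : Fin 4 → N8) :
    extDeriv (fun z => f z • wedge3 (a z) (b z) (c z)) z v = wedge4 f' (a z) (b z) (c z) v + f z *
      extDeriv (fun z => wedge3 (a z) (b z) (c z)) z v := by
  rw [extDeriv_smul_apply hf (differentiableAt_wedge3 ha hb hc)]
  congr 1
  simp [Fin.sum_univ_four, wedge4_apply, wedge3_apply, Fin.removeNth, Fin.succAbove]
  ring

/-- The three-form `φ` on a neighbourhood of `ℝ⁴ × S³`. -/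
def phiA (z : N8) : N8 [⋀^Fin 3]→L[ℝ] ℝ :=
  (27 / 8 : ℝ) • wedge3 (nu 0 z) (nu 1 z) (nu 2 z) + extDeriv betaA z

/-- The expression of `φ` in the coframe `d‖x‖², η⁺, η⁻`. -/
def phiEta (r : ℝ) (z : N8) : N8 [⋀^Fin 3]→L[ℝ] ℝ :=
  (8 * r / 3) • wedge3 (dsq z) (eM 0 z) (eP 0 z)
    + (4 / 3 * (r ^ 2 - 9 / 16)) •
      (wedge3 (dsq z) (eM 1 z) (eP 1 z) + wedge3 (dsq z) (eM 2 z) (eP 2 z))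
    + (16 / 9 * r * (r + 9 / 4) * (r - 3 / 4)) • wedge3 (eM 0 z) (eM 1 z) (eM 2 z)
    - (8 / 3 * (r ^ 2 - 81 / 16)) •
      (wedge3 (eP 0 z) (eP 1 z) (eM 2 z) + wedge3 (eP 0 z) (eM 1 z) (eP 2 z))
    - (16 / 9 * r * (r - 9 / 4) * (r + 3 / 4)) • wedge3 (eM 0 z) (eP 1 z) (eP 2 z)

theorem eventually_ne (hx : z.1 ≠ 0) (hy : z.2 ≠ 0) :
    ∀ᶠ w : N8 in nhds z, w.1 ≠ 0 ∧ w.2 ≠ 0 :=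
  (continuous_fst.continuousAt.eventually_ne hx).and (continuous_snd.continuousAt.eventually_ne hy)

/-- Differentiating the coefficients of `β` produces the terms with `dr`, and the structure
equations produce those without. The polynomials agree up to the constant 27 in front of `η⁻₁₂₃`,
the value at `r = 9/4`, which the closed form `(27/8) ν₁ν₂ν₃` supplies. -/
theorem phiA_eq (hx : z.1 ≠ 0) (hy : z.2 ≠ 0) : phiA z = phiEta (9 / 4 + sqn z) z := by
  have hP := fun i => (contDiffAt_eP i hx hy).differentiableAt (by simp)
  have hM := fun i => (contDiffAt_eM i hx hy).differentiableAt (by simp)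
  have he : betaA =ᶠ[nhds z] fun z => ((6 * sqn z + 4 / 3 * sqn z ^ 2) • wedge2 (eM 0 z) (eP 0 z)
      + (6 * sqn z + 3 * sqn z ^ 2 + 4 / 9 * sqn z ^ 3) • wedge2 (eM 1 z) (eP 1 z))
      + (6 * sqn z + 3 * sqn z ^ 2 + 4 / 9 * sqn z ^ 3) • wedge2 (eM 2 z) (eP 2 z) := by
    filter_upwards [eventually_ne hx hy] with w hw
    rw [betaA_eq hw.1 hw.2]; module
  have hs := hasFDerivAt_sqn z
  have f1 : HasFDerivAt (fun z => 6 * sqn z + 4 / 3 * sqn z ^ 2)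
      ((6 + 8 / 3 * sqn z) • dsq z) z :=
    ((hs.const_mul 6).fun_add ((hs.pow 2).const_mul (4 / 3))).congr_fderiv (by
      simp; module)
  have f2 : HasFDerivAt (fun z => 6 * sqn z + 3 * sqn z ^ 2 + 4 / 9 * sqn z ^ 3)
      ((6 + 6 * sqn z + 4 / 3 * sqn z ^ 2) • dsq z) z :=
    (((hs.const_mul 6).fun_add ((hs.pow 2).const_mul 3)).fun_add
      ((hs.pow 3).const_mul (4 / 9))).congr_fderiv (by simp; module)
  have d1 := (f1.differentiableAt).fun_smul (differentiableAt_wedge2 (hM 0) (hP 0))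
  have d2 := (f2.differentiableAt).fun_smul (differentiableAt_wedge2 (hM 1) (hP 1))
  have d3 := (f2.differentiableAt).fun_smul (differentiableAt_wedge2 (hM 2) (hP 2))
  have n1 : wedge3 (nu 0 z) (nu 1 z) (nu 2 z) = (8 : ℝ) • wedge3 (eM 0 z) (eM 1 z) (eM 2 z) := by
    rw [wedge3_eM hx hy, smul_smul]; norm_num
  rw [phiA, n1, he.extDeriv_eq, extDeriv_fun_add (d1.fun_add d2) d3, extDeriv_fun_add d1 d2, phiEta]
  ext v
  simp only [ContinuousAlternatingMap.add_apply, ContinuousAlternatingMap.sub_apply]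
  rw [extDeriv_smul_wedge2_apply f1 (hM 0) (hP 0) (extDeriv_eM hx hy 0) (extDeriv_eP hx hy 0),
    extDeriv_smul_wedge2_apply f2 (hM 1) (hP 1) (extDeriv_eM hx hy 1) (extDeriv_eP hx hy 1),
    extDeriv_smul_wedge2_apply f2 (hM 2) (hP 2) (extDeriv_eM hx hy 2) (extDeriv_eP hx hy 2)]
  simp only [Fin.isValue, zero_add, show (1 + 1 : Fin 3) = 2 from rfl,
    show (1 + 2 : Fin 3) = 0 from rfl, show (2 + 1 : Fin 3) = 0 from rfl,
    show (2 + 2 : Fin 3) = 1 from rfl, wedge2_apply, wedge3_apply, smul_apply,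
    ContinuousAlternatingMap.add_apply, ContinuousAlternatingMap.smul_apply, smul_eq_mul,
    Matrix.cons_val_zero, Matrix.cons_val_one]
  ring

variable {z : N8}

/-- The four-form `ψ` on a neighbourhood of `ℝ⁴ × S³`. -/
def psiA (z : N8) : N8 [⋀^Fin 4]→L[ℝ] ℝ := extDeriv gammaA z

/-- The expression of `ψ` in the coframe `d‖x‖², η⁺, η⁻`. -/
def psiEta (r : ℝ) (z : N8) : N8 [⋀^Fin 4]→L[ℝ] ℝ :=
  (32 / 9 * r * (r ^ 2 - 81 / 16)) •
      (wedge4 (eM 0 z) (eP 0 z) (eM 1 z) (eP 1 z) + wedge4 (eM 0 z) (eP 0 z) (eM 2 z) (eP 2 z))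
    + (16 / 9 * (r ^ 2 - 81 / 16) * (r ^ 2 - 9 / 16)) •
      wedge4 (eM 1 z) (eP 1 z) (eM 2 z) (eP 2 z)
    + (8 / 3 * (r - 9 / 4) * (r + 3 / 4)) • wedge4 (dsq z) (eP 0 z) (eP 1 z) (eP 2 z)
    - (16 / 9 * r * (r ^ 2 - 9 / 16)) • (wedge4 (dsq z) (eM 0 z) (eM 1 z) (eP 2 z)
      + wedge4 (dsq z) (eM 0 z) (eP 1 z) (eM 2 z))
    - (8 / 3 * (r + 9 / 4) * (r - 3 / 4)) • wedge4 (dsq z) (eP 0 z) (eM 1 z) (eM 2 z)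

theorem psiEta_apply (r : ℝ) (z : N8) (v : Fin 4 → N8) : psiEta r z v =
    (32 / 9 * r * (r ^ 2 - 81 / 16)) *
      (wedge4 (eM 0 z) (eP 0 z) (eM 1 z) (eP 1 z) v + wedge4 (eM 0 z) (eP 0 z) (eM 2 z) (eP 2 z) v)
    + (16 / 9 * (r ^ 2 - 81 / 16) * (r ^ 2 - 9 / 16)) *
      wedge4 (eM 1 z) (eP 1 z) (eM 2 z) (eP 2 z) v
    + (8 / 3 * (r - 9 / 4) * (r + 3 / 4)) * wedge4 (dsq z) (eP 0 z) (eP 1 z) (eP 2 z) v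
    - (16 / 9 * r * (r ^ 2 - 9 / 16)) * (wedge4 (dsq z) (eM 0 z) (eM 1 z) (eP 2 z) v
      + wedge4 (dsq z) (eM 0 z) (eP 1 z) (eM 2 z) v)
    - (8 / 3 * (r + 9 / 4) * (r - 3 / 4)) * wedge4 (dsq z) (eP 0 z) (eM 1 z) (eM 2 z) v := by
  simp only [psiEta, ContinuousAlternatingMap.sub_apply, ContinuousAlternatingMap.add_apply,
    ContinuousAlternatingMap.smul_apply, smul_eq_mul]

/-- The exterior derivative of `a ∧ b ∧ c` when the derivatives of the factors have two terms. -/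
theorem extDeriv_wedge3_of_eq {a b c a₁ a₂ a₃ a₄ b₁ b₂ b₃ b₄ c₁ c₂ c₃ c₄ : N8 → N8 →L[ℝ] ℝ}
    (ha : DifferentiableAt ℝ a z) (hb : DifferentiableAt ℝ b z) (hc : DifferentiableAt ℝ c z)
    (hda : extDeriv (fun z => oneForm (a z)) z =
      (-2 : ℝ) • (wedge2 (a₁ z) (a₂ z) + wedge2 (a₃ z) (a₄ z)))
    (hdb : extDeriv (fun z => oneForm (b z)) z =
      (-2 : ℝ) • (wedge2 (b₁ z) (b₂ z) + wedge2 (b₃ z) (b₄ z)))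
    (hdc : extDeriv (fun z => oneForm (c z)) z =
      (-2 : ℝ) • (wedge2 (c₁ z) (c₂ z) + wedge2 (c₃ z) (c₄ z))) (v : Fin 4 → N8) :
    extDeriv (fun z => wedge3 (a z) (b z) (c z)) z v =
      -2 * (wedge4 (a₁ z) (a₂ z) (b z) (c z) v + wedge4 (a₃ z) (a₄ z) (b z) (c z) v)
      + 2 * (wedge4 (a z) (b₁ z) (b₂ z) (c z) v + wedge4 (a z) (b₃ z) (b₄ z) (c z) v)
      - 2 * (wedge4 (a z) (b z) (c₁ z) (c₂ z) v + wedge4 (a z) (b z) (c₃ z) (c₄ z) v) := by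
  rw [extDeriv_wedge3_apply ha hb hc v hda hdb hdc]
  simp only [wedge4_apply, wedge2_apply, ContinuousAlternatingMap.add_apply,
    ContinuousAlternatingMap.smul_apply, smul_eq_mul, Matrix.cons_val_zero, Matrix.cons_val_one]
  ring

theorem psiA_eq (hx : z.1 ≠ 0) (hy : z.2 ≠ 0) : psiA z = psiEta (9 / 4 + sqn z) z := by
  have hP := fun i => (contDiffAt_eP i hx hy).differentiableAt (by simp)
  have hM := fun i => (contDiffAt_eM i hx hy).differentiableAt (by simp)
  have he : gammaA =ᶠ[nhds z] fun z =>
      (((4 * sqn z ^ 2 + 8 / 9 * sqn z ^ 3) • wedge3 (eP 0 z) (eP 1 z) (eP 2 z)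
      + (-18 * sqn z - 8 * sqn z ^ 2 - 8 / 9 * sqn z ^ 3) • wedge3 (eP 0 z) (eM 1 z) (eM 2 z))
      + (-18 * sqn z - 13 * sqn z ^ 2 - 4 * sqn z ^ 3 - 4 / 9 * sqn z ^ 4) •
        wedge3 (eP 1 z) (eM 2 z) (eM 0 z)) +
      (-18 * sqn z - 13 * sqn z ^ 2 - 4 * sqn z ^ 3 - 4 / 9 * sqn z ^ 4) •
        wedge3 (eP 2 z) (eM 0 z) (eM 1 z) := by
    filter_upwards [eventually_ne hx hy] with w hw
    rw [gammaA_eq hw.1 hw.2]; module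
  have hs := hasFDerivAt_sqn z
  have f1 : HasFDerivAt (fun z => 4 * sqn z ^ 2 + 8 / 9 * sqn z ^ 3)
      ((8 * sqn z + 8 / 3 * sqn z ^ 2) • dsq z) z :=
    (((hs.pow 2).const_mul 4).fun_add ((hs.pow 3).const_mul (8 / 9))).congr_fderiv (by
      simp; module)
  have f2 : HasFDerivAt (fun z => -18 * sqn z - 8 * sqn z ^ 2 - 8 / 9 * sqn z ^ 3)
      ((-18 - 16 * sqn z - 8 / 3 * sqn z ^ 2) • dsq z) z :=
    (((hs.const_mul (-18)).fun_sub ((hs.pow 2).const_mul 8)).fun_sub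
      ((hs.pow 3).const_mul (8 / 9))).congr_fderiv (by simp; module)
  have f3 : HasFDerivAt (fun z => -18 * sqn z - 13 * sqn z ^ 2 - 4 * sqn z ^ 3 - 4 / 9 * sqn z ^ 4)
      ((-18 - 26 * sqn z - 12 * sqn z ^ 2 - 16 / 9 * sqn z ^ 3) • dsq z) z :=
    ((((hs.const_mul (-18)).fun_sub ((hs.pow 2).const_mul 13)).fun_sub
      ((hs.pow 3).const_mul 4)).fun_sub ((hs.pow 4).const_mul (4 / 9))).congr_fderiv (by
        simp; module)
  have d1 := (f1.differentiableAt).fun_smul (differentiableAt_wedge3 (hP 0) (hP 1) (hP 2))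
  have d2 := (f2.differentiableAt).fun_smul (differentiableAt_wedge3 (hP 0) (hM 1) (hM 2))
  have d3 := (f3.differentiableAt).fun_smul (differentiableAt_wedge3 (hP 1) (hM 2) (hM 0))
  have d4 := (f3.differentiableAt).fun_smul (differentiableAt_wedge3 (hP 2) (hM 0) (hM 1))
  -- Local shorthands for the structure equations, one triple of which is used for each cubic
  -- monomial.
  have eP' := fun i => extDeriv_eP hx hy i
  have eM' := fun i => extDeriv_eM hx hy i
  rw [psiA, he.extDeriv_eq, extDeriv_fun_add ((d1.fun_add d2).fun_add d3) d4,
    extDeriv_fun_add (d1.fun_add d2) d3, extDeriv_fun_add d1 d2, psiEta]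
  ext v
  simp only [ContinuousAlternatingMap.add_apply, ContinuousAlternatingMap.sub_apply]
  rw [extDeriv_smul_wedge3_apply f1 (hP 0) (hP 1) (hP 2),
    extDeriv_smul_wedge3_apply f2 (hP 0) (hM 1) (hM 2),
    extDeriv_smul_wedge3_apply f3 (hP 1) (hM 2) (hM 0),
    extDeriv_smul_wedge3_apply f3 (hP 2) (hM 0) (hM 1),
    extDeriv_wedge3_of_eq (hP 0) (hP 1) (hP 2) (eP' 0) (eP' 1) (eP' 2),
    extDeriv_wedge3_of_eq (hP 0) (hM 1) (hM 2) (eP' 0) (eM' 1) (eM' 2),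
    extDeriv_wedge3_of_eq (hP 1) (hM 2) (hM 0) (eP' 1) (eM' 2) (eM' 0),
    extDeriv_wedge3_of_eq (hP 2) (hM 0) (hM 1) (eP' 2) (eM' 0) (eM' 1)]
  simp only [Fin.isValue, zero_add, show (1 + 1 : Fin 3) = 2 from rfl,
    show (1 + 2 : Fin 3) = 0 from rfl, show (2 + 1 : Fin 3) = 0 from rfl,
    show (2 + 2 : Fin 3) = 1 from rfl, wedge4_apply, smul_apply,
    ContinuousAlternatingMap.add_apply, ContinuousAlternatingMap.smul_apply, smul_eq_mul]
  ring

/-! ### Comparison with the BGGG forms off the zero section -/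

theorem incl_snd_ne (m : M7) : (incl m).2 ≠ 0 := by
  have h : ‖(m.2 : ℍ[ℝ])‖ = 1 := by simp
  intro h0
  rw [show (m.2 : ℍ[ℝ]) = 0 from h0] at h
  simp at h

theorem radius_eq (m : M7) : radius m = 9 / 4 + sqn (incl m) := rfl

theorem inner_T_coe (i : Fin 3) : inner ℝ (T i) (1 : ℍ[ℝ]) = 0 := by
  rw [inner_T_apply]; fin_cases i <;> simp

/-- `(sh)⁻¹d(sh) = h⁻¹dh + s⁻¹ds`, and the last term is real, hence orthogonal to every `T_i`. Thus
normalising `x` to `q = x/|x|` does not affect the coframe. -/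
theorem mc_smul {E : Type*} [NormedAddCommGroup E] [NormedSpace ℝ E] {s : E → ℝ} {h : E → ℍ[ℝ]}
    {z : E} (i : Fin 3) (hs : DifferentiableAt ℝ s z) (hh : DifferentiableAt ℝ h z)
    (s0 : s z ≠ 0) (h0 : h z ≠ 0) : mc (fun z => s z • h z) i z = mc h i z := by
  refine ContinuousLinearMap.ext fun v => ?_
  have hd : fderiv ℝ (fun z => s z • h z) z = _ := (hs.hasFDerivAt.fun_smul hh.hasFDerivAt).fderiv
  have e : (s z • h z)⁻¹ * (s z • fderiv ℝ h z v + fderiv ℝ s z v • h z) =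
      (h z)⁻¹ * fderiv ℝ h z v + ((s z)⁻¹ * fderiv ℝ s z v) • (1 : ℍ[ℝ]) := by
    have e1 : (s z • h z)⁻¹ = (s z)⁻¹ • (h z)⁻¹ := by
      apply inv_eq_of_mul_eq_one_right
      rw [smul_mul_smul_comm, mul_inv_cancel₀ s0, mul_inv_cancel₀ h0, one_smul]
    rw [e1, mul_add, smul_mul_smul_comm, smul_mul_smul_comm, inv_mul_cancel₀ s0, one_smul,
      inv_mul_cancel₀ h0]
  simp only [mc, ContinuousLinearMap.comp_apply, theta_apply, hd, add_apply, smul_apply,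
    ContinuousLinearMap.smulRight_apply]
  rw [e, inner_add_right, inner_smul_right, inner_T_coe, mul_zero, add_zero]

variable {m : M7}

theorem maurerCartan_comp {g : N8 → ℍ[ℝ]} (i : Fin 3) (hg : DifferentiableAt ℝ g (incl m)) :
    maurerCartan (fun m => g (incl m)) i m = (mc g i (incl m)).comp (differential incl m) := by
  rw [maurerCartan, differential_comp hg (mdifferentiableAt_incl m)]
  rfl

theorem differentiableAt_inv_norm_fst {z : N8} (hx : z.1 ≠ 0) :
    DifferentiableAt ℝ (fun z : N8 => ‖z.1‖⁻¹) z :=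
  (((contDiffAt_norm ℝ hx).differentiableAt (n := 1) one_ne_zero).comp z
    differentiableAt_fst).inv (norm_ne_zero_iff.2 hx)

theorem maurerCartan_coordQ (hx : m.1 ≠ 0) (i : Fin 3) : maurerCartan coordQ i m =
    (mc (fun z : N8 => z.1) i (incl m)).comp (differential incl m) := by
  have hx' : (incl m).1 ≠ 0 := hx
  have hs := differentiableAt_inv_norm_fst hx'
  have e : coordQ = fun m => (fun z : N8 => ‖z.1‖⁻¹ • z.1) (incl m) := rfl
  rw [e, maurerCartan_comp i (hs.fun_smul differentiableAt_fst),
    mc_smul i hs differentiableAt_fst (inv_ne_zero (norm_ne_zero_iff.2 hx')) hx']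

theorem maurerCartan_coordP (hx : m.1 ≠ 0) (i : Fin 3) : maurerCartan coordP i m =
    (mc (fun z : N8 => z.2 * z.1) i (incl m)).comp (differential incl m) := by
  have hx' : (incl m).1 ≠ 0 := hx
  have hs := differentiableAt_inv_norm_fst hx'
  have hm : DifferentiableAt ℝ (fun z : N8 => z.2 * z.1) (incl m) :=
    differentiableAt_snd.mul differentiableAt_fst
  have e : coordP = fun m => (fun z : N8 => ‖z.1‖⁻¹ • (z.2 * z.1)) (incl m) := by
    funext m
    simp only [coordP, coordQ, mul_smul_comm, incl]
  rw [e, maurerCartan_comp i (hs.fun_smul hm), mc_smul i hs hm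
    (inv_ne_zero (norm_ne_zero_iff.2 hx')) (mul_ne_zero (incl_snd_ne m) hx')]

theorem etaP_eq (hx : m.1 ≠ 0) (i : Fin 3) :
    etaP i m = (eP i (incl m)).comp (differential incl m) := by
  rw [etaP, maurerCartan_coordP hx, maurerCartan_coordQ hx, eP, ContinuousLinearMap.smul_comp,
    ContinuousLinearMap.add_comp]

theorem etaM_eq (hx : m.1 ≠ 0) (i : Fin 3) :
    etaM i m = (eM i (incl m)).comp (differential incl m) := by
  rw [etaM, maurerCartan_coordP hx, maurerCartan_coordQ hx, eM, ContinuousLinearMap.smul_comp,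
    ContinuousLinearMap.sub_comp]

theorem differential_radius (m : M7) :
    differential radius m = (dsq (incl m)).comp (differential incl m) := by
  have e : radius = fun m => (fun z => 9 / 4 + sqn z) (incl m) := rfl
  have h := (hasFDerivAt_sqn (incl m)).const_add (9 / 4)
  rw [e, differential_comp h.differentiableAt (mdifferentiableAt_incl m), h.fderiv]

theorem A2_mul_B2 {r : ℝ} (hr : 9 / 4 ≤ r) : A2 r * B2 r =
    √((r - 3 / 4) * (r + 3 / 4)) * √((r - 9 / 4) * (r + 9 / 4)) / 3 := by
  have h1 : 0 ≤ (r - 9 / 4) * (r + 3 / 4) / 3 := by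
    have := mul_nonneg (show 0 ≤ r - 9 / 4 by linarith) (show 0 ≤ r + 3 / 4 by linarith)
    linarith
  have h2 : 0 ≤ (r - 3 / 4) * (r + 3 / 4) :=
    mul_nonneg (show 0 ≤ r - 3 / 4 by linarith) (show 0 ≤ r + 3 / 4 by linarith)
  rw [A2, B2, ← Real.sqrt_mul h1, ← Real.sqrt_mul h2, eq_div_iff (by norm_num)]
  have h3 : (3 : ℝ) = √9 := by rw [show (9 : ℝ) = 3 ^ 2 by norm_num, Real.sqrt_sq (by norm_num)]
  rw [h3, ← Real.sqrt_mul' _ (by norm_num)]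
  congr 1; norm_num; ring

theorem A2_sq {r : ℝ} (hr : 9 / 4 ≤ r) : A2 r ^ 2 = (r - 9 / 4) * (r + 3 / 4) / 3 := by
  have := mul_nonneg (show 0 ≤ r - 9 / 4 by linarith) (show 0 ≤ r + 3 / 4 by linarith)
  rw [A2, Real.sq_sqrt (by linarith)]

theorem B2_sq {r : ℝ} (hr : 9 / 4 ≤ r) : B2 r ^ 2 = (r + 9 / 4) * (r - 3 / 4) / 3 := by
  have := mul_nonneg (show 0 ≤ r + 9 / 4 by linarith) (show 0 ≤ r - 3 / 4 by linarith)
  rw [B2, Real.sq_sqrt (by linarith)]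

/-- The coefficient of `dr` in `ds`. -/
def speed (r : ℝ) : ℝ := √((r - 3 / 4) * (r + 3 / 4)) / √((r - 9 / 4) * (r + 9 / 4))

theorem sqrt_pos_left {r : ℝ} (hr : 9 / 4 < r) : 0 < √((r - 3 / 4) * (r + 3 / 4)) :=
  Real.sqrt_pos.2 (mul_pos (by linarith) (by linarith))

theorem sqrt_pos_right {r : ℝ} (hr : 9 / 4 < r) : 0 < √((r - 9 / 4) * (r + 9 / 4)) :=
  Real.sqrt_pos.2 (mul_pos (by linarith) (by linarith))

/-- This and the next two identities remove all square roots: in the coframe `dr, η^±` the roots in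
`φ` and `ψ` occur only through these products and through `A₂²`, `B₂²`. -/
theorem speed_mul_A1 {r : ℝ} (hr : 9 / 4 < r) : speed r * A1 r = 1 := by
  have h1 := (sqrt_pos_left hr).ne'
  have h2 := (sqrt_pos_right hr).ne'
  rw [speed, A1]
  generalize √((r - 3 / 4) * (r + 3 / 4)) = a at *
  generalize √((r - 9 / 4) * (r + 9 / 4)) = b at *
  field_simp

theorem speed_mul_A2_mul_B2 {r : ℝ} (hr : 9 / 4 < r) :
    speed r * (A2 r * B2 r) = (r ^ 2 - 9 / 16) / 3 := by
  have h2 := (sqrt_pos_right hr).ne'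
  have h3 := Real.sq_sqrt (mul_pos (show 0 < r - 3 / 4 by linarith)
    (show 0 < r + 3 / 4 by linarith)).le
  rw [speed, A2_mul_B2 hr.le]
  generalize √((r - 3 / 4) * (r + 3 / 4)) = a at *
  generalize √((r - 9 / 4) * (r + 9 / 4)) = b at *
  rw [show a / b * (a * b / 3) = a ^ 2 / 3 by field_simp, h3]; ring

theorem A1_mul_A2_mul_B2 {r : ℝ} (hr : 9 / 4 < r) :
    A1 r * (A2 r * B2 r) = (r ^ 2 - 81 / 16) / 3 := by
  have h2 := (sqrt_pos_left hr).ne'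
  have h3 := Real.sq_sqrt (mul_pos (show 0 < r - 9 / 4 by linarith)
    (show 0 < r + 9 / 4 by linarith)).le
  rw [A1, A2_mul_B2 hr.le]
  generalize √((r - 3 / 4) * (r + 3 / 4)) = a at *
  generalize √((r - 9 / 4) * (r + 9 / 4)) = b at *
  rw [show b / a * (a * b / 3) = b ^ 2 / 3 by field_simp, h3]; ring

theorem ds_eq (m : M7) : ds m = speed (radius m) • (dsq (incl m)).comp (differential incl m) := by
  rw [ds, differential_radius, speed]

theorem radius_gt (hx : m.1 ≠ 0) : 9 / 4 < radius m := by
  have : 0 < sqn (incl m) := sqn_pos hx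
  rw [radius_eq]; linarith

theorem wedge3_smul_left {V : Type*} [AddCommGroup V] [Module ℝ V] [TopologicalSpace V] (c : ℝ)
    (a b d : V →L[ℝ] ℝ) : wedge3 (c • a) b d = c • wedge3 a b d := by
  simp only [← oneForm_wedge2, oneForm_smul, wedge_smul_left]

theorem wedge4_smul_left {V : Type*} [AddCommGroup V] [Module ℝ V] [TopologicalSpace V] (c : ℝ)
    (a b d e : V →L[ℝ] ℝ) : wedge4 (c • a) b d e = c • wedge4 a b d e := by
  simp only [← oneForm_wedge3, oneForm_smul, wedge_smul_left]

/-- After replacing `ds` by `speed · d|x|²`, only the five coefficient identities `k1` to `k5`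
remain. -/
theorem phi_eq (hx : m.1 ≠ 0) : phi m = pull phiA m := by
  have hr := radius_gt hx
  have c1 := speed_mul_A1 hr
  have c2 := speed_mul_A2_mul_B2 hr
  have c3 := A1_mul_A2_mul_B2 hr
  have c4 := A2_sq hr.le
  have c5 := B2_sq hr.le
  rw [pull, phiA_eq (z := incl m) hx (incl_snd_ne m), ← radius_eq]
  have e : phi m = (speed (radius m) * (4 * A1 (radius m) * B1 (radius m))) •
      wedge3 ((dsq (incl m)).comp (differential incl m)) (etaM 0 m) (etaP 0 m) +
      (speed (radius m) * (4 * A2 (radius m) * B2 (radius m))) •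
      (wedge3 ((dsq (incl m)).comp (differential incl m)) (etaM 1 m) (etaP 1 m) +
      wedge3 ((dsq (incl m)).comp (differential incl m)) (etaM 2 m) (etaP 2 m)) + OmegaRe m := by
    rw [phi, omega, ds_eq]
    simp only [wedge_add_right, wedge_smul_right, oneForm_wedge2, wedge3_smul_left]
    module
  rw [e, OmegaRe]
  generalize radius m = r at *
  have k1 : speed r * (4 * A1 r * B1 r) = 8 * r / 3 := by
    rw [B1]; linear_combination (8 / 3 * r) * c1
  have k2 : speed r * (4 * A2 r * B2 r) = 4 / 3 * (r ^ 2 - 9 / 16) := by linear_combination 4 * c2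
  have k3 : 8 * B1 r * B2 r ^ 2 = 16 / 9 * r * (r + 9 / 4) * (r - 3 / 4) := by
    rw [c5, B1]; ring
  have k4 : 8 * A1 r * A2 r * B2 r = 8 / 3 * (r ^ 2 - 81 / 16) := by linear_combination 8 * c3
  have k5 : 8 * A2 r ^ 2 * B1 r = 16 / 9 * r * (r - 9 / 4) * (r + 3 / 4) := by
    rw [c4, B1]; ring
  rw [k1, k2, k3, k4, k5, phiEta]
  simp only [etaP_eq hx, etaM_eq hx, ← wedge3_comp]
  ext v
  simp
  ring

theorem psi_eq (hx : m.1 ≠ 0) : psi m = pull psiA m := by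
  have hr := radius_gt hx
  have c1 := speed_mul_A1 hr
  have c2 := speed_mul_A2_mul_B2 hr
  have c3 := A1_mul_A2_mul_B2 hr
  have c4 := A2_sq hr.le
  have c5 := B2_sq hr.le
  rw [pull, psiA_eq (z := incl m) hx (incl_snd_ne m), ← radius_eq]
  -- In `½ ω ∧ ω` the squares vanish and each mixed product occurs twice, since 2-forms commute.
  have w0 : ∀ {V : Type} [AddCommGroup V] [Module ℝ V] [TopologicalSpace V] (a b : V →L[ℝ] ℝ),
      wedge4 a b a b = 0 := fun a b => by ext v; rw [wedge4_apply]; simp; ring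
  have ws : ∀ {V : Type} [AddCommGroup V] [Module ℝ V] [TopologicalSpace V] (a b c d : V →L[ℝ] ℝ),
      wedge4 a b c d = wedge4 c d a b := fun a b c d => by
    ext v; rw [wedge4_apply, wedge4_apply]; ring
  have e : psi m =
      (4 * A1 (radius m) * B1 (radius m) * (4 * A2 (radius m) * B2 (radius m))) •
        (wedge4 (etaM 0 m) (etaP 0 m) (etaM 1 m) (etaP 1 m)
          + wedge4 (etaM 0 m) (etaP 0 m) (etaM 2 m) (etaP 2 m))
      + (4 * A2 (radius m) * B2 (radius m)) ^ 2 •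
        wedge4 (etaM 1 m) (etaP 1 m) (etaM 2 m) (etaP 2 m)
      + (speed (radius m) * (8 * A2 (radius m) ^ 2 * A1 (radius m))) •
        wedge4 ((dsq (incl m)).comp (differential incl m)) (etaP 0 m) (etaP 1 m) (etaP 2 m)
      - (speed (radius m) * (8 * B1 (radius m) * B2 (radius m) * A2 (radius m))) •
        (wedge4 ((dsq (incl m)).comp (differential incl m)) (etaM 0 m) (etaM 1 m) (etaP 2 m)
        + wedge4 ((dsq (incl m)).comp (differential incl m)) (etaM 0 m) (etaP 1 m) (etaM 2 m))
      - (speed (radius m) * (8 * A1 (radius m) * B2 (radius m) ^ 2)) •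
        wedge4 ((dsq (incl m)).comp (differential incl m)) (etaP 0 m) (etaM 1 m) (etaM 2 m) := by
    rw [psi, omega, OmegaIm, ds_eq]
    simp only [wedge_add_right, wedge_smul_right, oneForm_wedge3, wedge4_smul_left, wedge_add_left,
      wedge_smul_left, wedge2_wedge2, w0]
    rw [ws (etaM 1 m) (etaP 1 m) (etaM 0 m) (etaP 0 m),
      ws (etaM 2 m) (etaP 2 m) (etaM 0 m) (etaP 0 m),
      ws (etaM 2 m) (etaP 2 m) (etaM 1 m) (etaP 1 m)]
    module
  rw [e]
  generalize radius m = r at *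
  have k1 : 4 * A1 r * B1 r * (4 * A2 r * B2 r) = 32 / 9 * r * (r ^ 2 - 81 / 16) := by
    rw [B1]; linear_combination (32 / 3 * r) * c3
  have k2 : (4 * A2 r * B2 r) ^ 2 = 16 / 9 * (r ^ 2 - 81 / 16) * (r ^ 2 - 9 / 16) := by
    rw [mul_pow, mul_pow, c4, c5]; ring
  have k3 : speed r * (8 * A2 r ^ 2 * A1 r) = 8 / 3 * (r - 9 / 4) * (r + 3 / 4) := by
    rw [c4]; linear_combination (8 / 3 * (r - 9 / 4) * (r + 3 / 4)) * c1
  have k4 : speed r * (8 * B1 r * B2 r * A2 r) = 16 / 9 * r * (r ^ 2 - 9 / 16) := by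
    rw [B1]; linear_combination (16 / 3 * r) * c2
  have k5 : speed r * (8 * A1 r * B2 r ^ 2) = 8 / 3 * (r + 9 / 4) * (r - 3 / 4) := by
    rw [c5]; linear_combination (8 / 3 * (r + 9 / 4) * (r - 3 / 4)) * c1
  rw [k1, k2, k3, k4, k5, psiEta]
  simp only [etaP_eq hx, etaM_eq hx, ← wedge4_comp]
  ext v
  simp

/-! ### Smoothness and closedness -/

theorem contDiffAt_extDeriv {E : Type*} [NormedAddCommGroup E] [NormedSpace ℝ E] {k : ℕ}
    {α : E → E [⋀^Fin k]→L[ℝ] ℝ} {z : E} (h : ContDiffAt ℝ ∞ α z) :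
    ContDiffAt ℝ ∞ (extDeriv α) z := by
  have := (ContinuousAlternatingMap.alternatizeUncurryFinCLM ℝ E ℝ (n := k)).contDiff.contDiffAt
    |>.comp z (h.fderiv_right (m := ∞) (by simp))
  exact this

theorem contDiffAt_phiA {z : N8} (hy : z.2 ≠ 0) : ContDiffAt ℝ ∞ phiA z := by
  have hn := fun i => contDiffAt_nu i hy
  exact ((contDiffAt_wedge3 (hn 0) (hn 1) (hn 2)).const_smul (27 / 8 : ℝ)).add
    (contDiffAt_extDeriv (contDiffAt_betaA hy))

theorem smoothForm_phi : SmoothForm (pull phiA) :=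
  smoothForm_pull fun m => contDiffAt_phiA (incl_snd_ne m)

theorem contDiffAt_psiA {z : N8} (hy : z.2 ≠ 0) : ContDiffAt ℝ ∞ psiA z :=
  contDiffAt_extDeriv (contDiffAt_gammaA hy)

theorem smoothForm_psi : SmoothForm (pull psiA) :=
  smoothForm_pull fun m => contDiffAt_psiA (incl_snd_ne m)

theorem two_le_infty : minSmoothness ℝ 2 ≤ (∞ : ℕ∞ω) := by
  rw [minSmoothness_of_isRCLikeNormedField]
  exact show ((2 : ℕ∞) : ℕ∞ω) ≤ _ from WithTop.coe_le_coe.2 le_top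

theorem coclosed_psi (m : M7) : extD (pull psiA) m = 0 := by
  have hy := incl_snd_ne m
  rw [extD_pull ((contDiffAt_psiA hy).differentiableAt (by simp)), pull]
  have : extDeriv psiA (incl m) = 0 := extDeriv_extDeriv_apply (contDiffAt_gammaA hy) two_le_infty
  rw [this]
  ext v
  simp

/-- By the Maurer–Cartan equation each `dν_a` is a multiple of the product of the other two forms,
so every Leibniz term repeats a covector. -/
theorem extDeriv_wedge3_nu {z : N8} (hy : z.2 ≠ 0) :
    extDeriv (fun z => wedge3 (nu 0 z) (nu 1 z) (nu 2 z)) z = 0 := by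
  ext v
  have hd := fun i => (contDiffAt_nu i hy).differentiableAt (by simp)
  have he := fun i => extDeriv_mc (z := z) i contDiffAt_snd hy
  rw [extDeriv_wedge3_apply (hd 0) (hd 1) (hd 2) v (he 0) (he 1) (he 2)]
  simp only [ContinuousAlternatingMap.smul_apply, wedge2_apply, smul_eq_mul,
    Matrix.cons_val_zero, Matrix.cons_val_one, ContinuousAlternatingMap.coe_zero, Pi.zero_apply, nu,
    show (0 + 1 : Fin 3) = 1 from rfl, show (0 + 2 : Fin 3) = 2 from rfl,
    show (1 + 1 : Fin 3) = 2 from rfl, show (1 + 2 : Fin 3) = 0 from rfl,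
    show (2 + 1 : Fin 3) = 0 from rfl, show (2 + 2 : Fin 3) = 1 from rfl]
  ring

theorem extDeriv_phiA {z : N8} (hy : z.2 ≠ 0) : extDeriv phiA z = 0 := by
  have hn := fun i => (contDiffAt_nu i hy).differentiableAt (by simp)
  have h1 := extDeriv_wedge3_nu hy
  have h2 := extDeriv_extDeriv_apply (contDiffAt_betaA hy) two_le_infty
  have h3 : extDeriv (fun z => (27 / 8 : ℝ) • wedge3 (nu 0 z) (nu 1 z) (nu 2 z)) z = 0 := by
    refine (extDeriv_smul (27 / 8 : ℝ) fun z => wedge3 (nu 0 z) (nu 1 z) (nu 2 z)).trans ?_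
    rw [h1, smul_zero]
  refine (extDeriv_fun_add ((differentiableAt_wedge3 (hn 0) (hn 1) (hn 2)).fun_const_smul _)
    ((contDiffAt_extDeriv (contDiffAt_betaA hy)).differentiableAt (by simp))).trans ?_
  rw [h3, h2, add_zero]

theorem closed_phi (m : M7) : extD (pull phiA) m = 0 := by
  have hy := incl_snd_ne m
  rw [extD_pull ((contDiffAt_phiA hy).differentiableAt (by simp)), pull, extDeriv_phiA hy]
  ext v
  simp

/-! ### Values of `φ` and `ψ` along the zero section -/

section ZeroSection

theorem cx_zero (v : N8) : cx 0 v = v.1.re := by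
  change inner ℝ (1 : ℍ[ℝ]) v.1 = _
  rw [Quaternion.inner_def]; simp

theorem cx_one (v : N8) : cx 1 v = v.1.imI := inner_T_zero v.1

theorem cx_two (v : N8) : cx 2 v = v.1.imJ := inner_T_one v.1

theorem cx_three (v : N8) : cx 3 v = v.1.imK := inner_T_two v.1

theorem fderiv_rt (i : Fin 3) (z u v : N8) : fderiv ℝ (rt i) z u v = rt i u v := by
  let L : N8 →L[ℝ] N8 →L[ℝ] ℝ := LinearMap.toContinuousLinearMap
    { toFun := rt i
      map_add' := fun a b => ContinuousLinearMap.ext fun v => by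
        simp [rt_apply, mul_add, inner_add_right]
      map_smul' := fun c a => ContinuousLinearMap.ext fun v => by
        simp [rt_apply, inner_smul_right] }
  have h : fderiv ℝ (rt i) z = L := L.fderiv
  rw [h]; rfl

theorem fderiv_lf (i : Fin 3) (z u v : N8) : fderiv ℝ (lf i) z u v = lf i u v := by
  let L : N8 →L[ℝ] N8 →L[ℝ] ℝ := LinearMap.toContinuousLinearMap
    { toFun := lf i
      map_add' := fun a b => ContinuousLinearMap.ext fun v => by
        simp [lf_apply, add_mul, inner_add_right]
      map_smul' := fun c a => ContinuousLinearMap.ext fun v => by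
        simp [lf_apply, inner_smul_right] }
  have h : fderiv ℝ (lf i) z = L := L.fderiv
  rw [h]; rfl

/-- The self-dual two-forms `2 (dx₀ ∧ dx_a + dx_b ∧ dx_c)`. -/
def sdForm : Fin 3 → N8 [⋀^Fin 2]→L[ℝ] ℝ :=
  ![(2 : ℝ) • (wedge2 (cx 0) (cx 1) + wedge2 (cx 2) (cx 3)),
    (2 : ℝ) • (wedge2 (cx 0) (cx 2) + wedge2 (cx 3) (cx 1)),
    (2 : ℝ) • (wedge2 (cx 0) (cx 3) + wedge2 (cx 1) (cx 2))]

/-- `d(dx x̄) = -dx ∧ dx̄` is self-dual on `ℝ⁴`. -/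
theorem extDeriv_rt (i : Fin 3) (z : N8) :
    extDeriv (fun z => oneForm (rt i z)) z = sdForm i := by
  ext v
  rw [extDeriv_oneForm_apply ((contDiff_rt i).contDiffAt.differentiableAt (by simp)), fderiv_rt,
    fderiv_rt]
  fin_cases i <;>
  · simp [sdForm, ContinuousAlternatingMap.add_apply, ContinuousAlternatingMap.smul_apply,
      wedge2_apply,
      rt_apply, inner_T_apply, cx_zero, cx_one, cx_two, cx_three]
    ring

/-- `d(x̄ dx) = dx̄ ∧ dx` has the opposite duality; this makes the curvature of the connection
anti-self-dual along the zero section. -/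
theorem extDeriv_lf_zero (z : N8) : extDeriv (fun z => oneForm (lf 0 z)) z =
    (2 : ℝ) • (wedge2 (cx 0) (cx 1) - wedge2 (cx 2) (cx 3)) := by
  ext v
  rw [extDeriv_oneForm_apply ((contDiff_lf 0).contDiffAt.differentiableAt (by simp)), fderiv_lf,
    fderiv_lf]
  simp [ContinuousAlternatingMap.sub_apply, ContinuousAlternatingMap.smul_apply, wedge2_apply,
    lf_apply, inner_T_apply, cx_zero, cx_one, cx_two, cx_three]
  ring

variable {z : N8}

theorem adm_of_eq_zero (hx : z.1 = 0) (a i : Fin 3) : adm a i z.1 = 0 := by simp [adm, hx]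

theorem rt_of_eq_zero (hx : z.1 = 0) (i : Fin 3) : rt i z = 0 :=
  ContinuousLinearMap.ext fun v => by simp [rt_apply, hx]

theorem nE_of_eq_zero (hx : z.1 = 0) (i : Fin 3) : nE i z = 0 := by
  simp [nE, adm_of_eq_zero hx]

theorem pE_of_eq_zero (hx : z.1 = 0) (i : Fin 3) : pE i z = 0 := by
  rw [pE, nE_of_eq_zero hx, add_zero]
  exact ContinuousLinearMap.ext fun v => by simp [lf_apply, hx]

theorem sqn_of_eq_zero (hx : z.1 = 0) : sqn z = 0 := by simp [sqn, hx]

theorem dsq_of_eq_zero (hx : z.1 = 0) : dsq z = 0 :=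
  ContinuousLinearMap.ext fun v => by simp [dsq, hx]

theorem extDeriv_wedge2_of_eq_zero {a b : N8 → N8 →L[ℝ] ℝ} (ha : DifferentiableAt ℝ a z)
    (hb : DifferentiableAt ℝ b z) (ha0 : a z = 0) (hb0 : b z = 0) :
    extDeriv (fun z => wedge2 (a z) (b z)) z = 0 := by
  ext v
  rw [extDeriv_wedge2_apply ha hb v rfl rfl, ha0, hb0]
  simp

theorem extDeriv_wedge3_of_eq_zero {a b c : N8 → N8 →L[ℝ] ℝ} (ha : DifferentiableAt ℝ a z)
    (hb : DifferentiableAt ℝ b z) (hc : DifferentiableAt ℝ c z) (ha0 : a z = 0) (hb0 : b z = 0) :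
    extDeriv (fun z => wedge3 (a z) (b z) (c z)) z = 0 := by
  ext v
  rw [extDeriv_wedge3_apply ha hb hc v rfl rfl rfl, ha0, hb0]
  simp [wedge2_apply]

theorem extDeriv_smul_of_eq_zero {E : Type*} [NormedAddCommGroup E] [NormedSpace ℝ E] {z : E}
    {k : ℕ} {f : E → ℝ} {f' : E →L[ℝ] ℝ} {α : E → E [⋀^Fin k]→L[ℝ] ℝ}
    (hf : HasFDerivAt f f' z) (hf' : f' = 0) (hα : DifferentiableAt ℝ α z) :
    extDeriv (fun z => f z • α z) z = f z • extDeriv α z := by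
  ext v
  rw [extDeriv_smul_apply hf hα, hf']
  simp

/-- At `x = 0` a product with two vanishing factors has zero derivative, so of `dβ` only `-3 Σ ν_a ∧
d(rt_a)` survives. -/
theorem phiA_zeroSection (hx : z.1 = 0) (hy : z.2 ≠ 0) : phiA z =
    (27 / 8 : ℝ) • wedge3 (nu 0 z) (nu 1 z) (nu 2 z)
      - (6 : ℝ) • (wedge3 (nu 0 z) (cx 0) (cx 1) + wedge3 (nu 0 z) (cx 2) (cx 3)
        + wedge3 (nu 1 z) (cx 0) (cx 2) + wedge3 (nu 1 z) (cx 3) (cx 1)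
        + wedge3 (nu 2 z) (cx 0) (cx 3) + wedge3 (nu 2 z) (cx 1) (cx 2)) := by
  have hr : ∀ i, DifferentiableAt ℝ (rt i) z := fun i =>
    (contDiff_rt i).contDiffAt.differentiableAt (by simp)
  have hn := fun i => (contDiffAt_nu i hy).differentiableAt (by simp)
  have hN := fun i => (contDiffAt_nE i hy).differentiableAt (by simp)
  have hP := fun i => (contDiffAt_pE i hy).differentiableAt (by simp)
  have dn := fun i => extDeriv_mc (z := z) i contDiffAt_snd hy
  have hs : HasFDerivAt (fun z => 3 + 4 / 9 * sqn z) (0 : N8 →L[ℝ] ℝ) z :=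
    (((hasFDerivAt_sqn z).const_mul (4 / 9)).const_add 3).congr_fderiv
      (by rw [dsq_of_eq_zero hx, smul_zero])
  have d1 := fun i => differentiableAt_wedge2 (hn i) (hr i)
  have d2 := fun i => differentiableAt_wedge2 (hN i) (hP i)
  have e1 : ∀ i, extDeriv (fun z => wedge2 (nE i z) (pE i z)) z = 0 := fun i =>
    extDeriv_wedge2_of_eq_zero (hN i) (hP i) (nE_of_eq_zero hx i) (pE_of_eq_zero hx i)
  have e2 : extDeriv (fun z => wedge2 (nE 1 z) (pE 1 z) + wedge2 (nE 2 z) (pE 2 z)) z = 0 := by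
    rw [extDeriv_fun_add (d2 1) (d2 2), e1, e1, add_zero]
  have e3 : extDeriv (fun z => (4 / 3 : ℝ) • wedge2 (nE 0 z) (pE 0 z)) z = 0 :=
    (extDeriv_smul _ _).trans (by rw [e1, smul_zero])
  have e4 : extDeriv (fun z => (3 : ℝ) • (wedge2 (nu 0 z) (rt 0 z) + wedge2 (nu 1 z) (rt 1 z)
      + wedge2 (nu 2 z) (rt 2 z))) z = (3 : ℝ) • (extDeriv (fun z => wedge2 (nu 0 z) (rt 0 z)) z
      + extDeriv (fun z => wedge2 (nu 1 z) (rt 1 z)) z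
      + extDeriv (fun z => wedge2 (nu 2 z) (rt 2 z)) z) := by
    refine (extDeriv_smul _ _).trans ?_
    rw [extDeriv_fun_add ((d1 0).fun_add (d1 1)) (d1 2), extDeriv_fun_add (d1 0) (d1 1)]
  have e5 : extDeriv betaA z = _ := (extDeriv_fun_add
    (((((d1 0).fun_add (d1 1)).fun_add (d1 2)).fun_const_smul (3 : ℝ)).fun_add
      ((d2 0).fun_const_smul (4 / 3 : ℝ)))
    (hs.differentiableAt.fun_smul ((d2 1).fun_add (d2 2)))).trans (congrArg₂ (· + ·)
      (extDeriv_fun_add ((((d1 0).fun_add (d1 1)).fun_add (d1 2)).fun_const_smul (3 : ℝ))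
      ((d2 0).fun_const_smul (4 / 3 : ℝ)))
      (extDeriv_smul_of_eq_zero hs rfl ((d2 1).fun_add (d2 2))))
  rw [phiA, e5, e2, e3, e4, smul_zero, add_zero, add_zero]
  ext v
  simp only [ContinuousAlternatingMap.add_apply, ContinuousAlternatingMap.sub_apply,
    ContinuousAlternatingMap.smul_apply]
  rw [extDeriv_wedge2_apply (hn 0) (hr 0) v (dn 0) (extDeriv_rt 0 z),
    extDeriv_wedge2_apply (hn 1) (hr 1) v (dn 1) (extDeriv_rt 1 z),
    extDeriv_wedge2_apply (hn 2) (hr 2) v (dn 2) (extDeriv_rt 2 z)]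
  simp only [rt_of_eq_zero hx, sdForm, wedge2_apply, wedge3_apply, zero_apply,
    ContinuousAlternatingMap.add_apply, ContinuousAlternatingMap.smul_apply, smul_eq_mul,
    Matrix.cons_val_zero, Matrix.cons_val_one, Matrix.cons_val]
  ring

theorem extDeriv_mixedForm_of_eq_zero (hx : z.1 = 0) (hy : z.2 ≠ 0) (i : Fin 3) :
    extDeriv (mixedForm i) z = 0 := by
  have hn := fun i => (contDiffAt_nu i hy).differentiableAt (by simp)
  have hP := fun i => (contDiffAt_pE i hy).differentiableAt (by simp)
  have ha : ∀ a, DifferentiableAt ℝ (fun z : N8 => adm a i z.1) z := fun a =>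
    (contDiff_adm a i).contDiffAt.differentiableAt (by simp)
  have key : ∀ a b c, extDeriv (fun z => adm a i z.1 • wedge3 (pE i z) (nu b z) (nu c z)) z = 0 :=
    fun a b c => by
      ext v
      rw [extDeriv_smul_apply (ha a).hasFDerivAt (differentiableAt_wedge3 (hP i) (hn b) (hn c)),
        adm_of_eq_zero hx, pE_of_eq_zero hx]
      simp [wedge3_apply]
  have d := fun a b c => (ha a).fun_smul (differentiableAt_wedge3 (hP i) (hn b) (hn c))
  refine (extDeriv_fun_add ((d 0 1 2).fun_add (d 1 2 0)) (d 2 0 1)).trans ?_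
  rw [extDeriv_fun_add (d 0 1 2) (d 1 2 0), key, key, key, add_zero, add_zero]

theorem extDeriv_radialVol (z : N8) :
    extDeriv radialVol z = (4 : ℝ) • wedge4 (cx 0) (cx 1) (cx 2) (cx 3) := by
  have h0 : HasFDerivAt (fun z : N8 => z.1.re) (cx 0) z := by
    simpa only [funext cx_zero] using (cx 0).hasFDerivAt (x := z)
  have h1 : HasFDerivAt (fun z : N8 => z.1.imI) (cx 1) z := by
    simpa only [funext cx_one] using (cx 1).hasFDerivAt (x := z)
  have h2 : HasFDerivAt (fun z : N8 => z.1.imJ) (cx 2) z := by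
    simpa only [funext cx_two] using (cx 2).hasFDerivAt (x := z)
  have h3 : HasFDerivAt (fun z : N8 => z.1.imK) (cx 3) z := by
    simpa only [funext cx_three] using (cx 3).hasFDerivAt (x := z)
  have dc := fun a b c => differentiableAt_wedge3 (z := z) (differentiableAt_const (cx a))
    (differentiableAt_const (cx b)) (differentiableAt_const (cx c))
  have d0 := h0.differentiableAt.fun_smul (dc 1 2 3)
  have d1 := h1.differentiableAt.fun_smul (dc 0 2 3)
  have d2 := h2.differentiableAt.fun_smul (dc 0 1 3)
  have d3 := h3.differentiableAt.fun_smul (dc 0 1 2)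
  have c0 : ∀ α : N8 [⋀^Fin 3]→L[ℝ] ℝ, extDeriv (fun _ : N8 => α) z = 0 := fun α => by
    ext v
    simp [extDeriv, ContinuousAlternatingMap.alternatizeUncurryFin_apply]
  have e : radialVol = fun z : N8 =>
      z.1.re • wedge3 (cx 1) (cx 2) (cx 3) + -(z.1.imI • wedge3 (cx 0) (cx 2) (cx 3))
    + z.1.imJ • wedge3 (cx 0) (cx 1) (cx 3) + -(z.1.imK • wedge3 (cx 0) (cx 1) (cx 2)) := by
    funext z
    rw [radialVol, sub_eq_add_neg, sub_eq_add_neg]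
  have hneg : ∀ f : N8 → N8 [⋀^Fin 3]→L[ℝ] ℝ, extDeriv (fun z => -f z) z = -extDeriv f z :=
    fun f => by
      have := extDeriv_smul (x := z) (-1 : ℝ) f
      simp only [neg_one_smul] at this
      exact this
  rw [e, extDeriv_fun_add ((d0.fun_add d1.fun_neg).fun_add d2) d3.fun_neg,
    extDeriv_fun_add (d0.fun_add d1.fun_neg) d2, extDeriv_fun_add d0 d1.fun_neg, hneg, hneg]
  ext v
  simp only [ContinuousAlternatingMap.add_apply, ContinuousAlternatingMap.neg_apply]
  rw [extDeriv_smul_apply h0 (dc _ _ _), extDeriv_smul_apply h1 (dc _ _ _),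
    extDeriv_smul_apply h2 (dc _ _ _),
    extDeriv_smul_apply h3 (dc _ _ _)]
  simp [c0, wedge3_apply, wedge4_apply, Fin.sum_univ_four, Fin.removeNth, Fin.succAbove]
  ring

end ZeroSection

theorem differentiableAt_smul_form {E : Type*} [NormedAddCommGroup E] [NormedSpace ℝ E] {z : E}
    {k : ℕ} {f : E → ℝ} {α : E → E [⋀^Fin k]→L[ℝ] ℝ} (hf : DifferentiableAt ℝ f z)
    (hα : DifferentiableAt ℝ α z) : DifferentiableAt ℝ (fun z => f z • α z) z := hf.fun_smul hα

/-- All summands of `γ` with two vanishing factors drop out, including `mixedForm`, where `adm` and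
`pE` both vanish. There remain `4 d(radialVol)`, which gives `16 = 4 · 4`, and the summand with
coefficient `|x|² - 9/2`, which gives `-9` through `d(rt_a)`. -/
theorem psiA_zeroSection {z : N8} (hx : z.1 = 0) (hy : z.2 ≠ 0) : psiA z =
    (16 : ℝ) • wedge4 (cx 0) (cx 1) (cx 2) (cx 3)
      - (9 : ℝ) • (wedge4 (cx 0) (cx 1) (nu 1 z) (nu 2 z) + wedge4 (cx 2) (cx 3) (nu 1 z) (nu 2 z)
        + wedge4 (cx 0) (cx 2) (nu 2 z) (nu 0 z) + wedge4 (cx 3) (cx 1) (nu 2 z) (nu 0 z)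
        + wedge4 (cx 0) (cx 3) (nu 0 z) (nu 1 z) + wedge4 (cx 1) (cx 2) (nu 0 z) (nu 1 z)) := by
  have hr : ∀ i, DifferentiableAt ℝ (rt i) z := fun i =>
    (contDiff_rt i).contDiffAt.differentiableAt (by simp)
  have hn := fun i => (contDiffAt_nu i hy).differentiableAt (by simp)
  have hP := fun i => (contDiffAt_pE i hy).differentiableAt (by simp)
  have hM := fun i => (contDiffAt_mixedForm hy i).differentiableAt (by simp)
  have hR := contDiff_radialVol.contDiffAt.differentiableAt (x := z) (by simp)
  have dn := fun i => extDeriv_mc (z := z) i contDiffAt_snd hy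
  have s0 := sqn_of_eq_zero hx
  have hs : HasFDerivAt sqn (0 : N8 →L[ℝ] ℝ) z := dsq_of_eq_zero hx ▸ hasFDerivAt_sqn z
  have f1 : HasFDerivAt (fun z => sqn z - 9 / 2) (0 : N8 →L[ℝ] ℝ) z := hs.sub_const _
  have f2 : HasFDerivAt (fun z => sqn z * (sqn z / 2 - 27 / 4)) (0 : N8 →L[ℝ] ℝ) z :=
    (hs.fun_mul ((hs.mul_const (2⁻¹ : ℝ)).sub_const (27 / 4))).congr_fderiv (by simp)
  have f3 : HasFDerivAt (fun z => -2 - 2 / 9 * sqn z) (0 : N8 →L[ℝ] ℝ) z :=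
    ((hs.const_mul (2 / 9)).const_sub (-2)).congr_fderiv (by simp)
  have f4 : HasFDerivAt (fun z => -13 / 4 - sqn z - sqn z ^ 2 / 9) (0 : N8 →L[ℝ] ℝ) z :=
    ((hs.const_sub (-13 / 4)).fun_sub ((hs.pow 2).mul_const (9⁻¹ : ℝ))).congr_fderiv (by simp)
  have k1 := fun i j k => differentiableAt_wedge3 (hr i) (hr j) (hn k)
  have k2 := fun i j k => differentiableAt_wedge3 (hr i) (hn j) (hn k)
  have k3 := differentiableAt_wedge3 (hn 0) (hn 1) (hn 2)
  have k4 := differentiableAt_wedge3 (hP 0) (hP 1) (hP 2)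
  have t0 := hR.fun_const_smul (4 : ℝ)
  have t1 := (((k1 0 1 2).fun_add (k1 1 2 0)).fun_add (k1 2 0 1)).fun_const_smul (2 : ℝ)
  have u2 := ((k2 0 1 2).fun_add (k2 1 2 0)).fun_add (k2 2 0 1)
  have t2 := f1.differentiableAt.fun_smul u2
  have t3 := f2.differentiableAt.fun_smul k3
  have t4 := k4.fun_const_smul (8 / 9 : ℝ)
  have t5 := differentiableAt_smul_form f3.differentiableAt (hM 0)
  have u6 := (hM 1).fun_add (hM 2)
  have t6 := differentiableAt_smul_form f4.differentiableAt u6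
  have v1 : ∀ i j k, extDeriv (fun z => wedge3 (rt i z) (rt j z) (nu k z)) z = 0 := fun i j k =>
    extDeriv_wedge3_of_eq_zero (hr i) (hr j) (hn k) (rt_of_eq_zero hx i) (rt_of_eq_zero hx j)
  have w0 : extDeriv (fun z => (4 : ℝ) • radialVol z) z = (4 : ℝ) • _ :=
    (extDeriv_smul _ _).trans (by rw [extDeriv_radialVol])
  have w1 : extDeriv (fun z => (2 : ℝ) • (wedge3 (rt 0 z) (rt 1 z) (nu 2 z)
      + wedge3 (rt 1 z) (rt 2 z) (nu 0 z) + wedge3 (rt 2 z) (rt 0 z) (nu 1 z))) z = 0 := by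
    refine (extDeriv_smul _ _).trans ?_
    rw [extDeriv_fun_add ((k1 0 1 2).fun_add (k1 1 2 0)) (k1 2 0 1),
      extDeriv_fun_add (k1 0 1 2) (k1 1 2 0), v1, v1, v1, add_zero, add_zero, smul_zero]
  have w2 : extDeriv (fun z => (sqn z - 9 / 2) • (wedge3 (rt 0 z) (nu 1 z) (nu 2 z)
      + wedge3 (rt 1 z) (nu 2 z) (nu 0 z) + wedge3 (rt 2 z) (nu 0 z) (nu 1 z))) z =
      (-(9 / 2) : ℝ) • (extDeriv (fun z => wedge3 (rt 0 z) (nu 1 z) (nu 2 z)) z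
      + extDeriv (fun z => wedge3 (rt 1 z) (nu 2 z) (nu 0 z)) z
      + extDeriv (fun z => wedge3 (rt 2 z) (nu 0 z) (nu 1 z)) z) := by
    rw [extDeriv_smul_of_eq_zero f1 rfl u2, s0, zero_sub,
      extDeriv_fun_add ((k2 0 1 2).fun_add (k2 1 2 0)) (k2 2 0 1),
      extDeriv_fun_add (k2 0 1 2) (k2 1 2 0)]
  have w3 : extDeriv (fun z => (sqn z * (sqn z / 2 - 27 / 4)) •
      wedge3 (nu 0 z) (nu 1 z) (nu 2 z)) z = 0 := by
    rw [extDeriv_smul_of_eq_zero f2 rfl k3, s0, zero_mul, zero_smul]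
  have w4 : extDeriv (fun z => (8 / 9 : ℝ) • wedge3 (pE 0 z) (pE 1 z) (pE 2 z)) z = 0 := by
    refine (extDeriv_smul _ _).trans ?_
    rw [extDeriv_wedge3_of_eq_zero (hP 0) (hP 1) (hP 2) (pE_of_eq_zero hx 0) (pE_of_eq_zero hx 1),
      smul_zero]
  have w5 : extDeriv (fun z => (-2 - 2 / 9 * sqn z) • mixedForm 0 z) z = 0 := by
    rw [extDeriv_smul_of_eq_zero f3 rfl (hM 0)]
    exact (congrArg _ (extDeriv_mixedForm_of_eq_zero hx hy 0)).trans (smul_zero _)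
  have w6 : extDeriv (fun z => (-13 / 4 - sqn z - sqn z ^ 2 / 9) •
      (mixedForm 1 z + mixedForm 2 z)) z = 0 := by
    rw [extDeriv_smul_of_eq_zero f4 rfl u6, extDeriv_fun_add (hM 1) (hM 2)]
    exact (congrArg _ (congrArg₂ (· + ·) (extDeriv_mixedForm_of_eq_zero hx hy 1)
      (extDeriv_mixedForm_of_eq_zero hx hy 2))).trans (by simp)
  have e : extDeriv gammaA z = _ :=
    (extDeriv_fun_add (((((t0.fun_add t1).fun_add t2).fun_add t3).fun_add t4).fun_add t5) t6)
  rw [psiA, e, extDeriv_fun_add ((((t0.fun_add t1).fun_add t2).fun_add t3).fun_add t4) t5,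
    extDeriv_fun_add (((t0.fun_add t1).fun_add t2).fun_add t3) t4,
    extDeriv_fun_add ((t0.fun_add t1).fun_add t2) t3, extDeriv_fun_add (t0.fun_add t1) t2,
    extDeriv_fun_add t0 t1, w0, w1, w2, w3, w4, w5, w6]
  ext v
  simp only [ContinuousAlternatingMap.add_apply, ContinuousAlternatingMap.sub_apply,
    ContinuousAlternatingMap.smul_apply, add_zero]
  rw [extDeriv_wedge3_apply (hr 0) (hn 1) (hn 2) v (extDeriv_rt 0 z) (dn 1) (dn 2),
    extDeriv_wedge3_apply (hr 1) (hn 2) (hn 0) v (extDeriv_rt 1 z) (dn 2) (dn 0),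
    extDeriv_wedge3_apply (hr 2) (hn 0) (hn 1) v (extDeriv_rt 2 z) (dn 0) (dn 1)]
  simp only [rt_of_eq_zero hx, sdForm, wedge2_apply, wedge4_apply, zero_apply,
    ContinuousAlternatingMap.add_apply, ContinuousAlternatingMap.smul_apply, smul_eq_mul,
    Matrix.cons_val_zero, Matrix.cons_val_one, Matrix.cons_val]
  ring

/-! ### Adapted coframes and the torsion-free `G₂`-structure -/

theorem linearIndependent_of_separating {V : Type*} [AddCommGroup V] [Module ℝ V]
    [TopologicalSpace V] [FiniteDimensional ℝ V] {n : ℕ} (hn : Module.finrank ℝ V = n)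
    (e : Fin n → V →L[ℝ] ℝ) (h : ∀ v, (∀ i, e i v = 0) → v = 0) : LinearIndependent ℝ e := by
  let L : V →ₗ[ℝ] Fin n → ℝ := LinearMap.pi fun i => (e i : V →ₗ[ℝ] ℝ)
  have hi : Function.Injective L := (injective_iff_map_eq_zero L).2 fun v hv =>
    h v fun i => congrFun hv i
  have hs : Function.Surjective L :=
    (LinearMap.injective_iff_surjective_of_finrank_eq_finrank (by simp [hn])).1 hi
  rw [Fintype.linearIndependent_iff]
  intro c hc i
  obtain ⟨v, hv⟩ := hs (Pi.single i 1)
  have h1 : ∀ j, e j v = (Pi.single i 1 : Fin n → ℝ) j := fun j => congrFun hv j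
  have h2 := congrArg (fun l : V →L[ℝ] ℝ => l v) hc
  simpa [sum_apply, h1, Pi.single_apply] using h2

theorem quaternion_eq_zero {q : ℍ[ℝ]} (h : q.re = 0) (hi : ∀ i, inner ℝ (T i) q = 0) : q = 0 := by
  have h0 := hi 0
  have h1 := hi 1
  have h2 := hi 2
  rw [inner_T_zero] at h0
  rw [inner_T_one] at h1
  rw [inner_T_two] at h2
  exact Quaternion.ext _ _ h h0 h1 h2

theorem re_star_mul (p q : ℍ[ℝ]) : (star p * q).re = inner ℝ p q := by
  rw [Quaternion.inner_def, Quaternion.re_mul, Quaternion.re_mul]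
  simp

variable {m : M7}

/-- A vector tangent to the unit sphere at `y` has `Re(ȳ · dy) = 0`, so the three imaginary
components `ν_a` determine it. -/
theorem eq_zero_of_fst_of_nu {v : TangentSpace I7 m} (h1 : (differential incl m v).1 = 0)
    (h2 : ∀ a, nu a (incl m) (differential incl m v) = 0) : v = 0 := by
  apply eq_zero_of_differential_incl
  refine Prod.ext h1 ?_
  have hy := incl_snd_ne m
  have h3 := inner_differential_snd m v
  have hn : ‖(incl m).2‖ = 1 := by simp [incl]
  have h4 : (incl m).2⁻¹ = star (incl m).2 := by
    rw [Quaternion.instInv]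
    simp [Quaternion.normSq_eq_norm_mul_self, hn]
  have h5 : (incl m).2⁻¹ * (differential incl m v).2 = 0 := by
    refine quaternion_eq_zero ?_ fun a => by rw [← nu_apply]; exact h2 a
    rw [h4, re_star_mul]
    exact h3
  rcases mul_eq_zero.1 h5 with h | h
  · exact absurd (inv_eq_zero.1 h) hy
  · exact h

theorem finrank_tangentSpace (m : M7) : Module.finrank ℝ (TangentSpace I7 m) = 7 := by
  change Module.finrank ℝ E7 = 7
  rw [Module.finrank_prod, Quaternion.finrank_eq_four, finrank_euclideanSpace_fin]

instance finiteDimensional_tangentSpace (m : M7) : FiniteDimensional ℝ (TangentSpace I7 m) :=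
  inferInstanceAs (FiniteDimensional ℝ E7)

/-- The adapted coframe off the zero section. -/
def coframe (m : M7) : Fin 7 → TangentSpace I7 m →L[ℝ] ℝ :=
  ![(2 * B1 (radius m)) • etaM 0 m, (2 * B2 (radius m)) • etaM 1 m, (2 * B2 (radius m)) • etaM 2 m,
    ds m, (-(2 * A1 (radius m))) • etaP 0 m, (-(2 * A2 (radius m))) • etaP 1 m,
    (2 * A2 (radius m)) • etaP 2 m]

/-- The signs in `coframe` are chosen so that the seven model terms match `ds ∧ ω` and `Ω⁺` one by
one. The identity is purely algebraic and needs no independence of the coframe. -/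
theorem phi_eq_model (m : M7) : phi m = modelThreeForm (coframe m) := by
  have e : ∀ a b c : TangentSpace I7 m →L[ℝ] ℝ, wedge (oneForm a) (wedge2 b c) = wedge3 a b c :=
    oneForm_wedge2
  rw [phi, omega, OmegaRe, modelThreeForm]
  simp only [wedge_add_right, wedge_smul_right, e, coframe]
  ext v
  simp only [wedge3_apply, ContinuousAlternatingMap.add_apply, ContinuousAlternatingMap.sub_apply,
    ContinuousAlternatingMap.smul_apply, smul_apply, smul_eq_mul, Matrix.cons_val]
  ring

theorem psi_eq_model (m : M7) : psi m = modelFourForm (coframe m) := by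
  rw [psi, omega, OmegaIm, modelFourForm]
  simp only [wedge_add_right, wedge_smul_right, wedge_add_left,
      wedge_smul_left, wedge2_wedge2, oneForm_wedge3, coframe]
  ext v
  simp only [wedge4_apply, ContinuousAlternatingMap.add_apply, ContinuousAlternatingMap.sub_apply,
    ContinuousAlternatingMap.smul_apply, smul_apply, smul_eq_mul, Matrix.cons_val]
  ring

theorem linearIndependent_coframe (hx : m.1 ≠ 0) : LinearIndependent ℝ (coframe m) := by
  refine linearIndependent_of_separating (finrank_tangentSpace m) _ fun v hv => ?_
  have hr := radius_gt hx
  have hx' : (incl m).1 ≠ 0 := hx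
  have hy := incl_snd_ne m
  have a1 : A1 (radius m) ≠ 0 := fun h => by simpa [h] using speed_mul_A1 hr
  have sp : speed (radius m) ≠ 0 := fun h => by simpa [h] using speed_mul_A1 hr
  have a2 : A2 (radius m) ≠ 0 := (Real.sqrt_pos.2 (div_pos (mul_pos (by linarith) (by linarith))
    (by norm_num))).ne'
  have b1 : B1 (radius m) ≠ 0 := by rw [B1]; linarith
  have b2 : B2 (radius m) ≠ 0 := (Real.sqrt_pos.2 (div_pos (mul_pos (by linarith) (by linarith))
    (by norm_num))).ne'
  set w := differential incl m v with hw
  have hM : ∀ i, eM i (incl m) w = 0 := by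
    have h : ∀ i, etaM i m v = 0 := by
      intro i
      fin_cases i
      · simpa [coframe, b1] using hv 0
      · simpa [coframe, b2] using hv 1
      · simpa [coframe, b2] using hv 2
    intro i
    have := h i
    rwa [etaM_eq hx] at this
  have hP : ∀ i, eP i (incl m) w = 0 := by
    have h : ∀ i, etaP i m v = 0 := by
      intro i
      fin_cases i
      · simpa [coframe, a1] using hv 4
      · simpa [coframe, a2] using hv 5
      · simpa [coframe, a2] using hv 6
    intro i
    have := h i
    rwa [etaP_eq hx] at this
  have hs : dsq (incl m) w = 0 := by
    have h := hv 3
    have h' : ds m v = 0 := h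
    rw [ds_eq] at h'
    exact (mul_eq_zero.1 h').resolve_left sp
  -- Invert the rotation relating `η⁻` to `½ν`.
  have hnu : ∀ a, nu a (incl m) w = 0 := by
    intro a
    have h0 := hM 0
    have h1 := hM 1
    have h2 := hM 2
    simp only [eM_rot _ hy, smul_apply, add_apply, smul_eq_mul] at h0 h1 h2
    have o0 := rot_orthogonal hx' a 0
    have o1 := rot_orthogonal hx' a 1
    have o2 := rot_orthogonal hx' a 2
    have : nu a (incl m) w = (if a = 0 then 1 else 0) * nu 0 (incl m) w
        + (if a = 1 then 1 else 0) * nu 1 (incl m) w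
        + (if a = 2 then 1 else 0) * nu 2 (incl m) w := by fin_cases a <;> simp
    rw [this, ← o0, ← o1, ← o2]
    linear_combination 2 * rot a 0 (incl m) * h0 + 2 * rot a 1 (incl m) * h1
      + 2 * rot a 2 (incl m) * h2
  refine eq_zero_of_fst_of_nu ?_ hnu
  -- With `ν = 0`, the condition `η⁺ = 0` kills the imaginary part of `x̄ dx`; `dr = 0` kills its
  -- real part.
  have hlf : ∀ i, lf i (incl m) w = 0 := by
    intro i
    have h1 := congrArg (fun l : N8 →L[ℝ] ℝ => l w) (pE_eq i hx' hy)
    have h2 := hP i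
    simp only [pE, nE, add_apply, smul_apply, hnu, h2, smul_eq_mul, mul_zero, add_zero] at h1
    exact h1
  have h5 : star (incl m).1 * w.1 = 0 := by
    refine quaternion_eq_zero ?_ fun i => by rw [← lf_apply]; exact hlf i
    rw [re_star_mul]
    have : dsq (incl m) w = 2 * inner ℝ (incl m).1 w.1 := by simp [dsq]
    linarith
  rcases mul_eq_zero.1 h5 with h | h
  · exact absurd (star_eq_zero.1 h) hx'
  · exact h

/-- The adapted coframe along the zero section. -/
def coframeZero (m : M7) : Fin 7 → TangentSpace I7 m →L[ℝ] ℝ := fun i =>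
  (![(3 / 2 : ℝ) • nu 0 (incl m), (3 / 2 : ℝ) • nu 1 (incl m), (3 / 2 : ℝ) • nu 2 (incl m),
    (2 : ℝ) • cx 0, (-2 : ℝ) • cx 1, (-2 : ℝ) • cx 2, (2 : ℝ) • cx 3] i).comp (differential incl m)

theorem linearIndependent_coframeZero (m : M7) : LinearIndependent ℝ (coframeZero m) := by
  refine linearIndependent_of_separating (finrank_tangentSpace m) _ fun v hv => ?_
  set w := differential incl m v with hw
  have hn : ∀ a, nu a (incl m) w = 0 := by
    intro a
    fin_cases a
    · simpa [coframeZero] using hv 0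
    · simpa [coframeZero] using hv 1
    · simpa [coframeZero] using hv 2
  have h0 : cx 0 w = 0 := by simpa [coframeZero] using hv 3
  have h1 : cx 1 w = 0 := by simpa [coframeZero] using hv 4
  have h2 : cx 2 w = 0 := by simpa [coframeZero] using hv 5
  have h3 : cx 3 w = 0 := by simpa [coframeZero] using hv 6
  rw [cx_zero] at h0
  rw [cx_one] at h1
  rw [cx_two] at h2
  rw [cx_three] at h3
  exact eq_zero_of_fst_of_nu (Quaternion.ext _ _ h0 h1 h2 h3) hn

theorem pull_phiA_zeroSection (hx : m.1 = 0) : pull phiA m = modelThreeForm (coframeZero m) := by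
  rw [pull, phiA_zeroSection (z := incl m) hx (incl_snd_ne m), modelThreeForm]
  simp only [coframeZero, ← wedge3_comp]
  ext v
  simp only [wedge3_apply, ContinuousAlternatingMap.add_apply, ContinuousAlternatingMap.sub_apply,
    ContinuousAlternatingMap.smul_apply, smul_apply, smul_eq_mul, Matrix.cons_val,
    ContinuousAlternatingMap.compContinuousLinearMap_apply, Function.comp_apply]
  ring

theorem pull_psiA_zeroSection (hx : m.1 = 0) : pull psiA m = modelFourForm (coframeZero m) := by
  rw [pull, psiA_zeroSection (z := incl m) hx (incl_snd_ne m), modelFourForm]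
  simp only [coframeZero, ← wedge4_comp]
  ext v
  simp only [wedge4_apply, ContinuousAlternatingMap.add_apply, ContinuousAlternatingMap.sub_apply,
    ContinuousAlternatingMap.smul_apply, smul_apply, smul_eq_mul, Matrix.cons_val,
    ContinuousAlternatingMap.compContinuousLinearMap_apply, Function.comp_apply]
  ring

theorem isTorsionFreeG2 : IsTorsionFreeG2 (pull phiA) (pull psiA) where
  smooth_phi := smoothForm_phi
  smooth_psi := smoothForm_psi
  adapted m := by
    by_cases hx : m.1 = 0
    · exact ⟨coframeZero m, linearIndependent_coframeZero m, pull_phiA_zeroSection hx,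
        pull_psiA_zeroSection hx⟩
    · exact ⟨coframe m, linearIndependent_coframe hx, by rw [← phi_eq hx, phi_eq_model],
        by rw [← psi_eq hx, psi_eq_model]⟩
  closed := closed_phi
  coclosed := coclosed_psi

/-! ### The implicit function `f_c` -/

section Branch

/-- The function inverted by `tSol`. -/
def gFun (u t : ℝ) : ℝ := Real.arctan t + u / 72 * t

theorem strictMono_gFun {u : ℝ} (hu : 0 ≤ u) : StrictMono (gFun u) := fun a b h => by
  have h1 := Real.arctan_strictMono h
  have h2 : u / 72 * a ≤ u / 72 * b := mul_le_mul_of_nonneg_left h.le (by positivity)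
  unfold gFun; linarith

theorem continuous_gFun (u : ℝ) : Continuous (gFun u) :=
  Real.continuous_arctan.add (continuous_const.mul continuous_id)

theorem gFun_zero (u : ℝ) : gFun u 0 = 0 := by simp [gFun]

/-- The solution `t` of `arctan t + u t / 72 = ε`. -/
def tSol (ε u : ℝ) : ℝ := Function.invFun (gFun u) ε

variable {ε u : ℝ}

/-- Intermediate value theorem between `0` and `tan ε`: at `t = tan ε` the value is `ε + (u/72) tan
ε`, which lies beyond `ε` on the side of its sign. -/
theorem gFun_tSol (hε : ε ∈ Set.Ioo (-(Real.pi / 2)) (Real.pi / 2)) (hu : 0 ≤ u) :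
    gFun u (tSol ε u) = ε := by
  refine Function.invFun_eq ?_
  have ht : gFun u (Real.tan ε) = ε + u / 72 * Real.tan ε := by
    rw [gFun, Real.arctan_tan hε.1 hε.2]
  rcases le_total 0 ε with h | h
  · have h1 : 0 ≤ Real.tan ε := Real.tan_nonneg_of_nonneg_of_le_pi_div_two h hε.2.le
    obtain ⟨t, -, h2⟩ := intermediate_value_Icc h1 (continuous_gFun u).continuousOn
      (show ε ∈ _ from ⟨by rw [gFun_zero]; exact h,
        by rw [ht]; linarith [mul_nonneg (show 0 ≤ u / 72 by positivity) h1]⟩)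
    exact ⟨t, h2⟩
  · have h1 : Real.tan ε ≤ 0 := Real.tan_nonpos_of_nonpos_of_neg_pi_div_two_le h hε.1.le
    obtain ⟨t, -, h2⟩ := intermediate_value_Icc h1 (continuous_gFun u).continuousOn
      (show ε ∈ _ from
        ⟨by rw [ht]; linarith [mul_nonneg (show 0 ≤ u / 72 by positivity) (neg_nonneg.2 h1)],
          by rw [gFun_zero]; exact h⟩)
    exact ⟨t, h2⟩

theorem tSol_eq {t : ℝ} (hu : 0 ≤ u) (h : gFun u t = ε) : tSol ε u = t := by
  rw [tSol, ← h, Function.leftInverse_invFun (strictMono_gFun hu).injective]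

theorem tSol_zero (hu : 0 ≤ u) : tSol 0 u = 0 := tSol_eq hu (gFun_zero u)

theorem tSol_pos (hε : ε ∈ Set.Ioo 0 (Real.pi / 2)) (hu : 0 ≤ u) : 0 < tSol ε u := by
  rw [← (strictMono_gFun hu).lt_iff_lt, gFun_zero, gFun_tSol ⟨by linarith [hε.1, hε.2], hε.2⟩ hu]
  exact hε.1

/-- Inverse function theorem for `(t, u) ↦ (arctan t + ut/72, u)`, whose derivative is invertible
because `1/(1 + t²) + u/72 > 0`. The range of `ε` includes `0`, as needed for the limit `c → π/2`.
-/
theorem contDiffWithinAt_tSol (hε : ε ∈ Set.Ioo (-(Real.pi / 2)) (Real.pi / 2)) (hu : 0 ≤ u) :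
    ContDiffWithinAt ℝ ∞ (fun p : ℝ × ℝ => tSol p.1 p.2) {p | 0 ≤ p.2} (ε, u) := by
  set t := tSol ε u with ht
  let Φ : ℝ × ℝ → ℝ × ℝ := fun p => (gFun p.2 p.1, p.2)
  have hΦ : ContDiff ℝ ∞ Φ :=
    ((Real.contDiff_arctan.comp contDiff_fst).add
      ((contDiff_snd.div_const 72).mul contDiff_fst)).prodMk contDiff_snd
  have hd : (0 : ℝ) < 1 / (1 + t ^ 2) + u / 72 := by positivity
  set d := 1 / (1 + t ^ 2) + u / 72 with hdd
  let L : (ℝ × ℝ) →L[ℝ] ℝ × ℝ := (d • ContinuousLinearMap.fst ℝ ℝ ℝ +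
    (t / 72) • ContinuousLinearMap.snd ℝ ℝ ℝ).prod (ContinuousLinearMap.snd ℝ ℝ ℝ)
  let L' : (ℝ × ℝ) →L[ℝ] ℝ × ℝ := (d⁻¹ • (ContinuousLinearMap.fst ℝ ℝ ℝ -
    (t / 72) • ContinuousLinearMap.snd ℝ ℝ ℝ)).prod (ContinuousLinearMap.snd ℝ ℝ ℝ)
  let e : (ℝ × ℝ) ≃L[ℝ] ℝ × ℝ := ContinuousLinearEquiv.equivOfInverse L L'
    (fun p => by ext <;> simp [L, L', hd.ne'])
    (fun p => by ext <;> simp [L, L', hd.ne'])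
  have hf : HasFDerivAt Φ (e : (ℝ × ℝ) →L[ℝ] ℝ × ℝ) (t, u) := by
    have h1 : HasFDerivAt (fun p : ℝ × ℝ => Real.arctan p.1)
        ((1 / (1 + t ^ 2)) • ContinuousLinearMap.fst ℝ ℝ ℝ) (t, u) := by
      simpa [smul_smul] using (hasFDerivAt_fst (𝕜 := ℝ) (p := (t, u))).arctan
    have h2 : HasFDerivAt (fun p : ℝ × ℝ => p.2 * 72⁻¹ * p.1) _ (t, u) :=
      ((hasFDerivAt_snd (𝕜 := ℝ) (p := (t, u))).mul_const (72⁻¹ : ℝ)).fun_mul hasFDerivAt_fst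
    refine ((h1.fun_add h2).prodMk hasFDerivAt_snd).congr_fderiv ?_
    refine ContinuousLinearMap.ext fun v => Prod.ext ?_ rfl
    simp [e, L, hdd]
    ring
  have hc : ContDiffAt ℝ ∞ Φ (t, u) := hΦ.contDiffAt
  have hΦt : Φ (t, u) = (ε, u) := Prod.ext (gFun_tSol hε hu) rfl
  have hinv := hc.to_localInverse hf (by simp)
  have hr := (hc.hasStrictFDerivAt' hf (by simp)).eventually_right_inverse
  rw [hΦt] at hinv hr
  refine ((contDiff_fst.contDiffAt.comp _ hinv).contDiffWithinAt
    (s := {p | 0 ≤ p.2})).congr_of_eventuallyEq ?_ ?_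
  -- The local inverse is identified with `tSol` only where `u ≥ 0`, since strict monotonicity is
  -- available there; hence smoothness within the half-plane.
  · filter_upwards [nhdsWithin_le_nhds hr, self_mem_nhdsWithin] with p hp hp2
    have h2 := congrArg Prod.snd hp
    have h1 := congrArg Prod.fst hp
    simp only [Φ] at h1 h2
    rw [h2] at h1
    exact tSol_eq hp2 h1
  · have hp := hr.self_of_nhds
    have h2 := congrArg Prod.snd hp
    have h1 := congrArg Prod.fst hp
    simp only [Φ] at h1 h2
    rw [h2] at h1
    exact tSol_eq hu h1

/-- The coordinate `16 r² - 81`. -/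
def uCoord (r : ℝ) : ℝ := 16 * r ^ 2 - 81

theorem uCoord_nonneg {r : ℝ} (hr : 9 / 4 ≤ r) : 0 ≤ uCoord r := by unfold uCoord; nlinarith

/-- The branch `f_c`. -/
def branch (c r : ℝ) : ℝ := uCoord r / 24 * tSol (Real.pi / 2 - c) (uCoord r)

variable {c : ℝ}

theorem sub_mem_Ioo (hc : c ∈ Set.Ioo 0 (Real.pi / 2)) :
    Real.pi / 2 - c ∈ Set.Ioo 0 (Real.pi / 2) := ⟨by linarith [hc.2], by linarith [hc.1]⟩

theorem Ioo_zero_subset (hε : ε ∈ Set.Ioo 0 (Real.pi / 2)) :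
    ε ∈ Set.Ioo (-(Real.pi / 2)) (Real.pi / 2) := ⟨by linarith [hε.1, hε.2], hε.2⟩

/-- The second form of `f`, read off from `arctan t + ut/72 = ε`: it says that `t = cot(f/3 + c)`.
-/
theorem branch_eq (hc : c ∈ Set.Ioo 0 (Real.pi / 2)) {r : ℝ} (hr : 9 / 4 ≤ r) :
    branch c r = 3 * (Real.pi / 2 - c - Real.arctan (tSol (Real.pi / 2 - c) (uCoord r))) := by
  have h := gFun_tSol (Ioo_zero_subset (sub_mem_Ioo hc)) (uCoord_nonneg hr)
  rw [gFun] at h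
  rw [branch]
  linarith

theorem branch_nonneg (hc : c ∈ Set.Ioo 0 (Real.pi / 2)) {r : ℝ} (hr : 9 / 4 ≤ r) :
    0 ≤ branch c r :=
  mul_nonneg (div_nonneg (uCoord_nonneg hr) (by norm_num))
    (tSol_pos (sub_mem_Ioo hc) (uCoord_nonneg hr)).le

theorem branch_le (hc : c ∈ Set.Ioo 0 (Real.pi / 2)) {r : ℝ} (hr : 9 / 4 ≤ r) :
    branch c r ≤ 3 * (Real.pi / 2 - c) := by
  have h := Real.arctan_pos.2 (tSol_pos (sub_mem_Ioo hc) (uCoord_nonneg hr))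
  rw [branch_eq hc hr]
  linarith

theorem continuousOn_branch (hc : c ∈ Set.Ioo 0 (Real.pi / 2)) :
    ContinuousOn (branch c) (Set.Ici (9 / 4)) := by
  intro r hr
  have hu : Continuous uCoord := by unfold uCoord; fun_prop
  have h := (contDiffWithinAt_tSol (Ioo_zero_subset (sub_mem_Ioo hc))
    (uCoord_nonneg hr)).continuousWithinAt
  have h2 := ContinuousWithinAt.comp (f := fun r : ℝ => (Real.pi / 2 - c, uCoord r))
    (s := Set.Ici (9 / 4)) (x := r) h (by fun_prop) fun r hr => uCoord_nonneg hr
  exact ((hu.div_const 24).continuousWithinAt).mul h2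

theorem isBranch_branch (hc : c ∈ Set.Ioo 0 (Real.pi / 2)) : IsBranch c (branch c) where
  continuousOn := continuousOn_branch hc
  vanish := by norm_num [branch, uCoord]
  relation r hr := by
    set t := tSol (Real.pi / 2 - c) (uCoord r) with ht
    have ht0 : 0 < t := tSol_pos (sub_mem_Ioo hc) (uCoord_nonneg hr)
    have e : branch c r / 3 + c = Real.pi / 2 - Real.arctan t := by rw [branch_eq hc hr]; ring
    rw [e]
    refine ⟨?_, ?_⟩
    · rw [Real.cos_pi_div_two_sub]
      exact (Real.sin_pos_of_pos_of_lt_pi (Real.arctan_pos.2 ht0)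
        (by linarith [Real.arctan_lt_pi_div_two t, Real.pi_pos])).ne'
    · rw [Real.tan_pi_div_two_sub, Real.tan_arctan, branch, ← ht, ← uCoord]
      field_simp

/-- Continuity confines the angle `θ = g/3 + c`, which starts at `c`, to `(0, π/2)`. There `cot θ`
solves the equation defining `tSol`. -/
theorem IsBranch.eqOn {g : ℝ → ℝ} (hc : c ∈ Set.Ioo 0 (Real.pi / 2)) (hg : IsBranch c g) :
    Set.EqOn g (branch c) (Set.Ici (9 / 4)) := by
  have hcont : ContinuousOn (fun r => g r / 3 + c) (Set.Ici (9 / 4)) :=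
    (hg.continuousOn.div_const 3).add continuousOn_const
  have h0 : g (9 / 4) / 3 + c = c := by rw [hg.vanish]; ring
  have hivt : ∀ r, 9 / 4 ≤ r →
      Set.uIcc c (g r / 3 + c) ⊆ (fun r => g r / 3 + c) '' Set.Ici (9 / 4) :=
    fun r hr => by
      have h := intermediate_value_uIcc (hcont.mono fun x (hx : x ∈ Set.uIcc (9 / 4) r) => by
        rw [Set.uIcc_of_le hr] at hx; exact hx.1)
      simp only [h0] at h
      refine h.trans (Set.image_mono fun x hx => ?_)
      rw [Set.uIcc_of_le hr] at hx
      exact hx.1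
  -- If `θ` reached `0`, the relation there would read `0 = 16x² - 81`, forcing `x = 9/4`, where `θ
  -- = c > 0`.
  have hpos : ∀ r, 9 / 4 ≤ r → 0 < g r / 3 + c := by
    intro r hr
    by_contra! hneg
    obtain ⟨x, hx, hx0⟩ := hivt r hr (Set.mem_uIcc.2 (Or.inr ⟨hneg, hc.1.le⟩))
    have h := (hg.relation x hx).2
    simp only at hx0
    rw [hx0, Real.tan_zero] at h
    have h2 : x = 9 / 4 := by
      have : (x - 9 / 4) * (x + 9 / 4) = 0 := by linarith
      rcases mul_eq_zero.1 this with h | h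
      · linarith
      · have : (9 / 4 : ℝ) ≤ x := hx
        linarith
    rw [h2, h0] at hx0
    exact hc.1.ne' hx0
  -- If `θ` reached `π/2`, the cosine would vanish there.
  have hlt : ∀ r, 9 / 4 ≤ r → g r / 3 + c < Real.pi / 2 := by
    intro r hr
    by_contra! hge
    obtain ⟨x, hx, hx0⟩ := hivt r hr (Set.mem_uIcc.2 (Or.inl ⟨hc.2.le, hge⟩))
    have h := (hg.relation x hx).1
    simp only at hx0
    rw [hx0, Real.cos_pi_div_two] at h
    exact h rfl
  intro r hr
  have hr' : 9 / 4 ≤ r := hr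
  have hp := hpos r hr
  have hl := hlt r hr
  set θ := g r / 3 + c with hθ
  have htan : 0 < Real.tan θ := Real.tan_pos_of_pos_of_lt_pi_div_two hp hl
  have hrel := (hg.relation r hr).2
  rw [← hθ] at hrel
  have hgr : g r = uCoord r / 24 * (Real.tan θ)⁻¹ := by
    rw [uCoord, ← hrel]; field_simp
  have ht : tSol (Real.pi / 2 - c) (uCoord r) = (Real.tan θ)⁻¹ := by
    refine tSol_eq (uCoord_nonneg hr) ?_
    rw [gFun, ← Real.tan_pi_div_two_sub, Real.arctan_tan (by linarith) (by linarith),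
      Real.tan_pi_div_two_sub]
    linarith
  rw [branch, ht, hgr]

/-- The bound `f ≤ 3ε` reads `ut ≤ 72ε`, so `t → 0` as `u → ∞` and `f = 3(ε - arctan t) → 3ε`. -/
theorem tendsto_branch (hc : c ∈ Set.Ioo 0 (Real.pi / 2)) :
    Filter.Tendsto (branch c) Filter.atTop (nhds (3 * Real.pi / 2 - 3 * c)) := by
  have hε := sub_mem_Ioo hc
  have hu : Filter.Tendsto uCoord Filter.atTop Filter.atTop :=
    Filter.tendsto_atTop_add_const_right _ _
      ((Filter.tendsto_pow_atTop two_ne_zero).const_mul_atTop (by norm_num))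
  have ht : Filter.Tendsto (fun r => tSol (Real.pi / 2 - c) (uCoord r)) Filter.atTop (nhds 0) := by
    refine tendsto_of_tendsto_of_tendsto_of_le_of_le' tendsto_const_nhds
      (hu.const_div_atTop (72 * (Real.pi / 2 - c))) ?_ ?_
    · filter_upwards [Filter.eventually_ge_atTop (9 / 4)] with r hr
      exact (tSol_pos hε (uCoord_nonneg hr)).le
    · filter_upwards [Filter.eventually_ge_atTop (9 / 4), hu.eventually_gt_atTop 0] with r hr hr0
      have h := branch_le hc hr
      rw [branch] at h
      rw [le_div_iff₀ hr0]
      linarith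
  have h2 := ((Real.continuous_arctan.tendsto 0).comp ht).const_sub (Real.pi / 2 - c)
    |>.const_mul 3
  rw [Real.arctan_zero] at h2
  rw [show 3 * Real.pi / 2 - 3 * c = 3 * (Real.pi / 2 - c - 0) by ring]
  refine h2.congr' ?_
  filter_upwards [Filter.eventually_ge_atTop (9 / 4)] with r hr
  rw [branch_eq hc hr, Function.comp_apply]

theorem tendstoUniformlyOn_branch : TendstoUniformlyOn branch (fun _ => 0)
    (nhdsWithin (Real.pi / 2) (Set.Iio (Real.pi / 2))) (Set.Ici (9 / 4)) := by
  rw [Metric.tendstoUniformlyOn_iff]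
  intro δ hδ
  have hp := Real.pi_pos
  have h1 : ∀ᶠ c in nhdsWithin (Real.pi / 2) (Set.Iio (Real.pi / 2)), c ∈ Set.Ioo 0 (Real.pi / 2) :=
    Ioo_mem_nhdsLT (by positivity)
  have h2 : ∀ᶠ c in nhdsWithin (Real.pi / 2) (Set.Iio (Real.pi / 2)),
      c ∈ Set.Ioo (Real.pi / 2 - δ / 3) (Real.pi / 2) := Ioo_mem_nhdsLT (by linarith)
  filter_upwards [h1, h2] with c hc hc2 r hr
  have h3 := branch_le hc hr
  have h4 := branch_nonneg hc hr
  rw [dist_comm, Real.dist_eq, sub_zero, abs_of_nonneg h4]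
  linarith [hc2.1]

end Branch

/-! ### The connection form and its curvature -/

section Connection

/-- The function `16 r² - 81` in terms of the ambient coordinates. -/
def uAmb (z : N8) : ℝ := 16 * sqn z * (sqn z + 9 / 2)

/-- The quotient `f_c / ‖x‖²`. -/
def connCoeff (ε : ℝ) (z : N8) : ℝ := 2 / 3 * (sqn z + 9 / 2) * tSol ε (uAmb z)

/-- The ambient connection form. -/
def connA (ε : ℝ) (z : N8) : N8 [⋀^Fin 1]→L[ℝ] ℝ := oneForm (connCoeff ε z • pE 0 z)

theorem sqn_nonneg (z : N8) : 0 ≤ sqn z := sq_nonneg _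

theorem uAmb_nonneg (z : N8) : 0 ≤ uAmb z := by
  have := sqn_nonneg z
  unfold uAmb; positivity

theorem uCoord_radius (m : M7) : uCoord (radius m) = uAmb (incl m) := by
  rw [radius_eq, uCoord, uAmb]; ring

/-- `u = 16|x|²(|x|² + 9/2)` contains the factor `|x|²` needed to turn `η₁⁺` into the smooth
covector `pE`. On the zero section `pE` vanishes, in agreement with the value there by convention.
-/
theorem connectionForm_branch (c : ℝ) :
    connectionForm (branch c) = pull (connA (Real.pi / 2 - c)) := by
  funext m
  by_cases hx : m.1 = 0
  · rw [connectionForm_zeroSection _ _ hx, pull, connA, pE_of_eq_zero (z := incl m) hx, smul_zero]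
    ext v
    simp [oneForm]
  · have hy := incl_snd_ne m
    rw [connectionForm, pull, connA, oneForm_comp, etaP_eq hx, eP_eq 0 hy, branch, uCoord_radius,
      connCoeff, ContinuousLinearMap.smul_comp, ContinuousLinearMap.smul_comp, smul_smul]
    congr 2
    have h0 : sqn (incl m) ≠ 0 := (sqn_pos hx).ne'
    nth_rw 1 [uAmb]
    field_simp
    ring

variable {z : N8} {ε : ℝ}

theorem contDiff_uAmb : ContDiff ℝ ∞ uAmb :=
  (contDiff_const.mul contDiff_sqn).mul (contDiff_sqn.add contDiff_const)

/-- `uAmb` is nonnegative on the whole ambient space, so one-sided smoothness of `tSol` becomes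
smoothness on full neighbourhoods. -/
theorem contDiffAt_tSol_uAmb (hε : ε ∈ Set.Ioo (-(Real.pi / 2)) (Real.pi / 2)) (z : N8) :
    ContDiffAt ℝ ∞ (fun p : ℝ × N8 => tSol p.1 (uAmb p.2)) (ε, z) := by
  have hf : ContDiff ℝ ∞ fun p : ℝ × N8 => (p.1, uAmb p.2) :=
    contDiff_fst.prodMk (contDiff_uAmb.comp contDiff_snd)
  have h := ContDiffWithinAt.comp (s := Set.univ) (f := fun p : ℝ × N8 => (p.1, uAmb p.2)) (ε, z)
    (contDiffWithinAt_tSol hε (uAmb_nonneg z)) hf.contDiffAt.contDiffWithinAt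
    fun p _ => uAmb_nonneg p.2
  exact contDiffWithinAt_univ.1 h

theorem contDiffAt_connCoeff (hε : ε ∈ Set.Ioo (-(Real.pi / 2)) (Real.pi / 2)) (z : N8) :
    ContDiffAt ℝ ∞ (fun p : ℝ × N8 => connCoeff p.1 p.2) (ε, z) :=
  (contDiffAt_const.mul ((contDiff_sqn.comp contDiff_snd).contDiffAt.add contDiffAt_const)).mul
    (contDiffAt_tSol_uAmb hε z)

theorem contDiffAt_connA (hε : ε ∈ Set.Ioo (-(Real.pi / 2)) (Real.pi / 2)) (hy : z.2 ≠ 0) :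
    ContDiffAt ℝ ∞ (fun p : ℝ × N8 => connA p.1 p.2) (ε, z) :=
  contDiffAt_oneForm (contDiffAt_smul_covector (contDiffAt_connCoeff hε z)
    ((contDiffAt_pE 0 hy).comp (ε, z) contDiffAt_snd))

theorem contDiffAt_connA_right (hε : ε ∈ Set.Ioo (-(Real.pi / 2)) (Real.pi / 2)) (hy : z.2 ≠ 0) :
    ContDiffAt ℝ ∞ (connA ε) z :=
  (contDiffAt_connA hε hy).comp z (contDiffAt_const.prodMk contDiffAt_id)

theorem hasFDerivAt_uAmb (z : N8) : HasFDerivAt uAmb ((32 * (9 / 4 + sqn z)) • dsq z) z := by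
  have hs := hasFDerivAt_sqn z
  exact ((hs.const_mul 16).fun_mul (hs.add_const (9 / 2))).congr_fderiv (by module)

/-- The coefficient of `dr` in the derivative of `f_c`. -/
def branchDeriv (ε : ℝ) (z : N8) : ℝ :=
  4 / 3 * (9 / 4 + sqn z) * tSol ε (uAmb z) / (1 + uAmb z / 72 * (1 + tSol ε (uAmb z) ^ 2))

theorem hasFDerivAt_sqn_mul_connCoeff (hε : ε ∈ Set.Ioo (-(Real.pi / 2)) (Real.pi / 2)) (z : N8) :
    HasFDerivAt (fun z => sqn z * connCoeff ε z) (branchDeriv ε z • dsq z) z := by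
  have ht : DifferentiableAt ℝ (fun z => tSol ε (uAmb z)) z :=
    ((contDiffAt_tSol_uAmb hε z).comp z (contDiffAt_const.prodMk contDiffAt_id)).differentiableAt
      (by simp)
  have hu := hasFDerivAt_uAmb z
  have h1 : HasFDerivAt (fun z => Real.arctan (tSol ε (uAmb z)) + uAmb z * 72⁻¹ * tSol ε (uAmb z))
    _ z := ht.hasFDerivAt.arctan.fun_add ((hu.mul_const (72⁻¹ : ℝ)).fun_mul ht.hasFDerivAt)
  have h2 : (fun z => Real.arctan (tSol ε (uAmb z)) + uAmb z * 72⁻¹ * tSol ε (uAmb z)) =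
      fun _ => ε := funext fun z => gFun_tSol hε (uAmb_nonneg z)
  rw [h2] at h1
  have h3 := h1.unique (hasFDerivAt_const ε z)
  have h4 : HasFDerivAt (fun z => uAmb z * 24⁻¹ * tSol ε (uAmb z)) _ z :=
    (hu.mul_const (24⁻¹ : ℝ)).fun_mul ht.hasFDerivAt
  have h5 : (fun z => sqn z * connCoeff ε z) = fun z => uAmb z * 24⁻¹ * tSol ε (uAmb z) := by
    funext z; rw [connCoeff]; nth_rw 2 [uAmb]; ring
  rw [h5]
  refine h4.congr_fderiv (ContinuousLinearMap.ext fun v => ?_)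
  have h6 := congrArg (fun l : N8 →L[ℝ] ℝ => l v) h3
  have hu0 := uAmb_nonneg z
  simp only [add_apply, smul_apply, smul_eq_mul, zero_apply, branchDeriv] at h6 ⊢
  generalize fderiv ℝ (fun z => tSol ε (uAmb z)) z v = t' at *
  generalize dsq z v = d at *
  generalize tSol ε (uAmb z) = t at *
  generalize uAmb z = u at *
  have hd : 0 < 1 + u / 72 * (1 + t ^ 2) := by positivity
  have hd2 : 0 < 1 + t ^ 2 := by positivity
  -- The derivative of `t`, solved from the differentiated relation `t'/(1 + t²) + (u't + ut')/72 =
  -- 0` with `u' = 32r`.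
  have h7 : t' * (1 + u / 72 * (1 + t ^ 2)) =
      -(4 / 9 * (1 + t ^ 2) * t * (9 / 4 + sqn z) * d) := by
    field_simp at h6 ⊢
    linarith
  rw [div_mul_eq_mul_div, eq_div_iff hd.ne']
  linear_combination u / 24 * h7

/-- With `f = ut/24` the bracket equals `(u/8)(1 + (u/72)(1 + t²))`, which cancels the denominator
of `f'`. -/
theorem branch_ode (ε : ℝ) (z : N8) : branchDeriv ε z *
    ((sqn z * connCoeff ε z) ^ 2 + uAmb z ^ 2 / 576 + uAmb z / 8) =
      4 * (9 / 4 + sqn z) * (sqn z * connCoeff ε z) := by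
  have h5 : sqn z * connCoeff ε z = uAmb z * tSol ε (uAmb z) / 24 := by
    rw [connCoeff]; nth_rw 2 [uAmb]; ring
  have hu0 := uAmb_nonneg z
  rw [h5, branchDeriv]
  generalize tSol ε (uAmb z) = t at *
  generalize uAmb z = u at *
  have hd : 0 < 1 + u / 72 * (1 + t ^ 2) := by positivity
  rw [div_mul_eq_mul_div, div_eq_iff hd.ne']
  ring

theorem extDeriv_connA (hε : ε ∈ Set.Ioo (-(Real.pi / 2)) (Real.pi / 2)) (hx : z.1 ≠ 0)
    (hy : z.2 ≠ 0) : extDeriv (connA ε) z = branchDeriv ε z • wedge2 (dsq z) (eP 0 z)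
      + (-2 * (sqn z * connCoeff ε z)) • (wedge2 (eP 1 z) (eP 2 z) + wedge2 (eM 1 z) (eM 2 z)) := by
  have he : connA ε =ᶠ[nhds z] fun z => oneForm ((sqn z * connCoeff ε z) • eP 0 z) := by
    filter_upwards [eventually_ne hx hy] with w hw
    rw [connA, pE_eq 0 hw.1 hw.2, smul_smul, mul_comm]
  have hd := (contDiffAt_eP 0 hx hy).differentiableAt (by simp)
  rw [he.extDeriv_eq]
  refine (extDeriv_oneForm_smul_apply (hasFDerivAt_sqn_mul_connCoeff hε z) hd).trans ?_
  rw [extDeriv_eP hx hy 0]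
  ext v
  simp only [wedge2_apply, smul_apply, ContinuousAlternatingMap.add_apply,
    ContinuousAlternatingMap.smul_apply, smul_eq_mul, show (0 + 1 : Fin 3) = 1 from rfl,
    show (0 + 2 : Fin 3) = 2 from rfl]
  ring

theorem hasFDerivAt_adm_of_eq_zero (hx : z.1 = 0) (a i : Fin 3) :
    HasFDerivAt (fun z : N8 => adm a i z.1) (0 : N8 →L[ℝ] ℝ) z := by
  have h1 : HasFDerivAt (fun z : N8 => star z.1) _ z :=
    (contDiff_star_fst.contDiffAt.differentiableAt (by simp)).hasFDerivAt
  have h2 := ((hasFDerivAt_fst (𝕜 := ℝ) (p := z)).mul_const' (T i)).mul' h1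
  have h3 := (innerSL ℝ (T a)).hasFDerivAt.comp z h2
  refine h3.congr_fderiv (ContinuousLinearMap.ext fun v => ?_)
  simp [hx]

section

variable {E : Type*} [NormedAddCommGroup E] [NormedSpace ℝ E] {z : E}

theorem extDeriv_oneForm_smul_of_eq_zero {f : E → ℝ} {f' : E →L[ℝ] ℝ} {a : E → E →L[ℝ] ℝ}
    (hf : HasFDerivAt f f' z) (hf' : f' = 0) (h0 : f z = 0) (ha : DifferentiableAt ℝ a z) :
    extDeriv (fun z => oneForm (f z • a z)) z = 0 := by
  rw [extDeriv_oneForm_smul_apply hf ha, h0, hf', zero_smul, add_zero]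
  ext v
  simp [wedge2_apply]

theorem extDeriv_oneForm_add_smul {l a b c : E → E →L[ℝ] ℝ} (s : ℝ) (hl : DifferentiableAt ℝ l z)
    (ha : DifferentiableAt ℝ a z) (hb : DifferentiableAt ℝ b z) (hc : DifferentiableAt ℝ c z) :
    extDeriv (fun z => oneForm (l z + s • (a z + b z + c z))) z =
      extDeriv (fun z => oneForm (l z)) z + s • (extDeriv (fun z => oneForm (a z)) z
        + extDeriv (fun z => oneForm (b z)) z + extDeriv (fun z => oneForm (c z)) z) := by
  have h := hl.hasFDerivAt.fun_add (((ha.hasFDerivAt.fun_add hb.hasFDerivAt).fun_add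
    hc.hasFDerivAt).fun_const_smul s)
  ext v
  simp only [ContinuousAlternatingMap.add_apply, ContinuousAlternatingMap.smul_apply]
  rw [extDeriv_oneForm_apply h.differentiableAt, h.fderiv, extDeriv_oneForm_apply hl,
    extDeriv_oneForm_apply ha, extDeriv_oneForm_apply hb, extDeriv_oneForm_apply hc]
  simp
  ring

end

theorem extDeriv_pE_of_eq_zero (hx : z.1 = 0) (hy : z.2 ≠ 0) :
    extDeriv (fun z => oneForm (pE 0 z)) z =
      (2 : ℝ) • (wedge2 (cx 0) (cx 1) - wedge2 (cx 2) (cx 3)) := by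
  have hl : DifferentiableAt ℝ (lf 0) z := (contDiff_lf 0).contDiffAt.differentiableAt (by simp)
  have hn := fun a => (contDiffAt_nu a hy).differentiableAt (by simp)
  have hd : ∀ a, DifferentiableAt ℝ (fun z => adm a 0 z.1 • nu a z) z := fun a =>
    (contDiffAt_smul_covector (contDiff_adm a 0).contDiffAt
      (contDiffAt_nu a hy)).differentiableAt (by simp)
  have h0 : ∀ a, extDeriv (fun z => oneForm (adm a 0 z.1 • nu a z)) z = 0 := fun a =>
    extDeriv_oneForm_smul_of_eq_zero (hasFDerivAt_adm_of_eq_zero hx a 0) rfl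
      (adm_of_eq_zero hx a 0) (hn a)
  have h := extDeriv_oneForm_add_smul (1 / 2) hl (hd 0) (hd 1) (hd 2)
  rw [h0, h0, h0, add_zero, add_zero, smul_zero, add_zero, extDeriv_lf_zero] at h
  exact h

/-- At `x = 0` the coefficient is not differentiated because `pE` vanishes, and `dpE = d(lf)`
because `adm` is quadratic in `x`. -/
theorem extDeriv_connA_of_eq_zero (hε : ε ∈ Set.Ioo (-(Real.pi / 2)) (Real.pi / 2)) (hx : z.1 = 0)
    (hy : z.2 ≠ 0) : extDeriv (connA ε) z =
      (connCoeff ε z * 2) • (wedge2 (cx 0) (cx 1) - wedge2 (cx 2) (cx 3)) := by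
  have hd : DifferentiableAt ℝ (connCoeff ε) z :=
    ((contDiffAt_connCoeff hε z).comp z (contDiffAt_const.prodMk contDiffAt_id)).differentiableAt
      (by simp)
  refine (extDeriv_oneForm_smul_apply hd.hasFDerivAt
    ((contDiffAt_pE 0 hy).differentiableAt (by simp))).trans ?_
  rw [extDeriv_pE_of_eq_zero hx hy, pE_of_eq_zero hx, smul_smul]
  ext v
  simp [wedge2_apply]

end Connection

/-! ### The deformed instanton equation -/

section Instanton

variable {V : Type*} [AddCommGroup V] [Module ℝ V] [TopologicalSpace V]

theorem wedge_sub_left {k l : ℕ} (α α' : V [⋀^Fin k]→L[ℝ] ℝ) (β : V [⋀^Fin l]→L[ℝ] ℝ) :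
    wedge (α - α') β = wedge α β - wedge α' β := by
  rw [eq_sub_iff_add_eq, ← wedge_add_left, sub_add_cancel]

theorem wedge_sub_right {k l : ℕ} (α : V [⋀^Fin k]→L[ℝ] ℝ) (β β' : V [⋀^Fin l]→L[ℝ] ℝ) :
    wedge α (β - β') = wedge α β - wedge α β' := by
  rw [eq_sub_iff_add_eq, ← wedge_add_right, sub_add_cancel]

theorem covectorWedge_six_eq_zero {a b c d e f : V →L[ℝ] ℝ}
    (h : a = b ∨ a = c ∨ a = d ∨ a = e ∨ a = f ∨ b = c ∨ b = d ∨ b = e ∨ b = f ∨ c = d ∨ c = e ∨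
      c = f ∨ d = e ∨ d = f ∨ e = f) : covectorWedge ![a, b, c, d, e, f] = 0 := by
  rcases h with h | h | h | h | h | h | h | h | h | h | h | h | h | h | h
  exacts [covectorWedge_eq_zero 0 1 (by decide) h, covectorWedge_eq_zero 0 2 (by decide) h,
    covectorWedge_eq_zero 0 3 (by decide) h, covectorWedge_eq_zero 0 4 (by decide) h,
    covectorWedge_eq_zero 0 5 (by decide) h, covectorWedge_eq_zero 1 2 (by decide) h,
    covectorWedge_eq_zero 1 3 (by decide) h, covectorWedge_eq_zero 1 4 (by decide) h,
    covectorWedge_eq_zero 1 5 (by decide) h, covectorWedge_eq_zero 2 3 (by decide) h,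
    covectorWedge_eq_zero 2 4 (by decide) h, covectorWedge_eq_zero 2 5 (by decide) h,
    covectorWedge_eq_zero 3 4 (by decide) h, covectorWedge_eq_zero 3 5 (by decide) h,
    covectorWedge_eq_zero 4 5 (by decide) h]

theorem covectorWedge_swap_pairs_left (a b c d e f : V →L[ℝ] ℝ) :
    covectorWedge ![c, d, a, b, e, f] = covectorWedge ![a, b, c, d, e, f] := by
  have h := covectorWedge_perm ![a, b, c, d, e, f] (Equiv.swap 0 2 * Equiv.swap 1 3)
  have h2 : (Equiv.Perm.sign (Equiv.swap (0 : Fin 6) 2 * Equiv.swap 1 3) : ℤ) = 1 := by decide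
  rw [← Int.cast_inj (α := ℝ)] at h2
  push_cast at h2
  rw [h2, one_smul] at h
  rw [← h]
  congr 1; ext i : 1; fin_cases i <;> rfl

theorem covectorWedge_swap_pairs_right (a b c d e f : V →L[ℝ] ℝ) :
    covectorWedge ![a, b, e, f, c, d] = covectorWedge ![a, b, c, d, e, f] := by
  have h := covectorWedge_perm ![a, b, c, d, e, f] (Equiv.swap 2 4 * Equiv.swap 3 5)
  have h2 : (Equiv.Perm.sign (Equiv.swap (2 : Fin 6) 4 * Equiv.swap 3 5) : ℤ) = 1 := by decide
  rw [← Int.cast_inj (α := ℝ)] at h2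
  push_cast at h2
  rw [h2, one_smul] at h
  rw [← h]
  congr 1; ext i : 1; fin_cases i <;> rfl

theorem covectorWedge_shuffle (a b c d e f : V →L[ℝ] ℝ) :
    covectorWedge ![a, b, e, c, f, d] = -covectorWedge ![a, b, c, d, e, f] := by
  have h := covectorWedge_perm ![a, b, c, d, e, f]
    (Equiv.swap 2 4 * Equiv.swap 4 5 * Equiv.swap 3 5)
  have h2 : (Equiv.Perm.sign (Equiv.swap (2 : Fin 6) 4 * Equiv.swap 4 5 * Equiv.swap 3 5) : ℤ) =
      -1 := by decide
  rw [← Int.cast_inj (α := ℝ)] at h2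
  push_cast at h2
  rw [h2] at h
  have h3 : (-1 : ℝ) • covectorWedge ![a, b, c, d, e, f] = -covectorWedge ![a, b, c, d, e, f] := by
    ext v; simp
  rw [← h3, ← h]
  congr 1; ext i : 1; fin_cases i <;> rfl

/-- Every 6-form that occurs is a multiple of `d p₀ p₁ p₂ m₁ m₂` or repeats a covector. Hence `k₁`
and `k₄` play no role, `F³/6` contributes `4g²l`, and the equation becomes the scalar condition
`hk`. -/
theorem deformed_identity (d p₀ p₁ p₂ m₀ m₁ m₂ : V →L[ℝ] ℝ) {l g k₁ k₂ k₃ k₄ k₅ : ℝ}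
    (hk : 4 * g ^ 2 * l + l * k₂ = 2 * g * (k₅ - k₃)) {F : V [⋀^Fin 2]→L[ℝ] ℝ}
    (hF : F = l • wedge2 d p₀ + (-2 * g) • (wedge2 p₁ p₂ + wedge2 m₁ m₂))
    {Ψ : V [⋀^Fin 4]→L[ℝ] ℝ}
    (hΨ : ∀ v, Ψ v = k₁ * (wedge4 m₀ p₀ m₁ p₁ v + wedge4 m₀ p₀ m₂ p₂ v)
        + k₂ * wedge4 m₁ p₁ m₂ p₂ v + k₃ * wedge4 d p₀ p₁ p₂ v
        - k₄ * (wedge4 d m₀ m₁ p₂ v + wedge4 d m₀ p₁ m₂ v) - k₅ * wedge4 d p₀ m₁ m₂ v) :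
    (1 / 6 : ℝ) • (wedge (wedge F F) F : V [⋀^Fin 6]→L[ℝ] ℝ) -
      (wedge F Ψ : V [⋀^Fin 6]→L[ℝ] ℝ) = 0 := by
  have hΨ' : Ψ = k₁ • (wedge4 m₀ p₀ m₁ p₁ + wedge4 m₀ p₀ m₂ p₂) + k₂ • wedge4 m₁ p₁ m₂ p₂
        + k₃ • wedge4 d p₀ p₁ p₂ - k₄ • (wedge4 d m₀ m₁ p₂ + wedge4 d m₀ p₁ m₂)
        - k₅ • wedge4 d p₀ m₁ m₂ :=
    ContinuousAlternatingMap.ext hΨ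
  have hFF : (wedge F F : V [⋀^Fin 4]→L[ℝ] ℝ) =
      (-4 * g * l) • (wedge4 d p₀ p₁ p₂ + wedge4 d p₀ m₁ m₂)
        + (8 * g ^ 2) • wedge4 p₁ p₂ m₁ m₂ := by
    rw [hF]
    simp only [wedge_add_left, wedge_add_right, wedge_smul_left, wedge_smul_right, wedge2_wedge2]
    ext v
    simp only [wedge4_apply, ContinuousAlternatingMap.add_apply,
      ContinuousAlternatingMap.smul_apply, smul_eq_mul]
    ring
  have hFFF : (wedge (wedge F F) F : V [⋀^Fin 6]→L[ℝ] ℝ) =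
      (24 * g ^ 2 * l) • covectorWedge ![d, p₀, p₁, p₂, m₁, m₂] := by
    rw [hFF, hF]
    simp only [wedge_add_left, wedge_add_right, wedge_smul_left, wedge_smul_right, wedge4_wedge2]
    rw [covectorWedge_swap_pairs_right d p₀ p₁ p₂ m₁ m₂,
      covectorWedge_swap_pairs_right p₁ p₂ d p₀ m₁ m₂,
      covectorWedge_swap_pairs_left d p₀ p₁ p₂ m₁ m₂]
    simp only [covectorWedge_six_eq_zero, true_or, or_true]
    module
  rw [hFFF, hΨ', hF]
  simp only [wedge_sub_right, wedge_add_left, wedge_add_right, wedge_smul_left,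
    wedge_smul_right, wedge2_wedge4]
  rw [covectorWedge_swap_pairs_left d p₀ m₁ m₂ p₁ p₂,
    covectorWedge_swap_pairs_right d p₀ p₁ p₂ m₁ m₂,
    covectorWedge_swap_pairs_left d p₀ p₁ p₂ m₁ m₂, covectorWedge_shuffle d p₀ p₁ p₂ m₁ m₂]
  simp only [covectorWedge_six_eq_zero, true_or, or_true]
  have hk' : 4 * g ^ 2 * l + l * k₂ + 2 * g * k₃ - 2 * g * k₅ = 0 := by linarith
  refine Eq.trans ?_ ((congrArg (· • covectorWedge ![d, p₀, p₁, p₂, m₁, m₂]) hk').trans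
    (zero_smul ℝ _))
  module

/-- `F` involves only the four covectors `x_i`, so its cube and its product with `x₀x₁x₂x₃` vanish;
being anti-self-dual, it is also annihilated by the self-dual factors of the other terms. -/
theorem deformed_identity_of_eq_zero (x₀ x₁ x₂ x₃ n₀ n₁ n₂ : V →L[ℝ] ℝ) {l k₁ k₂ : ℝ}
    {F : V [⋀^Fin 2]→L[ℝ] ℝ} (hF : F = l • (wedge2 x₀ x₁ - wedge2 x₂ x₃))
    {Ψ : V [⋀^Fin 4]→L[ℝ] ℝ} (hΨ : Ψ = k₁ • wedge4 x₀ x₁ x₂ x₃ -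
      k₂ • (wedge4 x₀ x₁ n₁ n₂ + wedge4 x₂ x₃ n₁ n₂ + wedge4 x₀ x₂ n₂ n₀
        + wedge4 x₃ x₁ n₂ n₀ + wedge4 x₀ x₃ n₀ n₁ + wedge4 x₁ x₂ n₀ n₁)) :
    (1 / 6 : ℝ) • (wedge (wedge F F) F : V [⋀^Fin 6]→L[ℝ] ℝ) -
      (wedge F Ψ : V [⋀^Fin 6]→L[ℝ] ℝ) = 0 := by
  have hFF : (wedge F F : V [⋀^Fin 4]→L[ℝ] ℝ) = (-2 * l ^ 2) • wedge4 x₀ x₁ x₂ x₃ := by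
    rw [hF]
    simp only [wedge_sub_left, wedge_sub_right, wedge_smul_left, wedge_smul_right, wedge2_wedge2]
    ext v
    simp only [wedge4_apply, ContinuousAlternatingMap.sub_apply,
      ContinuousAlternatingMap.smul_apply, smul_eq_mul]
    ring
  have hFFF : (wedge (wedge F F) F : V [⋀^Fin 6]→L[ℝ] ℝ) = 0 := by
    rw [hFF, hF]
    simp only [wedge_sub_right, wedge_smul_left, wedge_smul_right, wedge4_wedge2]
    simp only [covectorWedge_six_eq_zero, true_or, or_true]
    simp
  rw [hFFF, hΨ, hF]
  simp only [wedge_sub_left, wedge_sub_right, wedge_add_right, wedge_smul_left,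
    wedge_smul_right, wedge2_wedge4]
  rw [covectorWedge_swap_pairs_left x₀ x₁ x₂ x₃ n₁ n₂]
  simp only [covectorWedge_six_eq_zero, true_or, or_true]
  module

theorem smul_sub_comp_eq_zero {W : Type*} [AddCommGroup W] [Module ℝ W] [TopologicalSpace W]
    (L : W →L[ℝ] V) {k : ℕ} {c : ℝ} {α β : V [⋀^Fin k]→L[ℝ] ℝ} (h : c • α - β = 0) :
    c • α.compContinuousLinearMap L - β.compContinuousLinearMap L = 0 := by
  ext v
  exact congrArg (fun γ : V [⋀^Fin k]→L[ℝ] ℝ => γ (L ∘ v)) h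

theorem deformed_comp {W : Type*} [AddCommGroup W] [Module ℝ W] [TopologicalSpace W] (L : W →L[ℝ] V)
    {F : V [⋀^Fin 2]→L[ℝ] ℝ} {Ψ : V [⋀^Fin 4]→L[ℝ] ℝ} {F' : W [⋀^Fin (1 + 1)]→L[ℝ] ℝ}
    {Ψ' : W [⋀^Fin 4]→L[ℝ] ℝ} (hF : F' = F.compContinuousLinearMap L)
    (hΨ : Ψ' = Ψ.compContinuousLinearMap L)
    (h : (1 / 6 : ℝ) • (wedge (wedge F F) F : V [⋀^Fin 6]→L[ℝ] ℝ) -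
      (wedge F Ψ : V [⋀^Fin 6]→L[ℝ] ℝ) = 0) :
    (1 / 6 : ℝ) • (wedge (wedge F' F') F' : W [⋀^Fin 6]→L[ℝ] ℝ) -
      (wedge F' Ψ' : W [⋀^Fin 6]→L[ℝ] ℝ) = 0 := by
  have h1 : (wedge F' Ψ' : W [⋀^Fin 6]→L[ℝ] ℝ) =
      (wedge F Ψ : V [⋀^Fin 6]→L[ℝ] ℝ).compContinuousLinearMap L := by
    subst hF hΨ; exact (wedge_comp F Ψ L).symm
  have h2 : (wedge (wedge F' F') F' : W [⋀^Fin 6]→L[ℝ] ℝ) =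
      (wedge (wedge F F) F : V [⋀^Fin 6]→L[ℝ] ℝ).compContinuousLinearMap L := by
    subst hF
    refine Eq.trans ?_ (wedge_comp _ F L).symm
    rw [wedge_comp]
  generalize (wedge F' Ψ' : W [⋀^Fin 6]→L[ℝ] ℝ) = β' at *
  generalize (wedge (wedge F' F') F' : W [⋀^Fin 6]→L[ℝ] ℝ) = α' at *
  generalize (wedge F Ψ : V [⋀^Fin 6]→L[ℝ] ℝ) = β at *
  generalize (wedge (wedge F F) F : V [⋀^Fin 6]→L[ℝ] ℝ) = α at *
  subst h1 h2
  exact smul_sub_comp_eq_zero L h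

end Instanton

/-! ### Smooth dependence on the parameter and the limit `c → π/2` -/

section Parameter

variable {P E F : Type*} [NormedAddCommGroup P] [NormedSpace ℝ P] [NormedAddCommGroup E]
  [NormedSpace ℝ E] [NormedAddCommGroup F] [NormedSpace ℝ F]

/-- Induction on the order: the partial derivative in `z` of a jointly smooth map is jointly smooth.
-/
theorem contDiffAt_iteratedFDeriv_parameter {G : P → E → F} {p : P} {z : E}
    (h : ContDiffAt ℝ ∞ (fun q : P × E => G q.1 q.2) (p, z)) (n : ℕ) :
    ContDiffAt ℝ ∞ (fun q : P × E => iteratedFDeriv ℝ n (G q.1) q.2) (p, z) := by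
  induction n with
  | zero =>
    exact (continuousMultilinearCurryFin0 ℝ E F).symm.contDiff.contDiffAt.comp (p, z) h
  | succ n ih =>
    have h1 : ContDiffAt ℝ ∞ (Function.uncurry fun (q : P × E) (w : E) =>
        iteratedFDeriv ℝ n (G q.1) w) ((p, z), z) :=
      ContDiffAt.comp (g := fun q : P × E => iteratedFDeriv ℝ n (G q.1) q.2)
        (f := fun q : (P × E) × E => (q.1.1, q.2)) ((p, z), z) ih
        ((contDiff_fst.comp contDiff_fst).prodMk contDiff_snd).contDiffAt
    have h2 := ContDiffAt.fderiv (m := ∞) (x₀ := (p, z)) (g := Prod.snd) h1 contDiffAt_snd (by simp)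
    exact (continuousMultilinearCurryLeftEquiv ℝ
      (fun _ : Fin (n + 1) => E) F).symm.contDiff.contDiffAt.comp (p, z) h2

/-- Joint continuity of the derivatives gives convergence uniformly near each point of `K`;
compactness makes it uniform on `K`. -/
theorem tendstoUniformlyOn_iteratedFDeriv_parameter {G : P → E → F} {p : P} {K : Set E}
    (hK : IsCompact K)
    (h : ∀ z ∈ K, ContDiffAt ℝ ∞ (fun q : P × E => G q.1 q.2) (p, z)) (n : ℕ) :
    TendstoUniformlyOn (fun q => iteratedFDeriv ℝ n (G q)) (iteratedFDeriv ℝ n (G p))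
      (nhds p) K := by
  rw [← tendstoLocallyUniformlyOn_iff_tendstoUniformlyOn_of_compact hK,
    Metric.tendstoLocallyUniformlyOn_iff]
  intro δ hδ z hz
  have hc := (contDiffAt_iteratedFDeriv_parameter (h z hz) n).continuousAt
  have h1 := Metric.continuousAt_iff'.1 hc (δ / 2) (half_pos hδ)
  rw [nhds_prod_eq] at h1
  obtain ⟨A, hA, B, hB, hAB⟩ := Filter.eventually_prod_iff.1 h1
  refine ⟨{y | B y}, mem_nhdsWithin_of_mem_nhds hB, ?_⟩
  filter_upwards [hA] with q hq y hy
  have d1 := hAB hq hy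
  have d2 := hAB hA.self_of_nhds hy
  calc _ ≤ _ := dist_triangle_right _ _ (iteratedFDeriv ℝ n (G p) z)
    _ < δ / 2 + δ / 2 := add_lt_add d2 d1
    _ = δ := by ring

end Parameter

variable {ε : ℝ}

theorem contDiffAt_chartRep_connA (hε : ε ∈ Set.Ioo (-(Real.pi / 2)) (Real.pi / 2)) {m₀ : M7}
    {z : E7} (hz : z ∈ (extChartAt I7 m₀).target) :
    ContDiffAt ℝ ∞ (fun p : ℝ × E7 => chartRep (pull (connA p.1)) m₀ p.2) (ε, z) := by
  have h := contDiffAt_inclRep hz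
  have h1 : ContDiffAt ℝ ∞ (fun p : ℝ × E7 => connA p.1 (inclRep m₀ p.2)) (ε, z) :=
    ContDiffAt.comp (g := fun p : ℝ × N8 => connA p.1 p.2)
      (f := fun p : ℝ × E7 => (p.1, inclRep m₀ p.2)) (ε, z) (contDiffAt_connA hε (incl_snd_ne _))
      (contDiffAt_fst.prodMk (ContDiffAt.comp (g := inclRep m₀) (ε, z) h contDiffAt_snd))
  have h2 : ContDiffAt ℝ ∞ (fun p : ℝ × E7 => fderiv ℝ (inclRep m₀) p.2) (ε, z) :=
    (h.fderiv_right (m := ∞) (by simp)).comp (ε, z) contDiffAt_snd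
  refine (contDiffAt_compContinuousAlternating h1 h2).congr_of_eventuallyEq ?_
  have h3 : ∀ᶠ p : ℝ × E7 in nhds (ε, z), p.2 ∈ (extChartAt I7 m₀).target :=
    continuous_snd.continuousAt.eventually ((isOpen_extChartAt_target m₀).mem_nhds hz)
  filter_upwards [h3] with p hp
  exact chartRep_pull _ hp

theorem pull_connA_zero : pull (connA 0) = 0 := by
  funext m
  ext v
  simp [pull, connA, connCoeff, tSol_zero (uAmb_nonneg _), oneForm]

/-- Here `ε = π/2 - c → 0`, and the family in `ε` is smooth through `ε = 0`, where `t = 0` makes the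
connection vanish identically. -/
theorem convergesSmoothly_branch : ConvergesSmoothly (fun c => connectionForm (branch c))
    (nhdsWithin (Real.pi / 2) (Set.Iio (Real.pi / 2))) 0 := by
  intro m₀ K hK hKt n
  have h := tendstoUniformlyOn_iteratedFDeriv_parameter (p := (0 : ℝ))
    (G := fun ε => chartRep (pull (connA ε)) m₀) hK
    (fun z hz => contDiffAt_chartRep_connA ⟨by linarith [Real.pi_pos], by linarith [Real.pi_pos]⟩
      (hKt hz)) n
  rw [pull_connA_zero] at h
  simp only [connectionForm_branch]
  have ht : Filter.Tendsto (fun c => Real.pi / 2 - c)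
      (nhdsWithin (Real.pi / 2) (Set.Iio (Real.pi / 2))) (nhds 0) := by
    have : Filter.Tendsto (fun c => Real.pi / 2 - c) (nhds (Real.pi / 2)) (nhds 0) :=
      Continuous.tendsto' (by fun_prop) _ _ (sub_self _)
    exact this.mono_left nhdsWithin_le_nhds
  exact fun u hu => ht.eventually (h u hu)

theorem isDeformedG2Instanton_branch {c : ℝ} (hc : c ∈ Set.Ioo 0 (Real.pi / 2)) :
    IsDeformedG2Instanton (pull psiA) (connectionForm (branch c)) := by
  have hε := Ioo_zero_subset (sub_mem_Ioo hc)
  rw [connectionForm_branch]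
  generalize Real.pi / 2 - c = ε at hε ⊢
  refine ⟨smoothForm_pull fun m => contDiffAt_connA_right hε (incl_snd_ne m), fun m => ?_⟩
  have hy := incl_snd_ne m
  obtain ⟨J, hJ⟩ : ∃ J : TangentSpace I7 m →L[ℝ] N8, J = differential incl m := ⟨_, rfl⟩
  have hψ : pull psiA m = (psiA (incl m)).compContinuousLinearMap J := by rw [hJ]; rfl
  have hF : extD (pull (connA ε)) m = (extDeriv (connA ε) (incl m)).compContinuousLinearMap J := by
    rw [hJ]
    exact extD_pull ((contDiffAt_connA_right hε hy).differentiableAt (by simp))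
  by_cases hx : m.1 = 0
  · rw [extDeriv_connA_of_eq_zero (z := incl m) hε hx hy] at hF
    exact deformed_comp J hF hψ (deformed_identity_of_eq_zero _ _ _ _ _ _ _ rfl
      (psiA_zeroSection (z := incl m) hx hy))
  · rw [extDeriv_connA (z := incl m) hε hx hy] at hF
    -- With the coefficients of `psiEta`, `k₅ - k₃ = 8r` and `k₂ = 4(u²/576 + u/8)`, so the scalar
    -- condition is four times `branch_ode`.
    have hη := psiA_eq (z := incl m) hx hy
    refine deformed_comp J hF hψ (deformed_identity _ _ _ _ _ _ _ ?_ rfl fun v => by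
      rw [hη, psiEta_apply])
    have h := branch_ode ε (incl m)
    have hu : uAmb (incl m) = 16 * (9 / 4 + sqn (incl m)) ^ 2 - 81 := by rw [uAmb]; ring
    rw [hu] at h
    linear_combination 4 * h

end BGGG

end

theorem mainTheorem1 :
    ∃ (φ : BGGG.DForm 3) (ψ : BGGG.DForm 4),
      BGGG.IsTorsionFreeG2 φ ψ ∧
      (∀ m : BGGG.M7, m.1 ≠ 0 → φ m = BGGG.phi m ∧ ψ m = BGGG.psi m) ∧
      ∃ f : ℝ → ℝ → ℝ,
        (∀ c ∈ Set.Ioo (0 : ℝ) (Real.pi / 2),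
          BGGG.IsBranch c (f c) ∧
          (∀ g : ℝ → ℝ, BGGG.IsBranch c g → Set.EqOn g (f c) (Set.Ici (9 / 4))) ∧
          (∀ r : ℝ, 9 / 4 ≤ r → 0 ≤ f c r) ∧
          Filter.Tendsto (f c) Filter.atTop (nhds (3 * Real.pi / 2 - 3 * c)) ∧
          BGGG.IsDeformedG2Instanton ψ (BGGG.connectionForm (f c))) ∧
        TendstoUniformlyOn f (fun _ => 0) (nhdsWithin (Real.pi / 2) (Set.Iio (Real.pi / 2)))
          (Set.Ici (9 / 4)) ∧
        BGGG.ConvergesSmoothly (fun c => BGGG.connectionForm (f c))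
          (nhdsWithin (Real.pi / 2) (Set.Iio (Real.pi / 2))) 0 :=
  ⟨BGGG.pull BGGG.phiA, BGGG.pull BGGG.psiA, BGGG.isTorsionFreeG2,
    fun _ hx => ⟨(BGGG.phi_eq hx).symm, (BGGG.psi_eq hx).symm⟩, BGGG.branch,
    fun _ hc => ⟨BGGG.isBranch_branch hc, fun _ hg => hg.eqOn hc,
      fun _ hr => BGGG.branch_nonneg hc hr, BGGG.tendsto_branch hc,
      BGGG.isDeformedG2Instanton_branch hc⟩,
    BGGG.tendstoUniformlyOn_branch, BGGG.convergesSmoothly_branch⟩
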